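/- For $v\in\mathbb{R}^n$ and $p>0$ let $\|v\|_p=(\sum_{i}|v_i|^p)^{1/p}$, let $\|v\|_0$ be the number of non-zero coordinates of $v$, and for $s\in\{0,1\}^n$ let $v\circ s$ be the coordinatewise product. A turnstile stream $\langle(a_1,\Delta_1),\dots,(a_m,\Delta_m)\rangle$ with $(a_j,\Delta_j)\in[n]\times\{-1,1\}$ represents the vector $v=\sum_{j}\Delta_j e_{a_j}$. A randomized one-pass algorithm using $S$ bits of space has at most $2^S$ memory contents: the initial one is random, each update $(a_j,\Delta_j)$ replaces the current one by a random one whose distribution depends only on the current content and on $(a_j,\Delta_j)$, and the final content determines a function $F:\{0,1\}^n\to\mathbb{R}$. The function $F$ is evaluated at $s$ within the same space: starting from the final content, each step depends on the current content only and either halts with the value $F(s)$ or reads one coordinate of $s$ (given as read-only input) and moves to a new content that depends on that bit. Random choices that are needed again later have to be stored. The model is non-uniform: the algorithm may depend on $n$, $p$, $\epsilon$ and the bound on the stream length, and only memory is charged. **Theorem.** Let $p\ge 0$ be real and let $c\in\mathbb{N}$. There are constants $C$ and $d$, depending only on $p$ and $c$, such that for every $n\ge 1$ and every $\epsilon\in(0,1)$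 there is a randomized one-pass algorithm with the following property. For every turnstile stream of length $m\le c\,n^c$, with accumulated vector $v\in\mathbb{R}^n$, and for each $s\in\{0,1\}^n$, the output function $F:\{0,1\}^n\to\mathbb{R}$ satisfies $$\bigl|F(s)-\|v\circ s\|_p\bigr|\le\epsilon\,\|v\|_p$$ with probability at least $0.9$ over the randomness of the algorithm. The space, in bits, used by the algorithm and by the evaluation of $F$ is at most $C\,\epsilon^{-4}\log^{d}(2n/\epsilon)$ if $0\le p\le 2$, and at most $C\,\epsilon^{-4}\,n^{1-2/p}\log^{d}(2n/\epsilon)$ if $p>2$. -/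

import Mathlib

namespace SubsetNorm

/-- `‖v‖_p = (∑ |v i| ^ p) ^ (1 / p)` for `p > 0`; `‖v‖_0` is the number of non-zero coordinates. -/
noncomputable def lpNorm {n : ℕ} (p : ℝ) (v : Fin n → ℝ) : ℝ :=
  if p = 0 then ((Finset.univ.filter fun i => v i ≠ 0).card : ℝ)
  else (∑ i, |v i| ^ p) ^ (1 / p)

/-- The Hadamard product `v ∘ s` of `v` with the binary vector `s`. -/
def restrict {n : ℕ} (v : Fin n → ℝ) (s : Fin n → Bool) : Fin n → ℝ :=
  fun i => if s i then v i else 0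

/-- A turnstile update `(a, Δ)`: a coordinate `a` and an increment `Δ ∈ {-1, 1}`. -/
abbrev Update (n : ℕ) : Type := Fin n × ℤˣ

/-- The vector `∑ j, Δ_j • e_{a_j}` accumulated by a stream of updates. -/
def accumulated {n : ℕ} (σ : List (Update n)) : Fin n → ℝ :=
  (σ.map fun u => Pi.single u.1 (((u.2 : ℤˣ) : ℤ) : ℝ)).sum

/-- A randomized one-pass turnstile streaming algorithm for vectors of dimension `n` that answers
queries `s ∈ {0,1}^n`, given by its memory contents.

All that persists from one step to the next, random seeds and work space of the query phase
included, has to be part of the memory content. Randomness is private: an outcome that is needed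
again later has to be stored.

* `init` draws the initial memory content.
* `update u m` draws the memory content that follows `m` when the update `u` is read.
* `query m` is one step of the evaluation of the answer function: either it halts with an answer,
  or it names a coordinate `i` of the read-only query vector `s`, together with the memory content
  with which to go on, as a function of the bit `s i`. -/
structure StreamAlg (n : ℕ) where
  Mem : Type
  [fintypeMem : Fintype Mem]
  init : PMF Mem
  update : Update n → Mem → PMF Mem
  query : Mem → ℝ ⊕ (Fin n × (Bool → Mem))

attribute [instance] StreamAlg.fintypeMem

namespace StreamAlg

variable {n : ℕ} (A : StreamAlg n)

/-- The number of bits of memory: `⌈log₂ |Mem|⌉`. -/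
def space : ℕ := Nat.clog 2 (Fintype.card A.Mem)

/-- The distribution of the memory content after a single pass over the stream `σ`. -/
noncomputable def final (σ : List (Update n)) : PMF A.Mem :=
  σ.foldl (fun μ u => μ.bind (A.update u)) A.init

/-- On the query `s`, the evaluation that starts from the memory content `m` halts with
answer `y`. -/
inductive Answers (s : Fin n → Bool) : A.Mem → ℝ → Prop
  | halt {m : A.Mem} {y : ℝ} (h : A.query m = Sum.inl y) : Answers s m y
  | read {m : A.Mem} {i : Fin n} {next : Bool → A.Mem} {y : ℝ}
      (h : A.query m = Sum.inr (i, next)) (h' : Answers s (next (s i)) y) : Answers s m y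

/-- From every memory content `m`, the evaluation halts on every query `s`, with answer
`F m s`. -/
def Outputs (F : A.Mem → (Fin n → Bool) → ℝ) : Prop :=
  ∀ m s, A.Answers s m (F m s)

end StreamAlg

end SubsetNorm

/-!
The algorithm is a precision sampling sketch: it draws a small sample of coordinates that does not
depend on the query, with probabilities that are adapted to `v`, and it reads the query on the
sample only.

*Sampling.* Let `q = min p 2` and `p = q ρ`, so that `ρ ≥ 1`. Put `x i = |v i| ^ q` and
`N = ∑ i, x i`. Every coordinate gets a random `u i ∈ (0, 1]`, almost uniform, and the key
`z i = x i / u i`. It reaches a threshold `τ` with probability about `min 1 (x i / τ)`, so the sum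
of `s i * x i ^ ρ / min 1 (x i / τ)` over the coordinates with `z i ≥ τ` is an almost unbiased
estimate of `X = ∑ i, s i * x i ^ ρ = ‖v ∘ s‖_p ^ p`. Its variance is at most `τ * X ^ (2 - 1 / ρ)`
(`variance_sampleSum_le`, `prob_sampleSum`). With `τ` of order `N / k`, where
`k = O(ε⁻² n ^ (1 - 1 / ρ))`, and the power mean inequality `N ≤ n ^ (1 - 1 / ρ) ‖v‖_p ^ q`, the
error is at most `ε ‖v‖_p ^ (p / (2 ρ)) X ^ (1 - 1 / (2 ρ))`, which gives an error `ε ‖v‖_p` for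
`X ^ (1 / p)` (`abs_root_sub_lpNorm_le`). For `p = 0` the same scheme is applied with `ρ = 1` and
an exponent `q` of order `ε / log M`, where `M` bounds the length of the stream: then `|v i| ^ q`
is `0` or close to `1`, as `v` is an integer vector with entries of absolute value at most `M`
(`abs_sub_lpNorm_zero_le`).

*Sketching.* The keys are not known, but `z i = (a i |v i| / K) ^ q` for an integer multiplier
`a i` that determines `u i`; it takes at most `D` values. With high probability the sum of all keys
is `O(N log D)`, so only `O(k log D)` keys reach `τ`, and a count sketch of `(a i v i)` with that
many buckets, up to a factor `η⁻²`, finds each of these keys up to a relative error `O(q η)`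
(`prob_sketchEst`). The threshold itself is the largest power of two for which the sampling
estimate of `N` from the approximate keys is at least `k τ`. A threshold `τ` applied to keys that
are known up to a factor `1 ± δ` is sandwiched between the thresholds `τ / (1 ± δ)` applied to the
exact keys, so the choice of the threshold and the estimate are both controlled by Chebyshev's
inequality for a fixed number of exact estimates (`abs_estimate_sub_le`). Altogether the failure
probability is at most `1 / 160` (`prob_output`).

*Space.* The sketch is linear and is stored modulo a number larger than twice the absolute value of
its entries. Storing the random seed would take more than `n` bits, but Newman's argument replaces
it by an index into a fixed list of `10 n (2 M + 1)` seeds, fewer than a tenth of which are bad for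
any pair of a vector and a query (`exists_seeds`). The query phase stores the bits of the query at
the sampled coordinates (`exists_streamAlg`). Counting the memory contents gives the bound
(`exists_alg_space_le`).
-/

open Finset
open scoped BigOperators

namespace SubsetNorm

/-! ### Finite probability -/

section Expectation

variable {ι α Ω Ω' : Type*} [Fintype ι] [Fintype α] [Fintype Ω] [Fintype Ω']

theorem expect_const_mul (c : ℝ) (f : Ω → ℝ) : 𝔼 ω, c * f ω = c * 𝔼 ω, f ω :=
  (Finset.mul_expect _ _ _).symm

theorem expect_prod_eq (f : Ω × Ω' → ℝ) : 𝔼 x, f x = 𝔼 a, 𝔼 b, f (a, b) := by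
  rw [← Finset.univ_product_univ, Finset.expect_product]

theorem expect_pi_prod [DecidableEq ι] (f : ι → α → ℝ) :
    𝔼 ω : ι → α, ∏ i, f i (ω i) = ∏ i, 𝔼 a, f i a := by
  simp only [Fintype.expect_eq_sum_div_card, Finset.prod_div_distrib, Finset.prod_univ_sum,
    Fintype.piFinset_univ, Fintype.card_fun, Finset.prod_const, Finset.card_univ, Nat.cast_pow]

theorem expect_pi_apply [DecidableEq ι] [Nonempty α] (i : ι) (g : α → ℝ) :
    𝔼 ω : ι → α, g (ω i) = 𝔼 a, g a := by
  have h := expect_pi_prod (fun j a => if j = i then g a else (1 : ℝ))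
  rw [Finset.prod_eq_single i] at h
  · simp only [Finset.prod_ite_eq', Finset.mem_univ, if_true] at h
    exact h
  · intro j _ hj
    simp [hj]
  · simp

theorem expect_pi_mul [DecidableEq ι] [Nonempty α] {i j : ι} (hij : i ≠ j) (g h : α → ℝ) :
    𝔼 ω : ι → α, g (ω i) * h (ω j) = (𝔼 a, g a) * 𝔼 a, h a := by
  have key := expect_pi_prod
    (fun l a => (if l = i then g a else (1 : ℝ)) * (if l = j then h a else 1))
  simp only [Finset.prod_mul_distrib, Finset.prod_ite_eq', Finset.mem_univ, if_true] at key
  rw [key, ← Finset.prod_subset (Finset.subset_univ {i, j}), Finset.prod_pair hij]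
  · simp [hij, hij.symm]
  · intro l _ hl
    simp only [Finset.mem_insert, Finset.mem_singleton, not_or] at hl
    simp [hl.1, hl.2]

/-- Sums of independent centred random variables: the second moments add up. -/
theorem expect_sum_sq [DecidableEq ι] [Nonempty α] (Z : ι → α → ℝ) (hZ : ∀ i, 𝔼 a, Z i a = 0) :
    𝔼 ω : ι → α, (∑ i, Z i (ω i)) ^ 2 = ∑ i, 𝔼 a, Z i a ^ 2 := by
  simp only [sq, Finset.sum_mul_sum]
  rw [Finset.expect_sum_comm]
  refine Finset.sum_congr rfl fun i _ => ?_
  rw [Finset.expect_sum_comm, Finset.sum_eq_single i]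
  · exact expect_pi_apply i (fun a => Z i a * Z i a)
  · intro j _ hj
    rw [expect_pi_mul hj.symm, hZ, zero_mul]
  · simp

open Classical in
/-- The probability of the event `P` under the uniform distribution on a finite type. -/
noncomputable def prob (P : Ω → Prop) : ℝ := 𝔼 ω, if P ω then 1 else 0

theorem prob_mono {P Q : Ω → Prop} (h : ∀ ω, P ω → Q ω) : prob P ≤ prob Q := by
  classical
  refine Finset.expect_le_expect fun ω _ => ?_
  by_cases hP : P ω
  · simp [hP, h ω hP]
  · simp only [hP, if_false]
    split_ifs <;> norm_num

theorem prob_nonneg (P : Ω → Prop) : 0 ≤ prob P := by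
  classical
  exact Finset.expect_nonneg fun ω _ => by split_ifs <;> norm_num

theorem prob_or_le (P Q : Ω → Prop) : prob (fun ω => P ω ∨ Q ω) ≤ prob P + prob Q := by
  classical
  unfold prob
  rw [← Finset.expect_add_distrib]
  refine Finset.expect_le_expect fun ω _ => ?_
  by_cases hP : P ω <;> by_cases hQ : Q ω <;> simp [hP, hQ]

theorem prob_exists_le {κ : Type*} (s : Finset κ) (P : κ → Ω → Prop) :
    prob (fun ω => ∃ i ∈ s, P i ω) ≤ ∑ i ∈ s, prob (P i) := by
  classical
  induction s using Finset.induction_on with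
  | empty => simp [prob]
  | insert a s ha ih =>
    rw [Finset.sum_insert ha]
    refine le_trans (prob_mono (Q := fun ω => P a ω ∨ ∃ i ∈ s, P i ω) ?_)
      ((prob_or_le _ _).trans (by gcongr))
    rintro ω ⟨i, hi, h⟩
    rcases Finset.mem_insert.1 hi with rfl | hi
    · exact Or.inl h
    · exact Or.inr ⟨i, hi, h⟩

theorem prob_eq_card_div [DecidableEq Ω] (P : Ω → Prop) [DecidablePred P] :
    prob P = (#{ω | P ω} : ℝ) / Fintype.card Ω := by
  classical
  unfold prob
  rw [Fintype.expect_eq_sum_div_card]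
  congr 1
  rw [Finset.card_filter]
  push_cast
  exact Finset.sum_congr rfl fun ω _ => by congr

/-- Markov's inequality; the strict inequality makes the case `V = 0` hold as well. -/
theorem prob_markov {f : Ω → ℝ} (hf : ∀ ω, 0 ≤ f ω) {V b : ℝ} (hb : 0 ≤ b) (h : 𝔼 ω, f ω ≤ V) :
    prob (fun ω => V < b * f ω) ≤ b := by
  classical
  rcases isEmpty_or_nonempty Ω with hΩ | hΩ
  · simpa [prob] using hb
  have hV : 0 ≤ V := (Finset.expect_nonneg fun ω _ => hf ω).trans h
  rcases hV.eq_or_lt with rfl | hV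
  · have h0 : 𝔼 ω, f ω = 0 := le_antisymm h (Finset.expect_nonneg fun ω _ => hf ω)
    rw [Finset.expect_eq_zero_iff_of_nonneg (fun ω _ => hf ω)] at h0
    have : prob (fun ω => 0 < b * f ω) = 0 :=
      Finset.expect_eq_zero fun ω _ => by simp [h0 ω (mem_univ ω)]
    rw [this]
    exact hb
  · calc prob (fun ω => V < b * f ω) ≤ 𝔼 ω, (b / V) * f ω := by
          refine Finset.expect_le_expect fun ω _ => ?_
          split_ifs with hω
          · rw [div_mul_eq_mul_div, le_div_iff₀ hV]
            linarith
          · have := hf ω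
            positivity
      _ = b / V * 𝔼 ω, f ω := expect_const_mul _ _
      _ ≤ b / V * V := by gcongr
      _ = b := div_mul_cancel₀ _ hV.ne'

/-- Conditioning on the first of two independent components. -/
theorem prob_prod_le {P : Ω → Prop} {Q : Ω × Ω' → Prop} {a b : ℝ} (hb : 0 ≤ b) (hP : prob P ≤ a)
    (hQ : ∀ ω, ¬ P ω → prob (fun ω' => Q (ω, ω')) ≤ b) :
    prob (fun x : Ω × Ω' => P x.1 ∨ Q x) ≤ a + b := by
  classical
  rcases isEmpty_or_nonempty Ω with hΩ | hΩ
  · have h1 : prob P = 0 := by simp [prob]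
    have : prob (fun x : Ω × Ω' => P x.1 ∨ Q x) = 0 := by simp [prob]
    linarith
  rcases isEmpty_or_nonempty Ω' with hΩ' | hΩ'
  · have h1 := prob_nonneg P
    have : prob (fun x : Ω × Ω' => P x.1 ∨ Q x) = 0 := by simp [prob]
    linarith
  calc prob (fun x : Ω × Ω' => P x.1 ∨ Q x)
      = 𝔼 ω, prob (fun ω' => P ω ∨ Q (ω, ω')) := by
        unfold prob
        rw [expect_prod_eq]
    _ ≤ 𝔼 ω, ((if P ω then 1 else 0) + b) := by
        refine Finset.expect_le_expect fun ω _ => ?_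
        by_cases h : P ω
        · have : prob (fun ω' : Ω' => P ω ∨ Q (ω, ω')) = 1 := by
            simp [prob, h]
          rw [this]
          simp [h, hb]
        · simpa [h] using hQ ω h
    _ = prob P + b := by
        rw [Finset.expect_add_distrib, Fintype.expect_const]
        rfl
    _ ≤ a + b := by gcongr

theorem prob_fst [Nonempty Ω'] (P : Ω → Prop) :
    prob (fun x : Ω × Ω' => P x.1) = prob P := by
  classical
  unfold prob
  rw [expect_prod_eq]
  exact Finset.expect_congr rfl fun ω _ => Fintype.expect_const (if P ω then (1 : ℝ) else 0)

/-- An exponential moment bound for the number of bad outcomes among independent trials, each of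
which is bad with probability at most `b`. -/
theorem prob_le_card_bad [DecidableEq ι] [Nonempty α] (bad : α → Prop) [DecidablePred bad]
    {b K : ℝ} (hK : 1 ≤ K) (hb : prob bad ≤ b) (t : ℕ) :
    prob (fun ω : ι → α => t ≤ #{i | bad (ω i)}) ≤
      (1 + K * b) ^ Fintype.card ι / K ^ t := by
  classical
  have h1 : ∀ ω : ι → α, ∏ i, (if bad (ω i) then K else 1) = K ^ #{i | bad (ω i)} := by
    intro ω
    rw [Finset.prod_ite, Finset.prod_const, Finset.prod_const_one, mul_one]
  have h2 : 𝔼 ω : ι → α, ∏ i, (if bad (ω i) then K else 1) ≤ (1 + K * b) ^ Fintype.card ι := by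
    rw [expect_pi_prod (fun _ a => if bad a then K else 1), Finset.prod_const, Finset.card_univ]
    refine pow_le_pow_left₀
      (Finset.expect_nonneg fun a _ => by split_ifs <;> linarith) ?_ _
    · calc 𝔼 a, (if bad a then K else 1) ≤ 𝔼 a, (1 + K * if bad a then 1 else 0) := by
            refine Finset.expect_le_expect fun a _ => ?_
            split_ifs <;> linarith
        _ = 1 + K * prob bad := by
            rw [Finset.expect_add_distrib, Fintype.expect_const, expect_const_mul]
            unfold prob
            congr!
        _ ≤ 1 + K * b := by gcongr
  rw [le_div_iff₀ (by positivity)]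
  refine le_trans ?_ h2
  unfold prob
  rw [Finset.expect_mul]
  refine Finset.expect_le_expect fun ω _ => ?_
  rw [h1]
  split_ifs with h
  · rw [one_mul]
    exact pow_le_pow_right₀ hK h
  · rw [zero_mul]
    positivity

end Expectation

/-! ### Few random seeds suffice -/

open Classical in
/-- Newman's argument. If for each of fewer than `4 ^ t` inputs a random seed is bad with
probability at most `1 / 160`, then some list of `10 * t` seeds has fewer than `t` bad seeds for
every input: a random list fails for a given input with probability at most `4 ^ (-t)`. -/
theorem exists_seeds {Ω V : Type*} [Fintype Ω] [Nonempty Ω] [Fintype V] (bad : Ω → V → Prop)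
    (h : ∀ v, prob (fun ω => bad ω v) ≤ 1 / 160) (t : ℕ) (ht : Fintype.card V < 4 ^ t) :
    ∃ ω : Fin (10 * t) → Ω, ∀ v, #{i | bad (ω i) v} < t := by
  by_contra! hcon
  have h1 : ∀ v, prob (fun ω : Fin (10 * t) → Ω => t ≤ #{i | bad (ω i) v}) ≤ 1 / 4 ^ t := by
    intro v
    refine (prob_le_card_bad (fun ω => bad ω v) (K := 16) (by norm_num) (h v) t).trans ?_
    rw [Fintype.card_fin, pow_mul, ← div_pow, ← one_div_pow]
    exact pow_le_pow_left₀ (by norm_num) (by norm_num) t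
  have h2 : (1 : ℝ) ≤ ∑ v : V, 1 / 4 ^ t := by
    calc (1 : ℝ) = prob (fun ω : Fin (10 * t) → Ω =>
          ∃ v ∈ (univ : Finset V), t ≤ #{i | bad (ω i) v}) := by
          have : ∀ ω : Fin (10 * t) → Ω,
              (∃ v ∈ (univ : Finset V), t ≤ #{i | bad (ω i) v}) = True := by
            intro ω
            simpa using hcon ω
          simp only [this, prob, if_true]
          exact (Fintype.expect_const (1 : ℝ)).symm
      _ ≤ _ := (prob_exists_le univ _).trans (Finset.sum_le_sum fun v _ => h1 v)
  rw [Finset.sum_const, Finset.card_univ, nsmul_eq_mul, mul_one_div, le_div_iff₀ (by positivity),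
    one_mul] at h2
  exact absurd ht (not_lt.2 (by exact_mod_cast h2))

/-! ### Medians -/

open Classical in
theorem exists_median {ι : Type*} [Fintype ι] (z : ι → ℝ) :
    ∃ m, ∀ a b, Fintype.card ι < 2 * #{r | z r ∈ Set.Icc a b} → m ∈ Set.Icc a b := by
  rcases isEmpty_or_nonempty ι with hι | hι
  · exact ⟨0, fun a b h => by simp at h⟩
  have two : ∀ s t : Finset ι, Fintype.card ι < 2 * #s → Fintype.card ι < 2 * #t →
      (s ∩ t).Nonempty := by
    intro s t hs ht
    rw [← Finset.card_pos]
    have h1 := Finset.card_union_add_card_inter s t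
    have h2 := Finset.card_le_univ (s ∪ t)
    omega
  -- the largest value that more than half of the `z r` reach
  let G : Finset ι := {r | Fintype.card ι < 2 * #{r' | z r ≤ z r'}}
  have hG : G.Nonempty := by
    obtain ⟨r, -, hr⟩ := Finset.exists_min_image univ z univ_nonempty
    refine ⟨r, ?_⟩
    have : ({r' | z r ≤ z r'} : Finset ι) = univ := by
      ext r'
      simp [hr r' (mem_univ r')]
    have hpos : 0 < Fintype.card ι := Fintype.card_pos
    simp only [G, Finset.mem_filter, Finset.mem_univ, true_and, this, Finset.card_univ]
    omega
  obtain ⟨r, hrG, hr⟩ := Finset.exists_max_image G z hG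
  refine ⟨z r, fun a b hab => ⟨?_, ?_⟩⟩
  · have hne : ({r | z r ∈ Set.Icc a b} : Finset ι).Nonempty := by
      rw [← Finset.card_pos]
      omega
    obtain ⟨r', hr', hmin⟩ := Finset.exists_min_image _ z hne
    simp only [Finset.mem_filter, Finset.mem_univ, true_and] at hr' hmin
    refine hr'.1.trans (hr r' ?_)
    simp only [G, Finset.mem_filter, Finset.mem_univ, true_and]
    refine lt_of_lt_of_le hab (Nat.mul_le_mul_left 2 (Finset.card_le_card ?_))
    intro x hx
    simp only [Finset.mem_filter, Finset.mem_univ, true_and] at hx ⊢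
    exact hmin x hx
  · simp only [G, Finset.mem_filter, Finset.mem_univ, true_and] at hrG
    obtain ⟨x, hx⟩ := two _ _ hrG hab
    simp only [Finset.mem_inter, Finset.mem_filter, Finset.mem_univ, true_and] at hx
    exact hx.1.trans hx.2.2

/-- A median of a finite family of reals: a number that lies in every interval that contains more
than half of the family. -/
noncomputable def median {ι : Type*} [Fintype ι] (z : ι → ℝ) : ℝ := (exists_median z).choose

open Classical in
theorem abs_median_sub_le {ι : Type*} [Fintype ι] (z : ι → ℝ) {x e : ℝ}
    (h : 2 * #{r | e < |z r - x|} < Fintype.card ι) : |median z - x| ≤ e := by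
  have h1 := Finset.card_filter_add_card_filter_not (s := (univ : Finset ι))
    (fun r => e < |z r - x|)
  rw [Finset.card_univ] at h1
  have h2 : ({r | z r ∈ Set.Icc (x - e) (x + e)} : Finset ι) =
      ({r | ¬ e < |z r - x|} : Finset ι) := by
    ext r
    simp only [Finset.mem_filter, Finset.mem_univ, true_and, Set.mem_Icc, not_lt, abs_le]
    constructor <;> rintro ⟨h1, h2⟩ <;> constructor <;> linarith
  have h3 := (exists_median z).choose_spec (x - e) (x + e) (by rw [h2]; omega)
  rw [abs_le]
  constructor <;> unfold median <;> linarith [h3.1, h3.2]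

/-! ### The count sketch -/

/-- The sign encoded by a bit. -/
def sgn (b : Bool) : ℤ := if b then 1 else -1

theorem sgn_mul_self (b : Bool) : sgn b * sgn b = 1 := by cases b <;> rfl

theorem expect_sgn : 𝔼 b : Bool, ((sgn b : ℤ) : ℝ) = 0 := by
  rw [Fintype.expect_eq_sum_div_card]
  simp [sgn]

/-- The randomness of one row of a count sketch: a bucket and a sign for every coordinate. -/
abbrev Row (n B : ℕ) : Type := (Fin n → Fin B) × (Fin n → Bool)

/-- The signed sum of the coordinates of `w` in bucket `b`. -/
def bucketSum {n B : ℕ} (w : Fin n → ℤ) (ρ : Row n B) (b : Fin B) : ℤ :=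
  ∑ i, (if ρ.1 i = b then sgn (ρ.2 i) else 0) * w i

/-- The estimate of coordinate `i` read off one row with bucket contents `y`. -/
def rowEst {n B : ℕ} (ρ : Row n B) (y : Fin B → ℤ) (i : Fin n) : ℤ := sgn (ρ.2 i) * y (ρ.1 i)

theorem rowEst_bucketSum_sub {n B : ℕ} (w : Fin n → ℤ) (ρ : Row n B) (i : Fin n) :
    rowEst ρ (bucketSum w ρ) i - w i =
      sgn (ρ.2 i) * ∑ j, (if j ≠ i ∧ ρ.1 j = ρ.1 i then w j else 0) * sgn (ρ.2 j) := by
  have h : bucketSum w ρ (ρ.1 i) = sgn (ρ.2 i) * w i +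
      ∑ j, (if j ≠ i ∧ ρ.1 j = ρ.1 i then w j else 0) * sgn (ρ.2 j) := by
    unfold bucketSum
    rw [← Finset.add_sum_erase _ _ (mem_univ i), ← Finset.add_sum_erase univ
      (fun j => (if j ≠ i ∧ ρ.1 j = ρ.1 i then w j else 0) * sgn (ρ.2 j)) (mem_univ i)]
    simp only [if_true, ne_eq, not_true_eq_false, false_and, if_false, zero_mul, zero_add]
    congr 1
    refine Finset.sum_congr rfl fun j hj => ?_
    have hj' : j ≠ i := Finset.ne_of_mem_erase hj
    by_cases hh : ρ.1 j = ρ.1 i <;> simp [hh, hj', mul_comm]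
  rw [rowEst, h, mul_add, ← mul_assoc, sgn_mul_self, one_mul]
  ring

theorem abs_sgn_mul (b : Bool) (x : ℝ) : |((sgn b : ℤ) : ℝ) * x| = |x| := by
  cases b <;> simp [sgn]

theorem prob_collision {n B : ℕ} [NeZero B] {i j : Fin n} (hij : j ≠ i) :
    prob (fun h : Fin n → Fin B => h j = h i) = 1 / B := by
  classical
  have h1 : ∀ h : Fin n → Fin B, (if h j = h i then (1 : ℝ) else 0) =
      ∑ b, (if h j = b then (1 : ℝ) else 0) * (if h i = b then 1 else 0) := by
    intro h
    rw [Finset.sum_eq_single (h i)]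
    · simp
    · intro b _ hb
      simp [hb.symm]
    · simp
  calc prob (fun h : Fin n → Fin B => h j = h i)
      = 𝔼 h : Fin n → Fin B,
        ∑ b, (if h j = b then (1 : ℝ) else 0) * (if h i = b then 1 else 0) :=
        Finset.expect_congr rfl fun h _ => by rw [← h1]; congr
    _ = ∑ b : Fin B, (1 / B : ℝ) * (1 / B) := by
        rw [Finset.expect_sum_comm]
        refine Finset.sum_congr rfl fun b _ => ?_
        rw [expect_pi_mul hij (fun a => if a = b then (1 : ℝ) else 0)
          (fun a => if a = b then (1 : ℝ) else 0)]
        have : 𝔼 a : Fin B, (if a = b then (1 : ℝ) else 0) = 1 / B := by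
          rw [Fintype.expect_eq_sum_div_card]
          simp
        rw [this]
    _ = 1 / B := by
        rw [Finset.sum_const, Finset.card_univ, Fintype.card_fin, nsmul_eq_mul]
        field_simp

/-- One row of a count sketch with `B ≥ 32 m / η²` buckets estimates a coordinate up to `η θ`, with
probability `15 / 16`, as soon as all but `m` coordinates have squares that sum up to at most
`θ² m`: none of the `m` exceptional coordinates shares the bucket of `i`, and the variance due to
the others is small. -/
theorem prob_rowEst {n B : ℕ} [NeZero B] (w : Fin n → ℤ) (i : Fin n) (H : Finset (Fin n))
    {m θ η : ℝ} (hm : (#H : ℝ) ≤ m) (hθ : 0 < θ) (hη : 0 < η) (hη1 : η ≤ 1)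
    (hw : ∑ j ∈ univ \ H, (w j : ℝ) ^ 2 ≤ θ ^ 2 * m) (hB : 32 * m / η ^ 2 ≤ B) :
    prob (fun ρ : Row n B => η * θ < |((rowEst ρ (bucketSum w ρ) i : ℤ) : ℝ) - w i|) ≤ 1 / 16 := by
  classical
  have hB0 : (0 : ℝ) < B := by exact_mod_cast Nat.pos_of_ne_zero (NeZero.ne B)
  have hmB : m / B ≤ η ^ 2 / 32 := by
    rw [div_le_iff₀ (by positivity)] at hB
    rw [div_le_div_iff₀ hB0 (by norm_num)]
    linarith
  have hη2 : η ^ 2 ≤ 1 := pow_le_one₀ hη.le hη1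
  -- the contributions of the light coordinates to the error
  let c : (Fin n → Fin B) → Fin n → ℝ := fun h j =>
    if j ∉ H ∧ j ≠ i ∧ h j = h i then (w j : ℝ) else 0
  let f : Row n B → ℝ := fun ρ => (∑ j, c ρ.1 j * ((sgn (ρ.2 j) : ℤ) : ℝ)) ^ 2
  have hf : 𝔼 ρ, f ρ ≤ θ ^ 2 * η ^ 2 / 32 := by
    calc 𝔼 ρ, f ρ = 𝔼 h : Fin n → Fin B, ∑ j, c h j ^ 2 := by
          rw [expect_prod_eq]
          refine Finset.expect_congr rfl fun h _ => ?_
          refine (expect_sum_sq (fun (j : Fin n) (a : Bool) => c h j * ((sgn a : ℤ) : ℝ))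
            ?_).trans ?_
          · intro j
            rw [expect_const_mul, expect_sgn, mul_zero]
          · refine Finset.sum_congr rfl fun j _ => ?_
            have : ∀ a : Bool, (c h j * ((sgn a : ℤ) : ℝ)) ^ 2 = c h j ^ 2 := by
              intro a
              cases a <;> simp [sgn]
            simp only [this]
            exact Fintype.expect_const _
      _ = ∑ j, 𝔼 h : Fin n → Fin B, c h j ^ 2 := Finset.expect_sum_comm _ _ _
      _ ≤ ∑ j, (if j ∉ H then (w j : ℝ) ^ 2 / B else 0) := by
          refine Finset.sum_le_sum fun j _ => ?_
          by_cases hj : j ∉ H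
          · by_cases hji : j = i
            · simp only [c, hji, ne_eq, not_true_eq_false, false_and, and_false, if_false]
              simp only [ne_eq, OfNat.ofNat_ne_zero, not_false_eq_true, zero_pow,
                Finset.expect_const_zero]
              split_ifs <;> positivity
            · have : ∀ h : Fin n → Fin B, c h j ^ 2 =
                  (w j : ℝ) ^ 2 * (if h j = h i then 1 else 0) := by
                intro h
                by_cases hh : h j = h i <;> simp [c, hj, hji, hh]
              have h2 := prob_collision (B := B) hji
              unfold prob at h2
              simp only [this, hj, not_false_eq_true, if_true]
              rw [expect_const_mul, div_eq_mul_one_div, ← h2]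
              apply le_of_eq
              congr!
          · simp [c, hj]
      _ = (∑ j ∈ univ \ H, (w j : ℝ) ^ 2) / B := by
          rw [← Finset.sum_filter, Finset.sum_div]
          congr 1
          ext j
          simp
      _ ≤ θ ^ 2 * m / B := by gcongr
      _ = θ ^ 2 * (m / B) := by ring
      _ ≤ θ ^ 2 * (η ^ 2 / 32) := by gcongr
      _ = θ ^ 2 * η ^ 2 / 32 := by ring
  have h1 : prob (fun ρ : Row n B => ∃ j ∈ H.erase i, ρ.1 j = ρ.1 i) ≤ 1 / 32 := by
    calc _ ≤ ∑ j ∈ H.erase i, prob (fun ρ : Row n B => ρ.1 j = ρ.1 i) := prob_exists_le _ _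
      _ = ∑ j ∈ H.erase i, (1 / B : ℝ) := by
          refine Finset.sum_congr rfl fun j hj => ?_
          rw [prob_fst (fun h : Fin n → Fin B => h j = h i),
            prob_collision (Finset.ne_of_mem_erase hj)]
      _ = #(H.erase i) / B := by rw [Finset.sum_const, nsmul_eq_mul, mul_one_div]
      _ ≤ m / B := by
          gcongr
          exact le_trans (by exact_mod_cast Finset.card_erase_le) hm
      _ ≤ 1 / 32 := by linarith
  have h2 := prob_markov (f := f) (fun ρ => sq_nonneg _) (b := 1 / 32) (by norm_num) hf
  refine le_trans (prob_mono ?_) ((prob_or_le _ _).trans (add_le_add h1 h2)) |>.trans (by norm_num)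
  intro ρ hρ
  by_contra! hcon
  obtain ⟨hc1, hc2⟩ := hcon
  have e1 : ((rowEst ρ (bucketSum w ρ) i : ℤ) : ℝ) - w i =
      ((sgn (ρ.2 i) : ℤ) : ℝ) * ∑ j, c ρ.1 j * ((sgn (ρ.2 j) : ℤ) : ℝ) := by
    have := congrArg (fun z : ℤ => (z : ℝ)) (rowEst_bucketSum_sub w ρ i)
    push_cast at this
    rw [this]
    congr 1
    refine Finset.sum_congr rfl fun j _ => ?_
    by_cases hj : j ∈ H
    · by_cases hji : j = i
      · simp [c, hji]
      · have := hc1 j (Finset.mem_erase.2 ⟨hji, hj⟩)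
        simp [c, this]
    · by_cases hji : j = i ∨ ¬ ρ.1 j = ρ.1 i
      · rcases hji with hji | hji <;> simp [c, hji]
      · push Not at hji
        simp [c, hji, hj]
  rw [e1, abs_sgn_mul] at hρ
  have h3 : (η * θ) ^ 2 < f ρ := by
    refine lt_of_lt_of_eq ?_ (sq_abs (∑ j, c ρ.1 j * ((sgn (ρ.2 j) : ℤ) : ℝ)))
    exact pow_lt_pow_left₀ hρ (by positivity) (by norm_num)
  rw [mul_pow] at h3
  linarith

/-- The estimate of coordinate `i` from all rows: the median of the estimates of the rows. -/
noncomputable def sketchEst {n B R : ℕ} (ρ : Fin R → Row n B) (y : Fin R → Fin B → ℤ)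
    (i : Fin n) : ℝ := median fun r => ((rowEst (ρ r) (y r) i : ℤ) : ℝ)

/-- The median of `2 t` rows: a given coordinate is estimated badly only if at least `t` rows are
bad for it, which has probability at most `4 ^ (-t)`. -/
theorem prob_sketchEst {n B t : ℕ} [NeZero B] (w : Fin n → ℤ) (H : Finset (Fin n))
    {m θ η : ℝ} (hm : (#H : ℝ) ≤ m) (hθ : 0 < θ) (hη : 0 < η) (hη1 : η ≤ 1)
    (hw : ∑ j ∈ univ \ H, (w j : ℝ) ^ 2 ≤ θ ^ 2 * m) (hB : 32 * m / η ^ 2 ≤ B) :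
    prob (fun ρ : Fin (2 * t) → Row n B =>
      ∃ i, η * θ < |sketchEst ρ (fun r => bucketSum w (ρ r)) i - w i|) ≤ n / 4 ^ t := by
  classical
  calc _ ≤ prob (fun ρ : Fin (2 * t) → Row n B => ∃ i ∈ (univ : Finset (Fin n)), t ≤
        #{r | η * θ < |((rowEst (ρ r) (bucketSum w (ρ r)) i : ℤ) : ℝ) - w i|}) := by
        refine prob_mono ?_
        rintro ρ ⟨i, hi⟩
        refine ⟨i, mem_univ i, ?_⟩
        by_contra! hcon
        refine absurd (abs_median_sub_le _ ?_) (not_le.2 hi)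
        rw [Fintype.card_fin]
        exact Nat.mul_lt_mul_of_pos_left (hcon) (by norm_num)
    _ ≤ ∑ i : Fin n, (1 / 4 ^ t : ℝ) := by
        refine (prob_exists_le _ _).trans (Finset.sum_le_sum fun i _ => ?_)
        refine (prob_le_card_bad (fun ρ : Row n B =>
          η * θ < |((rowEst ρ (bucketSum w ρ) i : ℤ) : ℝ) - w i|) (K := 16) (by norm_num)
          (prob_rowEst w i H hm hθ hη hη1 hw hB) t).trans ?_
        rw [Fintype.card_fin, pow_mul, ← div_pow, ← one_div_pow]
        exact pow_le_pow_left₀ (by norm_num) (by norm_num) t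
    _ = n / 4 ^ t := by
        rw [Finset.sum_const, Finset.card_univ, Fintype.card_fin, nsmul_eq_mul, mul_one_div]

/-! ### The random multipliers -/

/-- The integer multiplier `⌊K (D / (j + 1)) ^ (1 / q)⌋` of a coordinate whose random number is
`j : Fin D`. -/
noncomputable def mult (q : ℝ) (K D : ℕ) (j : Fin D) : ℕ :=
  ⌊(K : ℝ) * ((D : ℝ) / (j + 1)) ^ (1 / q)⌋₊

/-- The number `u ∈ (0, 1]` with `mult = K u ^ (-1 / q)`. It is almost uniformly distributed. -/
noncomputable def unif (q : ℝ) (K D : ℕ) (j : Fin D) : ℝ := ((K : ℝ) / mult q K D j) ^ q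

section Mult

variable {q : ℝ} {K D : ℕ}

theorem one_le_ratio (j : Fin D) : 1 ≤ (D : ℝ) / (j + 1) := by
  rw [le_div_iff₀ (by positivity), one_mul]
  exact_mod_cast j.2

theorem one_le_ratio_rpow (hq : 0 < q) (j : Fin D) : 1 ≤ ((D : ℝ) / (j + 1)) ^ (1 / q) :=
  Real.one_le_rpow (one_le_ratio j) (by positivity)

theorem le_mult (hq : 0 < q) (j : Fin D) : K ≤ mult q K D j := by
  refine Nat.le_floor ?_
  nlinarith [one_le_ratio_rpow hq j, (Nat.cast_nonneg K : (0 : ℝ) ≤ K)]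

theorem mult_le (j : Fin D) : (mult q K D j : ℝ) ≤ K * ((D : ℝ) / (j + 1)) ^ (1 / q) :=
  Nat.floor_le (by positivity)

theorem mult_le' (hq : 0 < q) (j : Fin D) : (mult q K D j : ℝ) ≤ K * (D : ℝ) ^ (1 / q) := by
  refine (mult_le j).trans ?_
  gcongr
  exact div_le_self (Nat.cast_nonneg D) (by linarith [(Nat.cast_nonneg (j : ℕ) : (0 : ℝ) ≤ j)])

theorem mult_pos (hq : 0 < q) (hK : 0 < K) (j : Fin D) : (0 : ℝ) < mult q K D j := by
  exact_mod_cast hK.trans_le (le_mult hq j)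

theorem unif_pos (hq : 0 < q) (hK : 0 < K) (j : Fin D) : 0 < unif q K D j := by
  have := mult_pos hq hK j
  unfold unif
  positivity

theorem unif_le_one (hq : 0 < q) (hK : 0 < K) (j : Fin D) : unif q K D j ≤ 1 := by
  refine Real.rpow_le_one (by positivity) ?_ hq.le
  rw [div_le_one (mult_pos hq hK j)]
  exact_mod_cast le_mult hq j

theorem le_unif (hq : 0 < q) (hK : 0 < K) (j : Fin D) :
    ((j : ℝ) + 1) / D ≤ unif q K D j := by
  have hD : (0 : ℝ) < D := by exact_mod_cast (Nat.zero_le _).trans_lt j.2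
  have h1 : (((j : ℝ) + 1) / D) ^ (1 / q) ≤ (K : ℝ) / mult q K D j := by
    rw [le_div_iff₀ (mult_pos hq hK j)]
    calc (((j : ℝ) + 1) / D) ^ (1 / q) * mult q K D j
        ≤ (((j : ℝ) + 1) / D) ^ (1 / q) * (K * ((D : ℝ) / (j + 1)) ^ (1 / q)) := by
          gcongr
          exact mult_le j
      _ = K * ((((j : ℝ) + 1) / D) * (D / (j + 1))) ^ (1 / q) := by
          rw [Real.mul_rpow (by positivity) (by positivity)]
          ring
      _ = K := by
          rw [show (((j : ℝ) + 1) / D) * (D / (j + 1)) = 1 by field_simp, Real.one_rpow, mul_one]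
  calc ((j : ℝ) + 1) / D = ((((j : ℝ) + 1) / D) ^ (1 / q)) ^ q := by
        rw [← Real.rpow_mul (by positivity), one_div_mul_cancel hq.ne', Real.rpow_one]
    _ ≤ unif q K D j := by
        unfold unif
        gcongr

theorem unif_le (hq : 0 < q) (hq2 : q ≤ 2) {δ : ℝ} (hδ : 0 < δ) (hδ1 : δ ≤ 1) (hK : 4 / δ ≤ K)
    (j : Fin D) : (1 - δ / 2) * unif q K D j ≤ ((j : ℝ) + 1) / D := by
  have hK' : (4 : ℝ) ≤ K := le_trans (by rw [le_div_iff₀ hδ]; linarith) hK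
  have hK0 : 0 < K := by
    have : (0 : ℝ) < K := by linarith
    exact_mod_cast this
  have hKinv : 1 / (K : ℝ) ≤ δ / 4 := by
    rw [div_le_iff₀ hδ] at hK
    rw [div_le_div_iff₀ (by linarith) (by norm_num)]
    linarith
  have hKinv0 : 0 < 1 / (K : ℝ) := by positivity
  set t := ((D : ℝ) / (j + 1)) ^ (1 / q) with ht
  have ht1 : 1 ≤ t := one_le_ratio_rpow hq j
  have hm : (K : ℝ) * t * (1 - 1 / K) ≤ mult q K D j := by
    have := Nat.lt_floor_add_one ((K : ℝ) * t)
    have h2 : (K : ℝ) * t * (1 - 1 / K) = K * t - t := by field_simp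
    rw [h2]
    unfold mult
    rw [← ht]
    linarith
  have h1 : (1 - 1 / (K : ℝ)) * (K / mult q K D j) ≤ ((j + 1) / D : ℝ) ^ (1 / q) := by
    have e : (((j : ℝ) + 1) / D) ^ (1 / q) = t⁻¹ := by
      rw [ht, ← Real.inv_rpow (by positivity), inv_div]
    rw [e, ← mul_div_assoc, div_le_iff₀ (mult_pos hq hK0 j), inv_mul_eq_div,
      le_div_iff₀ (by linarith)]
    linarith
  have h2 : (1 - 1 / (K : ℝ)) ^ q * unif q K D j ≤ ((j : ℝ) + 1) / D := by
    unfold unif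
    rw [← Real.mul_rpow (by linarith) (by positivity)]
    calc _ ≤ (((j + 1) / D : ℝ) ^ (1 / q)) ^ q := by
          refine Real.rpow_le_rpow ?_ h1 hq.le
          have : 0 ≤ 1 - 1 / (K : ℝ) := by linarith
          positivity
      _ = _ := by rw [← Real.rpow_mul (by positivity), one_div_mul_cancel hq.ne', Real.rpow_one]
  have h3 : 1 - δ / 2 ≤ (1 - 1 / (K : ℝ)) ^ q := by
    calc 1 - δ / 2 ≤ (1 - 1 / (K : ℝ)) ^ (2 : ℕ) := by nlinarith
      _ = (1 - 1 / (K : ℝ)) ^ (2 : ℝ) := by rw [← Real.rpow_natCast]; norm_num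
      _ ≤ (1 - 1 / (K : ℝ)) ^ q :=
        Real.rpow_le_rpow_of_exponent_ge (by linarith) (by linarith) hq2
  have := unif_pos hq hK0 j (D := D)
  calc _ ≤ (1 - 1 / (K : ℝ)) ^ q * unif q K D j := by gcongr
    _ ≤ _ := h2

theorem card_succ_le (D : ℕ) (t : ℝ) :
    #{j : Fin D | ((j : ℝ) + 1) ≤ t} = min D ⌊t⌋₊ := by
  have h : ∀ j : Fin D, (((j : ℝ) + 1) ≤ t ↔ (j : ℕ) < ⌊t⌋₊) := by
    intro j
    rw [← Nat.succ_le_iff, Nat.le_floor_iff' (Nat.succ_ne_zero _)]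
    push_cast
    rfl
  simp only [h]
  rw [Fin.card_filter_val_lt]

theorem prob_unif_le (hq : 0 < q) (hK : 0 < K) [NeZero D] {y : ℝ} (hy : 0 ≤ y) :
    prob (fun j : Fin D => unif q K D j ≤ y) ≤ y := by
  classical
  have hD : (0 : ℝ) < D := by exact_mod_cast Nat.pos_of_ne_zero (NeZero.ne D)
  calc prob (fun j : Fin D => unif q K D j ≤ y)
      ≤ prob (fun j : Fin D => ((j : ℝ) + 1) ≤ y * D) := by
        refine prob_mono fun j hj => ?_
        rw [← div_le_iff₀ hD]
        exact (le_unif hq hK j).trans hj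
    _ = (min D ⌊y * D⌋₊ : ℕ) / (D : ℝ) := by
        rw [prob_eq_card_div, card_succ_le, Fintype.card_fin]
    _ ≤ y := by
        rw [div_le_iff₀ hD]
        refine le_trans ?_ (Nat.floor_le (by positivity : 0 ≤ y * D))
        exact_mod_cast min_le_right _ _

/-- The rounding of the multipliers and the discreteness of `Fin D` cost a factor `1 - δ / 2` each.
-/
theorem le_prob_unif (hq : 0 < q) (hq2 : q ≤ 2) [NeZero D] {δ : ℝ} (hδ : 0 < δ) (hδ1 : δ ≤ 1)
    (hK : 4 / δ ≤ K) {y : ℝ} (hy : 2 / (δ * D) ≤ y) (hy1 : y ≤ 1) :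
    (1 - δ) * y ≤ prob (fun j : Fin D => unif q K D j ≤ y) := by
  classical
  have hD : (0 : ℝ) < D := by exact_mod_cast Nat.pos_of_ne_zero (NeZero.ne D)
  have hDy : 2 ≤ δ * y * D := by
    rw [div_le_iff₀ (by positivity)] at hy
    linarith
  set t := (1 - δ / 2) * y * D with ht
  have htD : t ≤ D := by
    have h1 : (1 - δ / 2) * y ≤ 1 := by nlinarith
    calc t ≤ 1 * D := by rw [ht]; gcongr
      _ = D := one_mul _
  calc (1 - δ) * y ≤ (t - 1) / D := by
        rw [le_div_iff₀ hD]
        nlinarith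
    _ ≤ (min D ⌊t⌋₊ : ℕ) / (D : ℝ) := by
        gcongr
        push_cast
        refine le_min (by linarith) ?_
        linarith [Nat.lt_floor_add_one t]
    _ = prob (fun j : Fin D => ((j : ℝ) + 1) ≤ t) := by
        rw [prob_eq_card_div, card_succ_le, Fintype.card_fin]
    _ ≤ _ := by
        refine prob_mono fun j hj => ?_
        have h1 := unif_le hq hq2 hδ hδ1 hK j
        have h2 : ((j : ℝ) + 1) / D ≤ (1 - δ / 2) * y := by
          rw [div_le_iff₀ hD]
          exact hj
        exact le_of_mul_le_mul_left (h1.trans h2) (by linarith)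

theorem expect_inv_unif (hq : 0 < q) (hK : 0 < K) [NeZero D] :
    𝔼 j : Fin D, (unif q K D j)⁻¹ ≤ 1 + Real.log D := by
  have hD : (0 : ℝ) < D := by exact_mod_cast Nat.pos_of_ne_zero (NeZero.ne D)
  calc 𝔼 j : Fin D, (unif q K D j)⁻¹ ≤ 𝔼 j : Fin D, (D : ℝ) * ((j : ℝ) + 1)⁻¹ := by
        refine Finset.expect_le_expect fun j _ => ?_
        refine (inv_anti₀ (by positivity) (le_unif hq hK j)).trans_eq ?_
        rw [inv_div, div_eq_mul_inv]
    _ = ((harmonic D : ℚ) : ℝ) := by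
        rw [Fintype.expect_eq_sum_div_card, ← Finset.mul_sum, Fintype.card_fin,
          mul_div_cancel_left₀ _ hD.ne', harmonic,
          Fin.sum_univ_eq_sum_range (fun j => ((j : ℝ) + 1)⁻¹)]
        push_cast
        rfl
    _ ≤ _ := harmonic_le_one_add_log D

end Mult

/-! ### Sampling with threshold -/

/-- The threshold sampling estimate of `∑ i, x i ^ ρ` over the coordinates selected by `s`:
coordinate `i` is sampled if its key `z i` reaches the threshold `τ`, and for keys `x i / u` with
`u` uniform this has probability `min 1 (x i / τ)`, by which `x i ^ ρ` is divided. -/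
noncomputable def sampleSum {n : ℕ} (ρ τ : ℝ) (s : Fin n → Bool) (x z : Fin n → ℝ) : ℝ :=
  ∑ i, if s i = true ∧ τ ≤ z i then x i ^ (ρ - 1) * max (x i) τ else 0

/-- The sum of `x i ^ ρ` over the coordinates selected by `s`. -/
noncomputable def subsetSum {n : ℕ} (ρ : ℝ) (s : Fin n → Bool) (x : Fin n → ℝ) : ℝ :=
  ∑ i, if s i = true then x i ^ ρ else 0

section Deterministic

variable {n : ℕ} {ρ τ : ℝ} {s : Fin n → Bool} {x z x' z' : Fin n → ℝ}

theorem subsetSum_nonneg (hx : ∀ i, 0 ≤ x i) : 0 ≤ subsetSum ρ s x := by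
  refine Finset.sum_nonneg fun i _ => ?_
  have := hx i
  split_ifs <;> positivity

theorem subsetSum_le_univ (hx : ∀ i, 0 ≤ x i) :
    subsetSum ρ s x ≤ subsetSum ρ (fun _ => true) x := by
  refine Finset.sum_le_sum fun i _ => ?_
  have := hx i
  split_ifs
  · simp
  · simp_all
  · positivity
  · simp_all

theorem sampleSum_le_mul {c : ℝ} (hc : 0 < c) (hτ : 0 < τ) (hρ : 1 ≤ ρ) (hx : ∀ i, 0 ≤ x i)
    (hx' : ∀ i, 0 ≤ x' i) (h : ∀ i, τ ≤ z' i → τ / c ≤ z i ∧ x' i ≤ c * x i) :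
    sampleSum ρ τ s x' z' ≤ c ^ ρ * sampleSum ρ (τ / c) s x z := by
  unfold sampleSum
  rw [Finset.mul_sum]
  refine Finset.sum_le_sum fun i _ => ?_
  have hxi := hx i
  have hxi' := hx' i
  by_cases hi : s i = true ∧ τ ≤ z' i
  · obtain ⟨h1, h2⟩ := h i hi.2
    rw [if_pos hi, if_pos ⟨hi.1, h1⟩]
    calc x' i ^ (ρ - 1) * max (x' i) τ
        ≤ (c * x i) ^ (ρ - 1) * (c * max (x i) (τ / c)) := by
          gcongr ?_ * ?_
          · exact Real.rpow_le_rpow hxi' h2 (by linarith)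
          · rw [mul_max_of_nonneg _ _ hc.le, mul_div_cancel₀ _ hc.ne']
            exact max_le_max_right _ h2
      _ = c ^ ρ * (x i ^ (ρ - 1) * max (x i) (τ / c)) := by
          have : c ^ ρ = c ^ (ρ - 1) * c := by
            rw [← Real.rpow_add_one hc.ne']
            ring_nf
          rw [Real.mul_rpow hc.le hxi, this]
          ring
  · rw [if_neg hi]
    split_ifs <;> positivity

/-- The ratio of the estimate of `∑ x` to the threshold is the sum of `max 1 (x i / τ)` over the
sampled coordinates. -/
theorem sampleSum_one_div_antitone {τ' : ℝ} (hτ : 0 < τ) (hττ' : τ ≤ τ') (hx : ∀ i, 0 ≤ x i) :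
    sampleSum 1 τ' s x z / τ' ≤ sampleSum 1 τ s x z / τ := by
  have hτ' : 0 < τ' := hτ.trans_le hττ'
  unfold sampleSum
  rw [Finset.sum_div, Finset.sum_div]
  refine Finset.sum_le_sum fun i _ => ?_
  have hxi := hx i
  by_cases h : s i = true ∧ τ' ≤ z i
  · rw [if_pos h, if_pos ⟨h.1, hττ'.trans h.2⟩]
    simp only [sub_self, Real.rpow_zero, one_mul]
    rw [← max_div_div_right hτ'.le, ← max_div_div_right hτ.le, div_self hτ.ne',
      div_self hτ'.ne']
    gcongr
  · rw [if_neg h, zero_div]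
    split_ifs <;> positivity

/-- `∑ x ^ (2 ρ - 1) ≤ (∑ x ^ ρ) ^ (2 - 1 / ρ)`. -/
theorem subsetSum_two_mul_sub_one_le (hρ : 1 ≤ ρ) (hx : ∀ i, 0 ≤ x i) :
    subsetSum (2 * ρ - 1) s x ≤ subsetSum ρ s x ^ (2 - 1 / ρ) := by
  have hρ0 : 0 < ρ := by linarith
  set X := subsetSum ρ s x with hX
  have hX0 : 0 ≤ X := subsetSum_nonneg hx
  have hle : ∀ i, s i = true → x i ^ ρ ≤ X := by
    intro i hi
    have := Finset.single_le_sum (f := fun i => if s i = true then x i ^ ρ else 0)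
      (fun j _ => by have := hx j; split_ifs <;> positivity) (mem_univ i)
    simpa [hi, hX, subsetSum] using this
  have h1 : ∀ i, s i = true → x i ^ (ρ - 1) ≤ X ^ ((ρ - 1) / ρ) := by
    intro i hi
    calc x i ^ (ρ - 1) = (x i ^ ρ) ^ ((ρ - 1) / ρ) := by
          rw [← Real.rpow_mul (hx i)]
          congr 1
          field_simp
      _ ≤ _ := Real.rpow_le_rpow (Real.rpow_nonneg (hx i) _) (hle i hi)
          (div_nonneg (by linarith) hρ0.le)
  calc subsetSum (2 * ρ - 1) s x
      ≤ ∑ i, X ^ ((ρ - 1) / ρ) * (if s i = true then x i ^ ρ else 0) := by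
        refine Finset.sum_le_sum fun i _ => ?_
        split_ifs with hi
        · calc x i ^ (2 * ρ - 1) = x i ^ (ρ - 1) * x i ^ ρ := by
                rw [← Real.rpow_add' (hx i) (by linarith)]
                ring_nf
            _ ≤ _ := by
                exact mul_le_mul_of_nonneg_right (h1 i hi) (Real.rpow_nonneg (hx i) _)
        · simp
    _ = X ^ ((ρ - 1) / ρ) * X := by rw [← Finset.mul_sum]; rfl
    _ = X ^ ((ρ - 1) / ρ + 1) := by
        rw [Real.rpow_add_one' hX0]
        have : 0 ≤ (ρ - 1) / ρ := div_nonneg (by linarith) hρ0.le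
        linarith
    _ = X ^ (2 - 1 / ρ) := by
        congr 1
        field_simp
        ring

/-- The power mean inequality `∑ x ≤ n ^ (1 - 1 / ρ) (∑ x ^ ρ) ^ (1 / ρ)`. -/
theorem subsetSum_one_le (hρ : 1 ≤ ρ) (hx : ∀ i, 0 ≤ x i) :
    subsetSum 1 (fun _ => true) x ≤
      (n : ℝ) ^ (1 - 1 / ρ) * subsetSum ρ (fun _ => true) x ^ (1 / ρ) := by
  have hρ0 : 0 < ρ := by linarith
  have h := Real.rpow_sum_le_const_mul_sum_rpow univ x hρ
  have e1 : ∑ i, |x i| = subsetSum 1 (fun _ => true) x := by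
    simp [subsetSum, abs_of_nonneg (hx _)]
  have e2 : ∑ i, |x i| ^ ρ = subsetSum ρ (fun _ => true) x := by
    simp [subsetSum, abs_of_nonneg (hx _)]
  rw [e1, e2, Finset.card_univ, Fintype.card_fin] at h
  have h0 : 0 ≤ subsetSum 1 (fun _ => true) x := subsetSum_nonneg hx
  have h0' : 0 ≤ subsetSum ρ (fun _ => true) x := subsetSum_nonneg hx
  calc _ = (subsetSum 1 (fun _ => true) x ^ ρ) ^ (1 / ρ) := by
        rw [← Real.rpow_mul h0, mul_one_div_cancel hρ0.ne', Real.rpow_one]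
    _ ≤ ((n : ℝ) ^ (ρ - 1) * subsetSum ρ (fun _ => true) x) ^ (1 / ρ) := by gcongr
    _ = _ := by
        rw [Real.mul_rpow (by positivity) h0', ← Real.rpow_mul (by positivity)]
        congr 2
        field_simp

end Deterministic

section Random

theorem le_div_iff_unif {α : Type*} {u : α → ℝ} {τ : ℝ} {a : α} (hu : ∀ a, 0 < u a) (hτ : 0 < τ)
    (y : ℝ) : τ ≤ y / u a ↔ u a ≤ y / τ := by
  rw [le_div_iff₀ (hu a), le_div_iff₀ hτ, mul_comm]

theorem expect_sampleTerm {α : Type*} [Fintype α] {u : α → ℝ} {τ : ℝ} (hu : ∀ a, 0 < u a)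
    (hτ : 0 < τ) (b : Bool) (y g : ℝ) :
    𝔼 a, (if b = true ∧ τ ≤ y / u a then g else 0) =
      if b = true then prob (fun a => u a ≤ y / τ) * g else 0 := by
  classical
  cases b
  · simp
  · simp only [true_and, if_true, le_div_iff_unif hu hτ]
    unfold prob
    rw [Finset.expect_mul]
    refine Finset.expect_congr rfl fun a _ => ?_
    split_ifs <;> simp

variable {n : ℕ} {α : Type*} [Fintype α] [Nonempty α] {u : α → ℝ} {ρ τ : ℝ} {x : Fin n → ℝ}
  {s : Fin n → Bool}

theorem prob_eq_one {P : α → Prop} (h : ∀ a, P a) : prob P = 1 := by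
  simp only [prob, h, if_true]
  exact Fintype.expect_const _

theorem div_mul_sampleWeight {y : ℝ} (hρ : 1 ≤ ρ) (hτ : 0 < τ) (hy : 0 ≤ y) (hyτ : y ≤ τ) :
    y / τ * (y ^ (ρ - 1) * max y τ) = y ^ ρ := by
  have : y ^ ρ = y ^ (ρ - 1) * y := by
    rw [← Real.rpow_add_one' hy (by linarith)]
    ring_nf
  rw [max_eq_right hyτ, this]
  field_simp

theorem sampleWeight_of_le {y : ℝ} (hρ : 1 ≤ ρ) (hy : 0 ≤ y) (hyτ : τ ≤ y) :
    y ^ (ρ - 1) * max y τ = y ^ ρ := by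
  rw [max_eq_left hyτ, ← Real.rpow_add_one' hy (by linarith)]
  ring_nf

theorem expect_sampleSum_le (hu : ∀ a, 0 < u a) (hu1 : ∀ a, u a ≤ 1)
    (hP : ∀ y, 0 ≤ y → prob (fun a => u a ≤ y) ≤ y) (hρ : 1 ≤ ρ) (hτ : 0 < τ)
    (hx : ∀ i, 0 ≤ x i) :
    𝔼 ω : Fin n → α, sampleSum ρ τ s x (fun i => x i / u (ω i)) ≤ subsetSum ρ s x := by
  unfold sampleSum subsetSum
  rw [Finset.expect_sum_comm]
  refine Finset.sum_le_sum fun i _ => ?_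
  rw [expect_pi_apply i (fun a => if s i = true ∧ τ ≤ x i / u a then
    x i ^ (ρ - 1) * max (x i) τ else 0), expect_sampleTerm hu hτ]
  split_ifs
  · rcases le_total (x i) τ with h | h
    · rw [← div_mul_sampleWeight hρ hτ (hx i) h]
      have := hx i
      gcongr
      exact hP _ (by positivity)
    · rw [sampleWeight_of_le hρ (hx i) h,
        prob_eq_one fun a => (hu1 a).trans ((one_le_div hτ).2 h), one_mul]
  · rfl

theorem le_expect_sampleSum (hu : ∀ a, 0 < u a) (hu1 : ∀ a, u a ≤ 1) {δ ymin : ℝ} (hδ : 0 ≤ δ)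
    (hL : ∀ y, ymin ≤ y → y ≤ 1 → (1 - δ) * y ≤ prob (fun a => u a ≤ y)) (hρ : 1 ≤ ρ)
    (hτ : 0 < τ) (hx : ∀ i, x i = 0 ∨ 0 < x i ∧ ymin ≤ x i / τ) :
    (1 - δ) * subsetSum ρ s x ≤
      𝔼 ω : Fin n → α, sampleSum ρ τ s x (fun i => x i / u (ω i)) := by
  unfold sampleSum subsetSum
  rw [Finset.expect_sum_comm, Finset.mul_sum]
  refine Finset.sum_le_sum fun i _ => ?_
  rw [expect_pi_apply i (fun a => if s i = true ∧ τ ≤ x i / u a then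
    x i ^ (ρ - 1) * max (x i) τ else 0), expect_sampleTerm hu hτ]
  split_ifs
  · rcases hx i with h0 | ⟨h0, hy⟩
    · rw [h0, Real.zero_rpow (by linarith), mul_zero]
      have := prob_nonneg fun a => u a ≤ 0 / τ
      positivity
    · rcases le_total (x i) τ with h | h
      · rw [← div_mul_sampleWeight hρ hτ h0.le h, ← mul_assoc]
        gcongr
        exact hL _ hy ((div_le_one hτ).2 h)
      · rw [sampleWeight_of_le hρ h0.le h,
          prob_eq_one fun a => (hu1 a).trans ((one_le_div hτ).2 h)]
        have : 0 ≤ x i ^ ρ := by positivity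
        nlinarith
  · simp

theorem expect_sub_sq_le (f : α → ℝ) : 𝔼 a, (f a - 𝔼 b, f b) ^ 2 ≤ 𝔼 a, f a ^ 2 := by
  have h : ∀ a, (f a - 𝔼 b, f b) ^ 2 = f a ^ 2 - (2 * 𝔼 b, f b) * f a + (𝔼 b, f b) ^ 2 := by
    intro a
    ring
  simp only [h]
  rw [Finset.expect_add_distrib, Finset.expect_sub_distrib, expect_const_mul, Fintype.expect_const]
  nlinarith [sq_nonneg (𝔼 b, f b)]

/-- The variance of the threshold sampling estimate. Coordinates with `x i ≥ τ` are always sampled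
and contribute nothing. -/
theorem variance_sampleSum_le (hu : ∀ a, 0 < u a) (hu1 : ∀ a, u a ≤ 1)
    (hP : ∀ y, 0 ≤ y → prob (fun a => u a ≤ y) ≤ y) (hρ : 1 ≤ ρ) (hτ : 0 < τ)
    (hx : ∀ i, 0 ≤ x i) :
    𝔼 ω : Fin n → α, (sampleSum ρ τ s x (fun i => x i / u (ω i)) -
      𝔼 ω' : Fin n → α, sampleSum ρ τ s x (fun i => x i / u (ω' i))) ^ 2 ≤
      τ * subsetSum (2 * ρ - 1) s x := by
  set f : Fin n → α → ℝ := fun i a =>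
    if s i = true ∧ τ ≤ x i / u a then x i ^ (ρ - 1) * max (x i) τ else 0 with hf
  have h1 : 𝔼 ω' : Fin n → α, sampleSum ρ τ s x (fun i => x i / u (ω' i)) =
      ∑ i, 𝔼 a, f i a := by
    unfold sampleSum
    rw [Finset.expect_sum_comm]
    exact Finset.sum_congr rfl fun i _ => expect_pi_apply i (f i)
  have h2 : ∀ ω : Fin n → α, sampleSum ρ τ s x (fun i => x i / u (ω i)) - ∑ i, 𝔼 a, f i a =
      ∑ i, (fun i a => f i a - 𝔼 b, f i b) i (ω i) := by
    intro ω
    rw [Finset.sum_sub_distrib]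
    rfl
  rw [h1]
  simp only [h2]
  rw [expect_sum_sq (fun i a => f i a - 𝔼 b, f i b), subsetSum, Finset.mul_sum]
  · refine Finset.sum_le_sum fun i _ => ?_
    have hxi := hx i
    by_cases hs : s i = true
    · rw [if_pos hs]
      rcases le_total τ (x i) with h | h
      · have : ∀ a, f i a = x i ^ (ρ - 1) * max (x i) τ := by
          intro a
          simp only [hf]
          rw [if_pos ⟨hs, (le_div_iff_unif hu hτ _).2 ((hu1 a).trans ((one_le_div hτ).2 h))⟩]
        simp only [this, Fintype.expect_const (x i ^ (ρ - 1) * max (x i) τ), sub_self]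
        simp only [ne_eq, OfNat.ofNat_ne_zero, not_false_eq_true, zero_pow,
          Finset.expect_const_zero]
        positivity
      · refine (expect_sub_sq_le (f i)).trans ?_
        have : ∀ a, f i a ^ 2 = if s i = true ∧ τ ≤ x i / u a then
            (x i ^ (ρ - 1) * max (x i) τ) ^ 2 else 0 := by
          intro a
          simp only [hf]
          split_ifs <;> simp
        simp only [this]
        rw [expect_sampleTerm hu hτ, if_pos hs]
        calc _ ≤ x i / τ * (x i ^ (ρ - 1) * max (x i) τ) ^ 2 := by
              gcongr
              exact hP _ (by positivity)
          _ = x i ^ ρ * (x i ^ (ρ - 1) * τ) := by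
              rw [sq, ← mul_assoc, div_mul_sampleWeight hρ hτ hxi h, max_eq_right h]
          _ = τ * x i ^ (2 * ρ - 1) := by
              rw [show 2 * ρ - 1 = ρ + (ρ - 1) by ring,
                Real.rpow_add' hxi (by linarith : ρ + (ρ - 1) ≠ 0)]
              ring
    · rw [if_neg hs, mul_zero]
      have : ∀ a, f i a = 0 := fun a => by simp [hf, hs]
      simp [this]
  · intro i
    rw [Finset.expect_sub_distrib, Fintype.expect_const, sub_self]

/-- Chebyshev's inequality for the threshold sampling estimate. -/
theorem prob_sampleSum (hu : ∀ a, 0 < u a) (hu1 : ∀ a, u a ≤ 1)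
    (hP : ∀ y, 0 ≤ y → prob (fun a => u a ≤ y) ≤ y) {δ ymin b : ℝ} (hδ : 0 ≤ δ) (hb : 0 < b)
    (hL : ∀ y, ymin ≤ y → y ≤ 1 → (1 - δ) * y ≤ prob (fun a => u a ≤ y)) (hρ : 1 ≤ ρ)
    (hτ : 0 < τ) (hx : ∀ i, x i = 0 ∨ 0 < x i ∧ ymin ≤ x i / τ) :
    prob (fun ω : Fin n → α => ¬ (
      sampleSum ρ τ s x (fun i => x i / u (ω i)) ≤
        subsetSum ρ s x + √(τ / b * subsetSum ρ s x ^ (2 - 1 / ρ)) ∧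
      (1 - δ) * subsetSum ρ s x - √(τ / b * subsetSum ρ s x ^ (2 - 1 / ρ)) ≤
        sampleSum ρ τ s x (fun i => x i / u (ω i)))) ≤ b := by
  have hx0 : ∀ i, 0 ≤ x i := fun i => by
    rcases hx i with h | h
    · exact h.ge
    · exact h.1.le
  have hV := (variance_sampleSum_le hu hu1 hP hρ hτ hx0 (s := s)).trans
    (mul_le_mul_of_nonneg_left (subsetSum_two_mul_sub_one_le hρ hx0) hτ.le)
  refine le_trans (prob_mono ?_) (prob_markov (fun ω => sq_nonneg _) hb.le hV)
  intro ω hω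
  by_contra! hcon
  apply hω
  have h1 := expect_sampleSum_le hu hu1 hP hρ hτ hx0 (s := s)
  have h2 := le_expect_sampleSum hu hu1 hδ hL hρ hτ hx (s := s)
  have h3 : |sampleSum ρ τ s x (fun i => x i / u (ω i)) -
      𝔼 ω' : Fin n → α, sampleSum ρ τ s x (fun i => x i / u (ω' i))| ≤
      √(τ / b * subsetSum ρ s x ^ (2 - 1 / ρ)) := by
    apply Real.abs_le_sqrt
    rw [div_mul_eq_mul_div, le_div_iff₀ hb]
    linarith
  rw [abs_le] at h3
  constructor <;> linarith [h3.1, h3.2]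

end Random

/-! ### Choice of the threshold -/

open Classical in
/-- The largest power of two `τ` for which the threshold sampling estimate of `∑ x` is at least
`k τ`; it is about `(∑ x) / k`, up to a constant factor. -/
noncomputable def threshold {n : ℕ} (k : ℝ) (x z : Fin n → ℝ) : ℝ :=
  if h : ∃ j : ℤ, IsGreatest {j : ℤ | k ≤ sampleSum 1 (2 ^ j) (fun _ => true) x z / 2 ^ j} j then
    2 ^ h.choose else 1

theorem threshold_pos {n : ℕ} (k : ℝ) (x z : Fin n → ℝ) : 0 < threshold k x z := by
  unfold threshold
  split_ifs <;> positivity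

/-- The estimate of `∑ x ^ ρ` over `s` from approximate values `x` and keys `z`. -/
noncomputable def estimate {n : ℕ} (k ρ : ℝ) (x z : Fin n → ℝ) (s : Fin n → Bool) : ℝ :=
  sampleSum ρ (threshold k x z) s x z

/-- A power of two at which the estimate of `∑ x` is at least `k τ`, and a larger one at which it is
not, enclose the threshold. -/
theorem exists_threshold_eq {n : ℕ} {k : ℝ} {x z : Fin n → ℝ} (hx : ∀ i, 0 ≤ x i) (e : ℤ) (d : ℕ)
    (h0 : k ≤ sampleSum 1 (2 ^ e) (fun _ => true) x z / 2 ^ e)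
    (h1 : sampleSum 1 (2 ^ (e + d)) (fun _ => true) x z / 2 ^ (e + d) < k) :
    ∃ i < d, threshold k x z = 2 ^ (e + i) := by
  -- the ratio of the estimate to the threshold is antitone in the threshold
  have hub : ∀ j : ℤ, k ≤ sampleSum 1 (2 ^ j) (fun _ => true) x z / 2 ^ j → j < e + d := by
    intro j hj
    by_contra! hcon
    have := sampleSum_one_div_antitone (s := fun _ => true) (z := z) (τ := 2 ^ (e + (d : ℤ)))
      (τ' := 2 ^ j) (by positivity) (zpow_le_zpow_right₀ (by norm_num) hcon) hx
    linarith
  have hex : ∃ j : ℤ,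
      IsGreatest {j : ℤ | k ≤ sampleSum 1 (2 ^ j) (fun _ => true) x z / 2 ^ j} j := by
    obtain ⟨j, hj, hmax⟩ := Int.exists_greatest_of_bdd
      (P := fun j : ℤ => k ≤ sampleSum 1 (2 ^ j) (fun _ => true) x z / 2 ^ j)
      ⟨e + d, fun j hj => (hub j hj).le⟩ ⟨e, h0⟩
    exact ⟨j, hj, fun j' hj' => hmax j' hj'⟩
  have hsp := hex.choose_spec
  have hlo : e ≤ hex.choose := hsp.2 h0
  have hhi := hub _ hsp.1
  refine ⟨(hex.choose - e).toNat, by omega, ?_⟩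
  rw [threshold, dif_pos hex]
  congr 1
  omega

/-! ### Stability under small relative errors of the keys -/

theorem exp_le_one_add_two_mul {t : ℝ} (h0 : 0 ≤ t) (h1 : t ≤ 1 / 2) :
    Real.exp t ≤ 1 + 2 * t := by
  have h := Real.exp_bound_div_one_sub_of_interval h0 (by linarith : t < 1)
  refine h.trans ?_
  rw [div_le_iff₀ (by linarith)]
  nlinarith

/-- An additive error `η θ` is a relative error `O(η)` for numbers that reach `θ`, and the `q`-th
powers have a relative error `O(q η)`. -/
theorem rpow_rel_error {a b θ q η δ : ℝ} (ha : 0 ≤ a) (hb : 0 ≤ b) (hq : 0 < q)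
    (hη : 0 < η) (hη1 : η ≤ 1 / 4) (hδ : 4 * q * η ≤ δ) (hδ1 : δ ≤ 1) (hab : |b - a| ≤ η * θ)
    (h : θ ≤ a ∨ θ ≤ b) : (1 - δ) * a ^ q ≤ b ^ q ∧ b ^ q ≤ (1 + δ) * a ^ q := by
  rw [abs_le] at hab
  have hlo : (1 - η) * a ≤ b := by
    rcases h with h | h <;> nlinarith
  have hhi : b ≤ (1 + 2 * η) * a := by
    rcases h with h | h
    · nlinarith
    · have h1 : (1 - η) * b ≤ a := by nlinarith
      have h2 : b ≤ (1 + 2 * η) * ((1 - η) * b) := by nlinarith [mul_nonneg hη.le hb]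
      nlinarith
  constructor
  · have h1 : 1 - δ ≤ (1 - η) ^ q := by
      have e1 : Real.exp (-(2 * η)) ≤ 1 - η := by
        rw [Real.exp_neg, inv_le_comm₀ (Real.exp_pos _) (by linarith)]
        have := Real.add_one_le_exp (2 * η)
        refine le_trans ?_ this
        rw [inv_le_iff_one_le_mul₀ (by linarith)]
        nlinarith
      calc 1 - δ ≤ -(2 * η) * q + 1 := by nlinarith
        _ ≤ Real.exp (-(2 * η) * q) := Real.add_one_le_exp _
        _ = Real.exp (-(2 * η)) ^ q := Real.exp_mul _ _
        _ ≤ (1 - η) ^ q := Real.rpow_le_rpow (Real.exp_pos _).le e1 hq.le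
    calc (1 - δ) * a ^ q ≤ (1 - η) ^ q * a ^ q := by gcongr
      _ = ((1 - η) * a) ^ q := (Real.mul_rpow (by linarith) ha).symm
      _ ≤ b ^ q := Real.rpow_le_rpow (mul_nonneg (by linarith) ha) hlo hq.le
  · have h1 : (1 + 2 * η) ^ q ≤ 1 + δ := by
      calc (1 + 2 * η) ^ q ≤ Real.exp (2 * η) ^ q := by
            refine Real.rpow_le_rpow (by linarith) ?_ hq.le
            linarith [Real.add_one_le_exp (2 * η)]
        _ = Real.exp (2 * η * q) := (Real.exp_mul _ _).symm
        _ ≤ 1 + 2 * (2 * η * q) := exp_le_one_add_two_mul (by positivity) (by nlinarith)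
        _ ≤ 1 + δ := by nlinarith
    calc b ^ q ≤ ((1 + 2 * η) * a) ^ q := Real.rpow_le_rpow hb hhi hq.le
      _ = (1 + 2 * η) ^ q * a ^ q := Real.mul_rpow (by linarith) ha
      _ ≤ (1 + δ) * a ^ q := by gcongr

section Approximate

variable {n : ℕ} {x z x' z' : Fin n → ℝ} {s : Fin n → Bool} {k ρ δ ε N X τ τ₀ : ℝ} {e : ℤ}

/-- Upper half of the sandwich: a key that is known up to a factor `1 ± δ` and reaches `τ` has an
exact value of at least `τ / (1 + δ)`. -/
theorem sampleSum_approx_le (hx : ∀ i, 0 ≤ x i) (hx' : ∀ i, 0 ≤ x' i) (hρ : 1 ≤ ρ) (hδ : 0 < δ)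
    (hτ₀ : 0 < τ₀) (hτ : τ₀ ≤ τ) (hz : ∀ i, τ₀ ≤ z i ∨ τ₀ ≤ z' i → z' i ≤ (1 + δ) * z i)
    (hxx : ∀ i, τ₀ ≤ z i ∨ τ₀ ≤ z' i → x' i ≤ (1 + δ) * x i) :
    sampleSum ρ τ s x' z' ≤ (1 + δ) ^ ρ * sampleSum ρ (τ / (1 + δ)) s x z := by
  refine sampleSum_le_mul (by linarith) (hτ₀.trans_le hτ) hρ hx hx' fun i hi => ?_
  refine ⟨?_, hxx i (Or.inr (hτ.trans hi))⟩
  rw [div_le_iff₀ (by linarith)]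
  linarith [hz i (Or.inr (hτ.trans hi))]

/-- Lower half of the sandwich: a key with exact value at least `τ / (1 - δ)` is also seen to reach
`τ`. -/
theorem le_sampleSum_approx (hx : ∀ i, 0 ≤ x i) (hx' : ∀ i, 0 ≤ x' i) (hρ : 1 ≤ ρ) (hδ : 0 < δ)
    (hδ1 : δ < 1) (hτ₀ : 0 < τ₀) (hτ : τ₀ ≤ τ)
    (hz : ∀ i, τ₀ ≤ z i ∨ τ₀ ≤ z' i → (1 - δ) * z i ≤ z' i)
    (hxx : ∀ i, τ₀ ≤ z i ∨ τ₀ ≤ z' i → (1 - δ) * x i ≤ x' i) :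
    (1 - δ) ^ ρ * sampleSum ρ (τ / (1 - δ)) s x z ≤ sampleSum ρ τ s x' z' := by
  have hτ0 := hτ₀.trans_le hτ
  have h1δ : 0 < 1 - δ := by linarith
  have h := sampleSum_le_mul (c := (1 - δ)⁻¹) (τ := τ / (1 - δ)) (s := s) (x := x') (z := z')
    (x' := x) (z' := z) (inv_pos.2 h1δ) (by positivity) hρ hx' hx ?_
  · rw [div_inv_eq_mul, div_mul_cancel₀ _ h1δ.ne', Real.inv_rpow h1δ.le] at h
    rwa [le_inv_mul_iff₀ (by positivity)] at h
  · intro i hi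
    have hi' : τ₀ ≤ z i := by
      refine hτ.trans (le_trans ?_ hi)
      rw [le_div_iff₀ h1δ]
      nlinarith
    rw [div_inv_eq_mul, div_mul_cancel₀ _ h1δ.ne', inv_mul_eq_div, le_div_iff₀ h1δ]
    rw [div_le_iff₀ h1δ] at hi
    constructor
    · linarith [hz i (Or.inl hi')]
    · linarith [hxx i (Or.inl hi')]

/-- The threshold is found within a constant factor of `N / k`. -/
theorem exists_threshold_eq_of_approx (hx : ∀ i, 0 ≤ x i) (hx' : ∀ i, 0 ≤ x' i) (hδ0 : 0 < δ)
    (hδ16 : δ ≤ 1 / 16) (hk : 200000 ≤ k) (hN0 : 0 < N)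
    (he : 2 ^ e * (4 * k) ≤ N) (he' : N < 2 ^ e * 2 * (4 * k))
    (hz : ∀ i, 2 ^ e ≤ z i ∨ 2 ^ e ≤ z' i → (1 - δ) * z i ≤ z' i ∧ z' i ≤ (1 + δ) * z i)
    (hxx : ∀ i, 2 ^ e ≤ z i ∨ 2 ^ e ≤ z' i → (1 - δ) * x i ≤ x' i ∧ x' i ≤ (1 + δ) * x i)
    (h3 : sampleSum 1 (2 ^ (e + 14) / (1 + δ)) (fun _ => true) x z ≤ 1000 * N)
    (h4 : (1 - δ) * N - √(2 ^ e / (1 - δ) / (1 / 20000) * N) ≤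
      sampleSum 1 (2 ^ e / (1 - δ)) (fun _ => true) x z) :
    ∃ i < 14, threshold k x' z' = 2 ^ (e + (i : ℕ)) := by
  have hE : (0 : ℝ) < 2 ^ e := by positivity
  have hlow : k ≤ sampleSum 1 (2 ^ e) (fun _ => true) x' z' / 2 ^ e := by
    rw [le_div_iff₀ hE]
    have h := le_sampleSum_approx (s := fun _ => true) hx hx' le_rfl hδ0 (by linarith) hE le_rfl
      (fun i hi => (hz i hi).1) (fun i hi => (hxx i hi).1)
    rw [Real.rpow_one] at h
    have hs : √(2 ^ e / (1 - δ) / (1 / 20000) * N) ≤ N / 4 := by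
      apply Real.sqrt_le_iff.2
      refine ⟨by linarith, ?_⟩
      have h1δ : 0 < 1 - δ := by linarith
      have h0 : 2 ^ e / (1 - δ) / (1 / 20000) * N = 2 ^ e * 20000 * N / (1 - δ) := by
        field_simp
      rw [h0, div_le_iff₀ h1δ]
      have h1 : 2 ^ e * 800000 ≤ N := by nlinarith
      have h2 : 2 ^ e * 800000 * N ≤ N * N := by gcongr
      have h3 : N * N * δ ≤ N * N * (1 / 16) := by gcongr
      nlinarith
    have hS : 11 / 16 * N ≤ sampleSum 1 (2 ^ e / (1 - δ)) (fun _ => true) x z := by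
      nlinarith
    nlinarith
  have hhigh : sampleSum 1 (2 ^ (e + (14 : ℕ))) (fun _ => true) x' z' / 2 ^ (e + (14 : ℕ)) < k := by
    have e1 : (2 : ℝ) ^ (e + ((14 : ℕ) : ℤ)) = 2 ^ e * 16384 := by
      rw [zpow_add₀ (by norm_num)]
      norm_num
    have h := sampleSum_approx_le (s := fun _ => true) (τ := 2 ^ (e + ((14 : ℕ) : ℤ)))
      hx hx' le_rfl hδ0 hE (by rw [e1]; nlinarith)
      (fun i hi => (hz i hi).2) (fun i hi => (hxx i hi).2)
    rw [Real.rpow_one] at h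
    rw [div_lt_iff₀ (by positivity), e1]
    rw [e1] at h
    have e2 : (2 : ℝ) ^ (e + 14) = 2 ^ e * 16384 := e1
    rw [e2] at h3
    nlinarith
  exact exists_threshold_eq hx' e 14 hlow hhigh

/-- The standard deviation of the threshold sampling estimate, for a threshold `O(N / k)`. -/
theorem sqrt_variance_le (hx : ∀ i, 0 ≤ x i) (hρ : 1 ≤ ρ) (hε : 0 < ε) (hk : 0 < k)
    (hkκ : 4096 * 20000 * 64 / ε ^ 2 * (n : ℝ) ^ (1 - 1 / ρ) ≤ k) (hX0 : 0 ≤ X)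
    (hτN : τ * k ≤ 4096 * subsetSum 1 (fun _ => true) x) :
    √(τ / (1 / 20000) * X ^ (2 - 1 / ρ)) ≤
      ε / 8 * (subsetSum ρ (fun _ => true) x ^ (1 / (2 * ρ)) * X ^ (1 - 1 / (2 * ρ))) := by
  set Np := subsetSum ρ (fun _ => true) x with hNp
  have hNp0 : 0 ≤ Np := subsetSum_nonneg hx
  have hsq : (Np ^ (1 / (2 * ρ)) * X ^ (1 - 1 / (2 * ρ))) ^ 2 =
      Np ^ (1 / ρ) * X ^ (2 - 1 / ρ) := by
    rw [mul_pow, ← Real.rpow_mul_natCast hNp0, ← Real.rpow_mul_natCast hX0]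
    congr 2 <;> push_cast <;> field_simp
  apply Real.sqrt_le_iff.2
  refine ⟨by positivity, ?_⟩
  rw [mul_pow, hsq]
  have hmean := subsetSum_one_le hρ hx
  rw [← hNp] at hmean
  have h1 : τ * 20000 ≤ (ε / 8) ^ 2 * Np ^ (1 / ρ) := by
    have hε2 : 0 < ε ^ 2 := by positivity
    have hkκ' : 4096 * 20000 * 64 * (n : ℝ) ^ (1 - 1 / ρ) ≤ k * ε ^ 2 := by
      rw [div_mul_eq_mul_div, div_le_iff₀ hε2] at hkκ
      exact hkκ
    have h2 : τ * k ≤ 4096 * ((n : ℝ) ^ (1 - 1 / ρ) * Np ^ (1 / ρ)) := by linarith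
    have h3 : τ * 20000 * 64 * k ≤ k * ε ^ 2 * Np ^ (1 / ρ) := by
      calc τ * 20000 * 64 * k = 20000 * 64 * (τ * k) := by ring
        _ ≤ 20000 * 64 * (4096 * ((n : ℝ) ^ (1 - 1 / ρ) * Np ^ (1 / ρ))) := by gcongr
        _ = 4096 * 20000 * 64 * (n : ℝ) ^ (1 - 1 / ρ) * Np ^ (1 / ρ) := by ring
        _ ≤ _ := by gcongr
    have h4 : τ * 20000 * 64 ≤ ε ^ 2 * Np ^ (1 / ρ) :=
      le_of_mul_le_mul_right (by linarith) hk
    linarith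
  calc τ / (1 / 20000) * X ^ (2 - 1 / ρ) = τ * 20000 * X ^ (2 - 1 / ρ) := by ring
    _ ≤ (ε / 8) ^ 2 * Np ^ (1 / ρ) * X ^ (2 - 1 / ρ) := by gcongr
    _ = _ := by ring

/-- If the keys that reach `2 ^ e ≈ N / (4 k)` are known up to a factor `1 ± δ`, then the threshold
sampling estimates with exact keys control both the choice of the threshold and the estimate. -/
theorem abs_estimate_sub_le (hx : ∀ i, 0 ≤ x i) (hx' : ∀ i, 0 ≤ x' i) (hρ : 1 ≤ ρ) (hε : 0 < ε)
    (hε1 : ε ≤ 1) (hδ : δ = ε / (16 * ρ)) (hk : 200000 ≤ k)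
    (hkκ : 4096 * 20000 * 64 / ε ^ 2 * (n : ℝ) ^ (1 - 1 / ρ) ≤ k)
    (hN : N = subsetSum 1 (fun _ => true) x) (hN0 : 0 < N) (hX : X = subsetSum ρ s x)
    (he : 2 ^ e * (4 * k) ≤ N) (he' : N < 2 ^ e * 2 * (4 * k))
    (hz : ∀ i, 2 ^ e ≤ z i ∨ 2 ^ e ≤ z' i → (1 - δ) * z i ≤ z' i ∧ z' i ≤ (1 + δ) * z i)
    (hxx : ∀ i, 2 ^ e ≤ z i ∨ 2 ^ e ≤ z' i → (1 - δ) * x i ≤ x' i ∧ x' i ≤ (1 + δ) * x i)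
    (h3 : sampleSum 1 (2 ^ (e + 14) / (1 + δ)) (fun _ => true) x z ≤ 1000 * N)
    (h4 : (1 - δ) * N - √(2 ^ e / (1 - δ) / (1 / 20000) * N) ≤
      sampleSum 1 (2 ^ e / (1 - δ)) (fun _ => true) x z)
    (h5 : ∀ i < 14, sampleSum ρ (2 ^ (e + (i : ℕ)) / (1 + δ)) s x z ≤
      X + √(2 ^ (e + (i : ℕ)) / (1 + δ) / (1 / 20000) * X ^ (2 - 1 / ρ)))
    (h6 : ∀ i < 14, (1 - δ) * X - √(2 ^ (e + (i : ℕ)) / (1 - δ) / (1 / 20000) * X ^ (2 - 1 / ρ)) ≤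
      sampleSum ρ (2 ^ (e + (i : ℕ)) / (1 - δ)) s x z) :
    2 ^ e ≤ threshold k x' z' ∧
      |estimate k ρ x' z' s - X| ≤
        ε * (subsetSum ρ (fun _ => true) x ^ (1 / (2 * ρ)) * X ^ (1 - 1 / (2 * ρ))) := by
  have hρ0 : 0 < ρ := by linarith
  have hδ0 : 0 < δ := by rw [hδ]; positivity
  have hρδ : ρ * δ = ε / 16 := by rw [hδ]; field_simp
  have hδε : δ ≤ ε / 16 := by nlinarith
  have hδ16 : δ ≤ 1 / 16 := by linarith
  have hE : (0 : ℝ) < 2 ^ e := by positivity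
  have hX0 : 0 ≤ X := hX ▸ subsetSum_nonneg hx
  obtain ⟨i, hi, hthr⟩ := exists_threshold_eq_of_approx hx hx' hδ0 hδ16 hk hN0 he he' hz hxx h3 h4
  have e3 : (2 : ℝ) ^ (e + (i : ℤ)) = 2 ^ e * 2 ^ i := by
    rw [zpow_add₀ (by norm_num), zpow_natCast]
  have hi1 : (1 : ℝ) ≤ 2 ^ i := one_le_pow₀ (by norm_num)
  have hi13 : (2 : ℝ) ^ i ≤ 2 ^ 13 := pow_le_pow_right₀ (by norm_num) (by omega)
  have hge : (2 : ℝ) ^ e ≤ 2 ^ (e + (i : ℤ)) := by rw [e3]; nlinarith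
  refine ⟨hthr ▸ hge, ?_⟩
  have h5' := h5 i hi
  have h6' := h6 i hi
  have hτN : (2 : ℝ) ^ (e + (i : ℤ)) * k ≤ 2048 * N := by
    rw [e3]
    calc (2 : ℝ) ^ e * 2 ^ i * k ≤ 2 ^ e * 2 ^ 13 * k := by gcongr
      _ = 2048 * (2 ^ e * (4 * k)) := by ring
      _ ≤ 2048 * N := by gcongr
  clear h5 h6 e3
  rw [estimate, hthr]
  clear hthr
  generalize (2 : ℝ) ^ (e + (i : ℤ)) = τ at *
  have hτ0 : 0 < τ := hE.trans_le hge
  -- the thresholds `τ / (1 ± δ)` for the exact keys are both at most `2 τ`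
  have hW : ∀ τ', τ' ≤ 2 * τ → τ' * k ≤ 4096 * subsetSum 1 (fun _ => true) x := by
    intro τ' hτ'
    rw [← hN]
    calc τ' * k ≤ 2 * τ * k := by gcongr
      _ ≤ 4096 * N := by linarith
  have hW1 := sqrt_variance_le hx hρ hε (by linarith) hkκ hX0
    (hW (τ / (1 + δ)) (by rw [div_le_iff₀ (by linarith)]; nlinarith))
  have hW2 := sqrt_variance_le hx hρ hε (by linarith) hkκ hX0
    (hW (τ / (1 - δ)) (by rw [div_le_iff₀ (by linarith)]; nlinarith))
  have hU := sampleSum_approx_le (s := s) hx hx' hρ hδ0 hE hge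
    (fun i hi => (hz i hi).2) (fun i hi => (hxx i hi).2)
  have hL := le_sampleSum_approx (s := s) hx hx' hρ hδ0 (by linarith) hE hge
    (fun i hi => (hz i hi).1) (fun i hi => (hxx i hi).1)
  have hNp0 : 0 ≤ subsetSum ρ (fun _ => true) x := subsetSum_nonneg hx
  have hXNp : X ≤ subsetSum ρ (fun _ => true) x := hX ▸ subsetSum_le_univ hx
  generalize subsetSum ρ (fun _ => true) x = Np at *
  -- the relative errors `(1 ± δ) ^ ρ` contribute `O(ε X)`, which the error bound absorbs
  have hXG : X ≤ Np ^ (1 / (2 * ρ)) * X ^ (1 - 1 / (2 * ρ)) := by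
    calc X = X ^ (1 / (2 * ρ) + (1 - 1 / (2 * ρ))) := by simp
      _ = X ^ (1 / (2 * ρ)) * X ^ (1 - 1 / (2 * ρ)) := Real.rpow_add' hX0 (by simp)
      _ ≤ _ := by gcongr
  have hG0 : 0 ≤ Np ^ (1 / (2 * ρ)) * X ^ (1 - 1 / (2 * ρ)) := by positivity
  generalize Np ^ (1 / (2 * ρ)) * X ^ (1 - 1 / (2 * ρ)) = G at *
  have hpow1 : (1 + δ) ^ ρ ≤ 1 + ε / 8 := by
    calc (1 + δ) ^ ρ ≤ Real.exp δ ^ ρ :=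
          Real.rpow_le_rpow (by linarith) (by linarith [Real.add_one_le_exp δ]) hρ0.le
      _ = Real.exp (δ * ρ) := (Real.exp_mul _ _).symm
      _ ≤ 1 + 2 * (δ * ρ) := exp_le_one_add_two_mul (by positivity) (by linarith)
      _ = 1 + ε / 8 := by linarith
  have hpow2 : 1 - ε / 16 ≤ (1 - δ) ^ ρ := by
    have h := one_add_mul_self_le_rpow_one_add (by linarith : -1 ≤ -δ) hρ
    rw [← sub_eq_add_neg 1 δ] at h
    linarith
  have hpow0 : (1 - δ) ^ ρ ≤ 1 := Real.rpow_le_one (by linarith) (by linarith) hρ0.le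
  have hpow3 : 0 ≤ (1 - δ) ^ ρ := Real.rpow_nonneg (by linarith) _
  generalize (1 + δ) ^ ρ = A at *
  generalize (1 - δ) ^ ρ = A' at *
  have h13 : ε * X ≤ ε * G := by gcongr
  have h15 : 0 ≤ ε * G := by positivity
  rw [abs_le]
  constructor
  · have h7 : A' * ((1 - δ) * X - ε / 8 * G) ≤ sampleSum ρ τ s x' z' :=
      (mul_le_mul_of_nonneg_left (by linarith) hpow3).trans hL
    have h8 : (1 - ε / 16) * ((1 - δ) * X) ≤ A' * ((1 - δ) * X) :=
      mul_le_mul_of_nonneg_right hpow2 (mul_nonneg (by linarith) hX0)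
    have h9 : A' * (ε / 8 * G) ≤ ε / 8 * G := mul_le_of_le_one_left (by positivity) hpow0
    have h11 : δ * X ≤ ε / 16 * X := by gcongr
    have h12 : 0 ≤ ε * (δ * X) := by positivity
    linarith
  · have h7 : sampleSum ρ τ s x' z' ≤ (1 + ε / 8) * (X + ε / 8 * G) := by
      refine hU.trans (mul_le_mul hpow1 (by linarith) ?_ (by linarith))
      refine Finset.sum_nonneg fun i _ => ?_
      have := hx i
      split_ifs <;> positivity
    have h14 : ε * (ε * G) ≤ 1 * (ε * G) := by gcongr
    linarith

end Approximate

/-! ### The estimator and its failure probability -/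

/-- The requirements on the exact keys `z` under which the sampling scheme succeeds. -/
structure GoodKeys {n : ℕ} (ρ δ Λ : ℝ) (e : ℤ) (s : Fin n → Bool) (x z : Fin n → ℝ) : Prop where
  sum_le : ∑ i, z i ≤ Λ * subsetSum 1 (fun _ => true) x
  high : sampleSum 1 (2 ^ (e + 14) / (1 + δ)) (fun _ => true) x z ≤
    1000 * subsetSum 1 (fun _ => true) x
  low : (1 - δ) * subsetSum 1 (fun _ => true) x -
      √(2 ^ e / (1 - δ) / (1 / 20000) * subsetSum 1 (fun _ => true) x) ≤
    sampleSum 1 (2 ^ e / (1 - δ)) (fun _ => true) x z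
  upper : ∀ i < 14, sampleSum ρ (2 ^ (e + (i : ℕ)) / (1 + δ)) s x z ≤
    subsetSum ρ s x +
      √(2 ^ (e + (i : ℕ)) / (1 + δ) / (1 / 20000) * subsetSum ρ s x ^ (2 - 1 / ρ))
  lower : ∀ i < 14, (1 - δ) * subsetSum ρ s x -
      √(2 ^ (e + (i : ℕ)) / (1 - δ) / (1 / 20000) * subsetSum ρ s x ^ (2 - 1 / ρ)) ≤
    sampleSum ρ (2 ^ (e + (i : ℕ)) / (1 - δ)) s x z

/-- Markov's inequality for the first two requirements, Chebyshev's inequality for the others. -/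
theorem prob_not_goodKeys {n : ℕ} {α : Type*} [Fintype α] [Nonempty α] {u : α → ℝ}
    {ρ δ l ymin : ℝ} {e : ℤ} {s : Fin n → Bool} {x : Fin n → ℝ}
    (hu : ∀ a, 0 < u a) (hu1 : ∀ a, u a ≤ 1)
    (hP : ∀ y, 0 ≤ y → prob (fun a => u a ≤ y) ≤ y)
    (hL : ∀ y, ymin ≤ y → y ≤ 1 → (1 - δ) * y ≤ prob (fun a => u a ≤ y))
    (hl : 𝔼 a, (u a)⁻¹ ≤ l) (hδ : 0 ≤ δ) (hδ1 : δ ≤ 1 / 2) (hρ : 1 ≤ ρ)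
    (hx : ∀ i, x i = 0 ∨ 0 < x i ∧ ymin * (2 ^ (e + 14)) ≤ x i) (hymin : 0 < ymin) :
    prob (fun ω : Fin n → α => ¬ GoodKeys ρ δ (1000 * l) e s x (fun i => x i / u (ω i))) ≤
      345 / 100000 := by
  have hE : (0 : ℝ) < 2 ^ e := by positivity
  have hx0 : ∀ i, 0 ≤ x i := fun i => by
    rcases hx i with h | h
    · exact h.ge
    · exact h.1.le
  set N := subsetSum 1 (fun _ => true) x with hN
  have hN' : N = ∑ i, x i := by simp [hN, subsetSum]
  have e14 : (2 : ℝ) ^ (e + 14) = 2 ^ e * 16384 := by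
    rw [zpow_add₀ (by norm_num)]
    norm_num
  have hpow : ∀ i < 14, (2 : ℝ) ^ (e + ((i : ℕ) : ℤ)) ≤ 2 ^ e * 8192 := by
    intro i hi
    rw [zpow_add₀ (by norm_num), zpow_natCast]
    gcongr
    calc (2 : ℝ) ^ i ≤ 2 ^ 13 := pow_le_pow_right₀ (by norm_num) (by omega)
      _ = 8192 := by norm_num
  have hxτ : ∀ τ, 0 < τ → τ ≤ 2 ^ e * 16384 → ∀ i, x i = 0 ∨ 0 < x i ∧ ymin ≤ x i / τ := by
    intro τ hτ hτ' i
    refine (hx i).imp_right fun h => ⟨h.1, ?_⟩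
    rw [le_div_iff₀ hτ]
    refine le_trans ?_ h.2
    rw [e14]
    gcongr
  have hdivp : ∀ τ : ℝ, 0 < τ → τ / (1 + δ) ≤ 2 * τ := fun τ hτ => by
    rw [div_le_iff₀ (by linarith)]
    nlinarith
  have hdivm : ∀ τ : ℝ, 0 < τ → τ / (1 - δ) ≤ 2 * τ := fun τ hτ => by
    rw [div_le_iff₀ (by linarith)]
    nlinarith
  have h1 : prob (fun ω : Fin n → α =>
      N * l < 1 / 1000 * ∑ i, x i / u (ω i)) ≤ 1 / 1000 := by
    refine prob_markov (f := fun ω : Fin n → α => ∑ i, x i / u (ω i)) ?_ (by norm_num) ?_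
    · intro ω
      exact Finset.sum_nonneg fun i _ => div_nonneg (hx0 i) (hu _).le
    · rw [Finset.expect_sum_comm, hN', Finset.sum_mul]
      refine Finset.sum_le_sum fun i _ => ?_
      rw [expect_pi_apply i (fun a => x i / u a)]
      simp only [div_eq_mul_inv]
      rw [expect_const_mul]
      exact mul_le_mul_of_nonneg_left hl (hx0 i)
  have h2 : prob (fun ω : Fin n → α => N < 1 / 1000 *
      sampleSum 1 (2 ^ (e + 14) / (1 + δ)) (fun _ => true) x (fun i => x i / u (ω i))) ≤
      1 / 1000 := by
    have hτ : (0 : ℝ) < 2 ^ (e + 14) / (1 + δ) := by positivity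
    refine prob_markov ?_ (by norm_num) (expect_sampleSum_le hu hu1 hP le_rfl hτ hx0)
    intro ω
    refine Finset.sum_nonneg fun i _ => ?_
    have := hx0 i
    split_ifs <;> positivity
  have h3 := prob_sampleSum (s := fun _ => true) hu hu1 hP hδ (b := 1 / 20000) (by norm_num) hL
    le_rfl (τ := 2 ^ e / (1 - δ)) (div_pos hE (by linarith)) (hxτ _ (div_pos hE (by linarith))
      ((hdivm _ hE).trans (by linarith)))
  -- the threshold is `2 ^ (e + i)` for some `i < 14`, and all of these are controlled at once
  have h4 := prob_exists_le (Finset.range 14) (fun (i : ℕ) (ω : Fin n → α) =>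
      ¬ (sampleSum ρ (2 ^ (e + (i : ℤ)) / (1 + δ)) s x (fun i => x i / u (ω i)) ≤
        subsetSum ρ s x +
          √(2 ^ (e + (i : ℤ)) / (1 + δ) / (1 / 20000) * subsetSum ρ s x ^ (2 - 1 / ρ)) ∧
      (1 - δ) * subsetSum ρ s x -
          √(2 ^ (e + (i : ℤ)) / (1 + δ) / (1 / 20000) * subsetSum ρ s x ^ (2 - 1 / ρ)) ≤
        sampleSum ρ (2 ^ (e + (i : ℤ)) / (1 + δ)) s x (fun i => x i / u (ω i))))
  have h5 := prob_exists_le (Finset.range 14) (fun (i : ℕ) (ω : Fin n → α) =>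
      ¬ (sampleSum ρ (2 ^ (e + (i : ℤ)) / (1 - δ)) s x (fun i => x i / u (ω i)) ≤
        subsetSum ρ s x +
          √(2 ^ (e + (i : ℤ)) / (1 - δ) / (1 / 20000) * subsetSum ρ s x ^ (2 - 1 / ρ)) ∧
      (1 - δ) * subsetSum ρ s x -
          √(2 ^ (e + (i : ℤ)) / (1 - δ) / (1 / 20000) * subsetSum ρ s x ^ (2 - 1 / ρ)) ≤
        sampleSum ρ (2 ^ (e + (i : ℤ)) / (1 - δ)) s x (fun i => x i / u (ω i))))
  have h4' := h4.trans (Finset.sum_le_card_nsmul _ _ (1 / 20000) fun i hi => by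
    have hτ : (0 : ℝ) < 2 ^ (e + (i : ℤ)) := by positivity
    have hτ' : (0 : ℝ) < 2 ^ (e + (i : ℤ)) / (1 + δ) := by positivity
    exact prob_sampleSum hu hu1 hP hδ (by norm_num) hL hρ hτ' (hxτ _ hτ'
      ((hdivp _ hτ).trans (by linarith [hpow i (Finset.mem_range.1 hi)]))))
  have h5' := h5.trans (Finset.sum_le_card_nsmul _ _ (1 / 20000) fun i hi => by
    have hτ : (0 : ℝ) < 2 ^ (e + (i : ℤ)) := by positivity
    have hτ' : (0 : ℝ) < 2 ^ (e + (i : ℤ)) / (1 - δ) := div_pos hτ (by linarith)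
    exact prob_sampleSum hu hu1 hP hδ (by norm_num) hL hρ hτ' (hxτ _ hτ'
      ((hdivm _ hτ).trans (by linarith [hpow i (Finset.mem_range.1 hi)]))))
  have hall := (prob_or_le _ _).trans (add_le_add h1 ((prob_or_le _ _).trans (add_le_add h2
    ((prob_or_le _ _).trans (add_le_add h3 ((prob_or_le _ _).trans (add_le_add h4' h5')))))))
  refine le_trans (prob_mono ?_) (hall.trans (by rw [Finset.card_range]; norm_num))
  intro ω hω
  by_contra! hcon
  obtain ⟨c1, c2, c3, c4, c5⟩ := hcon
  refine hω ⟨by linarith, by linarith, ?_, fun i hi => (c4 i (Finset.mem_range.2 hi)).1,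
    fun i hi => (c5 i (Finset.mem_range.2 hi)).2⟩
  have := c3.2
  norm_num at this ⊢
  exact this

section Sketch

variable {n D B R : ℕ}

/-- The random seed of the sketch: a random number for every coordinate and the randomness of the
`R` rows of a count sketch. -/
abbrev Seed (n D B R : ℕ) : Type := (Fin n → Fin D) × (Fin R → Row n B)

/-- The coordinates of `v` multiplied by the random multipliers. -/
noncomputable def scaled (q : ℝ) (K : ℕ) (j : Fin n → Fin D) (v : Fin n → ℤ) (i : Fin n) : ℤ :=
  mult q K D (j i) * v i

/-- The linear sketch of `v`: a count sketch of the scaled vector. -/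
noncomputable def sketch (q : ℝ) (K : ℕ) (ω : Seed n D B R) (v : Fin n → ℤ) (r : Fin R)
    (b : Fin B) : ℤ :=
  bucketSum (scaled q K ω.1 v) (ω.2 r) b

/-- The approximate key of coordinate `i`, an estimate of `|v i| ^ q / u i`. -/
noncomputable def keyEst (q : ℝ) (K : ℕ) (ω : Seed n D B R) (y : Fin R → Fin B → ℤ) (i : Fin n) :
    ℝ :=
  (|sketchEst ω.2 y i| / K) ^ q

/-- The estimate of `|v i| ^ q` that corresponds to the approximate key. -/
noncomputable def valEst (q : ℝ) (K : ℕ) (ω : Seed n D B R) (y : Fin R → Fin B → ℤ) (i : Fin n) :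
    ℝ :=
  keyEst q K ω y i * unif q K D (ω.1 i)

/-- The coordinates whose approximate keys reach the threshold. Should there be more than `L` of
them, the sample is discarded. -/
noncomputable def sampled (k q : ℝ) (K L : ℕ) (ω : Seed n D B R) (y : Fin R → Fin B → ℤ) :
    Finset (Fin n) :=
  let S : Finset (Fin n) :=
    {i | threshold k (valEst q K ω y) (keyEst q K ω y) ≤ keyEst q K ω y i}
  if #S ≤ L then S else ∅

/-- The estimate of `∑ |v i| ^ (q ρ)` over `s`. It depends on `s` only through the sampled
coordinates. -/
noncomputable def output (k ρ q : ℝ) (K L : ℕ) (ω : Seed n D B R) (y : Fin R → Fin B → ℤ)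
    (s : Fin n → Bool) : ℝ :=
  ∑ i ∈ sampled k q K L ω y, if s i = true then valEst q K ω y i ^ (ρ - 1) *
    max (valEst q K ω y i) (threshold k (valEst q K ω y) (keyEst q K ω y)) else 0

theorem card_sampled_le (k q : ℝ) (K L : ℕ) (ω : Seed n D B R) (y : Fin R → Fin B → ℤ) :
    #(sampled k q K L ω y) ≤ L := by
  unfold sampled
  dsimp only
  split_ifs with h
  · exact h
  · simp

theorem output_congr (k ρ q : ℝ) (K L : ℕ) (ω : Seed n D B R) (y : Fin R → Fin B → ℤ)
    {s s' : Fin n → Bool} (h : ∀ i ∈ sampled k q K L ω y, s i = s' i) :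
    output k ρ q K L ω y s = output k ρ q K L ω y s' :=
  Finset.sum_congr rfl fun i hi => by rw [h i hi]

theorem output_eq_estimate (k ρ q : ℝ) (K L : ℕ) (ω : Seed n D B R) (y : Fin R → Fin B → ℤ)
    (s : Fin n → Bool)
    (h : #{i | threshold k (valEst q K ω y) (keyEst q K ω y) ≤ keyEst q K ω y i} ≤ L) :
    output k ρ q K L ω y s = estimate k ρ (valEst q K ω y) (keyEst q K ω y) s := by
  unfold output sampled estimate sampleSum
  dsimp only
  rw [if_pos h, Finset.sum_filter]
  refine Finset.sum_congr rfl fun i _ => ?_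
  split_ifs <;> simp_all

theorem abs_scaled_div (q : ℝ) (K : ℕ) (j : Fin n → Fin D) (v : Fin n → ℤ) (i : Fin n)
    (hq : 0 < q) (hK : 0 < K) :
    (|(scaled q K j v i : ℝ)| / K) ^ q = |(v i : ℝ)| ^ q / unif q K D (j i) := by
  have hm := mult_pos hq hK (j i)
  unfold scaled unif
  push_cast
  rw [abs_mul, abs_of_pos hm, ← Real.div_rpow (abs_nonneg _) (by positivity)]
  congr 1
  field_simp

/-- If the sum of the keys `z` is at most `m τ₀`, then at most `m` keys reach `τ₀`, and the squares
of the scaled coordinates with smaller keys sum up to at most `m (K τ₀ ^ (1 / q)) ^ 2`, as `q ≤ 2`.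
So the count sketch is accurate up to `η K τ₀ ^ (1 / q)`. -/
theorem sketchEst_accurate {q η m : ℝ} {K t : ℕ} [NeZero B] (j : Fin n → Fin D) (v : Fin n → ℤ)
    (hq : 0 < q) (hq2 : q ≤ 2) (hK : 0 < K) (hη : 0 < η) (hη1 : η ≤ 1) {τ₀ : ℝ} (hτ₀ : 0 < τ₀)
    (hm : ∑ i, |(v i : ℝ)| ^ q / unif q K D (j i) ≤ m * τ₀) (hB : 32 * m / η ^ 2 ≤ B)
    (ht : 1000 * n ≤ 4 ^ t) :
    prob (fun ρ : Fin (2 * t) → Row n B => ∃ i, η * (K * τ₀ ^ (1 / q)) <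
      |sketchEst ρ (fun r => bucketSum (scaled q K j v) (ρ r)) i - scaled q K j v i|) ≤
      1 / 1000 := by
  classical
  set z : Fin n → ℝ := fun i => |(v i : ℝ)| ^ q / unif q K D (j i) with hz
  have hz0 : ∀ i, 0 ≤ z i := fun i =>
    div_nonneg (Real.rpow_nonneg (abs_nonneg _) _) (unif_pos hq hK _).le
  let H : Finset (Fin n) := {i | τ₀ ≤ z i}
  have hH : (#H : ℝ) ≤ m := by
    have h1 : (#H : ℝ) * τ₀ ≤ m * τ₀ := by
      refine le_trans ?_ hm
      rw [← nsmul_eq_mul]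
      refine le_trans (Finset.card_nsmul_le_sum H z τ₀ fun i hi => ?_)
        (Finset.sum_le_sum_of_subset_of_nonneg (Finset.subset_univ H) fun i _ _ => hz0 i)
      exact (Finset.mem_filter.1 hi).2
    exact le_of_mul_le_mul_right h1 hτ₀
  have hw : ∑ i ∈ univ \ H, (scaled q K j v i : ℝ) ^ 2 ≤ (K * τ₀ ^ (1 / q)) ^ 2 * m := by
    have hterm : ∀ i ∈ univ \ H,
        (scaled q K j v i : ℝ) ^ 2 ≤ K ^ 2 * τ₀ ^ (2 / q - 1) * z i := by
      intro i hi
      have hiH : z i < τ₀ := by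
        simpa [H] using hi
      set a := |(scaled q K j v i : ℝ)| / K with ha
      have ha0 : 0 ≤ a := by positivity
      have haz : a ^ q = z i := abs_scaled_div q K j v i hq hK
      have h2q : 0 ≤ 2 / q - 1 := by
        rw [sub_nonneg, le_div_iff₀ hq]
        linarith
      have ha2 : a ^ 2 = z i ^ (2 / q - 1) * z i := by
        rw [← haz, ← Real.rpow_mul ha0, ← Real.rpow_add' ha0, ← Real.rpow_natCast]
        · congr 1
          push_cast
          field_simp
          ring
        · have : q * (2 / q - 1) + q = 2 := by
            field_simp
            ring
          rw [this]
          norm_num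
      have hsa : (scaled q K j v i : ℝ) ^ 2 = K ^ 2 * a ^ 2 := by
        rw [ha, div_pow, sq_abs]
        field_simp
      rw [hsa, ha2, mul_assoc]
      have h3 : z i ^ (2 / q - 1) ≤ τ₀ ^ (2 / q - 1) := Real.rpow_le_rpow (hz0 i) hiH.le h2q
      have := hz0 i
      gcongr
    calc ∑ i ∈ univ \ H, (scaled q K j v i : ℝ) ^ 2
        ≤ ∑ i ∈ univ \ H, K ^ 2 * τ₀ ^ (2 / q - 1) * z i := Finset.sum_le_sum hterm
      _ ≤ ∑ i, K ^ 2 * τ₀ ^ (2 / q - 1) * z i := by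
          refine Finset.sum_le_sum_of_subset_of_nonneg (Finset.sdiff_subset) fun i _ _ => ?_
          have := hz0 i
          positivity
      _ = K ^ 2 * τ₀ ^ (2 / q - 1) * ∑ i, z i := by rw [Finset.mul_sum]
      _ ≤ K ^ 2 * τ₀ ^ (2 / q - 1) * (m * τ₀) := by gcongr
      _ = K ^ 2 * (τ₀ ^ (2 / q - 1) * τ₀) * m := by ring
      _ = (K * τ₀ ^ (1 / q)) ^ 2 * m := by
          rw [← Real.rpow_add_one hτ₀.ne', mul_pow, ← Real.rpow_mul_natCast hτ₀.le]
          congr 3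
          push_cast
          ring
  refine (prob_sketchEst (scaled q K j v) H hH (by positivity) hη hη1 hw hB).trans ?_
  rw [div_le_div_iff₀ (by positivity) (by norm_num)]
  have : (1000 * n : ℝ) ≤ 4 ^ t := by exact_mod_cast ht
  linarith

theorem sketch_zero (q : ℝ) (K : ℕ) (ω : Seed n D B R) : sketch q K ω 0 = 0 := by
  funext r b
  simp [sketch, bucketSum, scaled]

theorem output_zero {k ρ q : ℝ} {K L t : ℕ} (hq : 0 < q) (ht : 0 < t)
    (ω : Seed n D B (2 * t)) (s : Fin n → Bool) : output k ρ q K L ω 0 s = 0 := by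
  classical
  have h0 : ∀ i, keyEst q K ω 0 i = 0 := by
    intro i
    have h := abs_median_sub_le
      (fun r => ((rowEst (ω.2 r) ((0 : Fin (2 * t) → Fin B → ℤ) r) i : ℤ) : ℝ)) (x := 0) (e := 0)
      (by simp [rowEst, ht])
    have h' : sketchEst ω.2 0 i = 0 := by
      rw [sub_zero] at h
      exact abs_eq_zero.1 (le_antisymm h (abs_nonneg _))
    rw [keyEst, h', abs_zero, zero_div, Real.zero_rpow hq.ne']
  have : sampled k q K L ω 0 = ∅ := by
    have hS : ({i | threshold k (valEst q K ω 0) (keyEst q K ω 0) ≤ keyEst q K ω 0 i} :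
        Finset (Fin n)) = ∅ := by
      ext i
      simp only [h0, Finset.mem_filter, Finset.mem_univ, true_and, Finset.notMem_empty, iff_false,
        not_le]
      exact threshold_pos _ _ _
    unfold sampled
    dsimp only
    rw [hS]
    simp
  rw [output, this, Finset.sum_empty]

/-- If the exact keys are good and the count sketch is accurate, then the estimator succeeds. -/
theorem abs_output_sub_le {k ρ q ε η δ Λ : ℝ} {K L : ℕ} {e : ℤ} {v : Fin n → ℤ} {x : Fin n → ℝ}
    {s : Fin n → Bool} (ω : Seed n D B R) (hxv : ∀ i, x i = |(v i : ℝ)| ^ q) (hρ : 1 ≤ ρ)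
    (hq : 0 < q) (hε : 0 < ε) (hε1 : ε ≤ 1) (hη : 0 < η) (hη1 : η ≤ 1 / 4)
    (hηδ : 4 * q * η ≤ δ) (hδ : δ = ε / (16 * ρ)) (hδ16 : δ ≤ 1 / 16) (hk : 200000 ≤ k)
    (hkκ : 4096 * 20000 * 64 / ε ^ 2 * (n : ℝ) ^ (1 - 1 / ρ) ≤ k) (hK0 : 0 < K)
    (hN0 : 0 < subsetSum 1 (fun _ => true) x) (hΛ : 0 ≤ Λ)
    (he : 2 ^ e * (4 * k) ≤ subsetSum 1 (fun _ => true) x)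
    (he' : subsetSum 1 (fun _ => true) x < 2 ^ e * 2 * (4 * k)) (hL : 16 * k * Λ ≤ L)
    (hgood : GoodKeys ρ δ Λ e s x (fun i => x i / unif q K D (ω.1 i)))
    (hacc : ∀ i, |sketchEst ω.2 (sketch q K ω v) i - scaled q K ω.1 v i| ≤
      η * (K * (2 ^ e) ^ (1 / q))) :
    |output k ρ q K L ω (sketch q K ω v) s - subsetSum ρ s x| ≤
      ε * (subsetSum ρ (fun _ => true) x ^ (1 / (2 * ρ)) *
        subsetSum ρ s x ^ (1 - 1 / (2 * ρ))) := by
  classical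
  have hx0 : ∀ i, 0 ≤ x i := fun i => hxv i ▸ Real.rpow_nonneg (abs_nonneg _) _
  have hK' : (0 : ℝ) < K := by exact_mod_cast hK0
  have hE : (0 : ℝ) < 2 ^ e := by positivity
  generalize hy : sketch q K ω v = y at *
  -- an additive error of the sketch is a relative error for the keys that matter
  have hkey : ∀ i, 2 ^ e ≤ x i / unif q K D (ω.1 i) ∨ 2 ^ e ≤ keyEst q K ω y i →
      (1 - δ) * (x i / unif q K D (ω.1 i)) ≤ keyEst q K ω y i ∧
        keyEst q K ω y i ≤ (1 + δ) * (x i / unif q K D (ω.1 i)) := by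
    intro i hi
    have hxi : x i / unif q K D (ω.1 i) = (|(scaled q K ω.1 v i : ℝ)| / K) ^ q := by
      rw [hxv]
      exact (abs_scaled_div q K ω.1 v i hq hK0).symm
    have hroot : ∀ a : ℝ, 0 ≤ a → 2 ^ e ≤ a ^ q → ((2 : ℝ) ^ e) ^ (1 / q) ≤ a := by
      intro a ha h
      calc ((2 : ℝ) ^ e) ^ (1 / q) ≤ (a ^ q) ^ (1 / q) :=
            Real.rpow_le_rpow hE.le h (by positivity)
        _ = a := by rw [← Real.rpow_mul ha, mul_one_div_cancel hq.ne', Real.rpow_one]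
    rw [hxi] at hi ⊢
    refine rpow_rel_error (θ := ((2 : ℝ) ^ e) ^ (1 / q)) (η := η) (by positivity)
      (by positivity) hq hη hη1 hηδ (by linarith) ?_
      (hi.imp (hroot _ (by positivity)) (hroot _ (by positivity)))
    rw [← sub_div, abs_div, abs_of_pos hK', div_le_iff₀ hK']
    refine (abs_abs_sub_abs_le_abs_sub _ _).trans ((hacc i).trans (le_of_eq ?_))
    ring
  have hval : ∀ i, 2 ^ e ≤ x i / unif q K D (ω.1 i) ∨ 2 ^ e ≤ keyEst q K ω y i →
      (1 - δ) * x i ≤ valEst q K ω y i ∧ valEst q K ω y i ≤ (1 + δ) * x i := by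
    intro i hi
    have h := hkey i hi
    have hu := unif_pos hq hK0 (ω.1 i)
    have hxu : x i = x i / unif q K D (ω.1 i) * unif q K D (ω.1 i) := by field_simp
    constructor
    · calc (1 - δ) * x i = (1 - δ) * (x i / unif q K D (ω.1 i)) * unif q K D (ω.1 i) := by
            rw [mul_assoc, ← hxu]
        _ ≤ keyEst q K ω y i * unif q K D (ω.1 i) := by gcongr; exact h.1
        _ = valEst q K ω y i := rfl
    · calc valEst q K ω y i = keyEst q K ω y i * unif q K D (ω.1 i) := rfl
        _ ≤ (1 + δ) * (x i / unif q K D (ω.1 i)) * unif q K D (ω.1 i) := by gcongr; exact h.2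
        _ = (1 + δ) * x i := by rw [mul_assoc, ← hxu]
  have hval0 : ∀ i, 0 ≤ valEst q K ω y i := fun i =>
    mul_nonneg (by unfold keyEst; positivity) (unif_pos hq hK0 _).le
  have hmain := abs_estimate_sub_le hx0 hval0 hρ hε hε1 hδ hk hkκ rfl hN0 rfl he he' hkey hval
    hgood.high hgood.low hgood.upper hgood.lower
  -- the sum of the keys bounds the size of the sample, so it is not discarded
  have hcard : #{i | threshold k (valEst q K ω y) (keyEst q K ω y) ≤ keyEst q K ω y i} ≤ L := by
    have hz0 : ∀ i, 0 ≤ x i / unif q K D (ω.1 i) := fun i =>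
      div_nonneg (hx0 i) (unif_pos hq hK0 _).le
    set S : Finset (Fin n) :=
      {i | threshold k (valEst q K ω y) (keyEst q K ω y) ≤ keyEst q K ω y i} with hS
    have h1 : (#S : ℝ) * (2 ^ e / 2) ≤ Λ * subsetSum 1 (fun _ => true) x := by
      refine le_trans ?_ hgood.sum_le
      rw [← nsmul_eq_mul]
      refine le_trans (Finset.card_nsmul_le_sum S (fun i => x i / unif q K D (ω.1 i)) _
        fun i hi => ?_)
        (Finset.sum_le_sum_of_subset_of_nonneg (Finset.subset_univ S) fun i _ _ => hz0 i)
      have h2 : 2 ^ e ≤ keyEst q K ω y i := hmain.1.trans (Finset.mem_filter.1 hi).2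
      have h3 := (hkey i (Or.inr h2)).2
      have h4 := hz0 i
      have h5 : δ * (x i / unif q K D (ω.1 i)) ≤ 1 * (x i / unif q K D (ω.1 i)) := by
        gcongr
        linarith
      linarith
    have h4 : Λ * subsetSum 1 (fun _ => true) x ≤ Λ * (2 ^ e * 2 * (4 * k)) := by gcongr
    have h5 : (#S : ℝ) ≤ L := by
      refine le_trans ?_ hL
      have h6 : (#S : ℝ) * 2 ^ e ≤ 16 * k * Λ * 2 ^ e := by linarith
      exact le_of_mul_le_mul_right h6 hE
    exact_mod_cast h5
  rw [output_eq_estimate _ _ _ _ _ _ _ _ hcard]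
  exact hmain.2

/-- The estimator fails with probability at most `1 / 160`. -/
theorem prob_output {k ρ q ε η : ℝ} {K L t M : ℕ} [NeZero B] [NeZero D] (hρ : 1 ≤ ρ)
    (hq : 0 < q) (hq2 : q ≤ 2) (hε : 0 < ε) (hε1 : ε ≤ 1) (hη : 0 < η) (hη1 : η ≤ 1 / 4)
    (hηδ : 4 * q * η ≤ ε / (16 * ρ)) (hk : 200000 ≤ k)
    (hkκ : 4096 * 20000 * 64 / ε ^ 2 * (n : ℝ) ^ (1 - 1 / ρ) ≤ k)
    (hK : 64 * ρ / ε ≤ K) (hD : 32 * ρ * n * M ^ 2 / ε ≤ D) (hM : 0 < M)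
    (hB : 32 * (8000 * k * (1 + Real.log D)) / η ^ 2 ≤ B)
    (hL : 16000 * k * (1 + Real.log D) ≤ L) (ht : 1000 * n ≤ 4 ^ t) (ht0 : 0 < t)
    (v : Fin n → ℤ) (hv : ∀ i, |v i| ≤ M) (s : Fin n → Bool) :
    prob (fun ω : Seed n D B (2 * t) =>
      ¬ |output k ρ q K L ω (sketch q K ω v) s - subsetSum ρ s (fun i => |(v i : ℝ)| ^ q)| ≤
        ε * (subsetSum ρ (fun _ => true) (fun i => |(v i : ℝ)| ^ q) ^ (1 / (2 * ρ)) *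
          subsetSum ρ s (fun i => |(v i : ℝ)| ^ q) ^ (1 - 1 / (2 * ρ)))) ≤ 1 / 160 := by
  classical
  have hρ0 : 0 < ρ := by linarith
  set x : Fin n → ℝ := fun i => |(v i : ℝ)| ^ q with hx
  have hx0 : ∀ i, 0 ≤ x i := fun i => Real.rpow_nonneg (abs_nonneg _) _
  by_cases hv0 : v = 0
  · have hxz : ∀ i, x i = 0 := fun i => by simp [hx, hv0, Real.zero_rpow hq.ne']
    have hX : subsetSum ρ s x = 0 := by
      simp [subsetSum, hxz, Real.zero_rpow hρ0.ne']
    have hz : prob (fun ω : Seed n D B (2 * t) =>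
        ¬ |output k ρ q K L ω (sketch q K ω v) s - subsetSum ρ s x| ≤
        ε * (subsetSum ρ (fun _ => true) x ^ (1 / (2 * ρ)) *
          subsetSum ρ s x ^ (1 - 1 / (2 * ρ)))) = 0 := by
      refine Finset.expect_eq_zero fun ω _ => if_neg (not_not.2 ?_)
      rw [hv0, sketch_zero, output_zero hq ht0, hX, sub_zero, abs_zero]
      have : 0 ≤ subsetSum ρ (fun _ => true) x := subsetSum_nonneg hx0
      positivity
    rw [hz]
    norm_num
  -- the general case
  set δ := ε / (16 * ρ) with hδ
  have hδ0 : 0 < δ := by positivity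
  have hρδ : ρ * δ = ε / 16 := by rw [hδ]; field_simp
  have hδ16 : δ ≤ 1 / 16 := by nlinarith
  have hDpos : (0 : ℝ) < D := by exact_mod_cast Nat.pos_of_ne_zero (NeZero.ne D)
  have hK4 : 4 / δ ≤ K := by
    refine le_trans (le_of_eq ?_) hK
    rw [hδ]
    field_simp
    norm_num
  have hK0 : 0 < K := by
    have : (0 : ℝ) < K := lt_of_lt_of_le (by positivity) hK4
    exact_mod_cast this
  set N := subsetSum 1 (fun _ => true) x with hN
  have hN' : N = ∑ i, x i := by simp [hN, subsetSum]
  have hx1 : ∀ i, x i = 0 ∨ 1 ≤ x i := by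
    intro i
    by_cases h : v i = 0
    · left
      simp [hx, h, Real.zero_rpow hq.ne']
    · right
      refine Real.one_le_rpow ?_ hq.le
      exact_mod_cast Int.one_le_abs h
  have hM1 : (1 : ℝ) ≤ M := by exact_mod_cast hM
  have hxM : ∀ i, x i ≤ (M : ℝ) ^ 2 := by
    intro i
    calc x i ≤ (M : ℝ) ^ q := by
          refine Real.rpow_le_rpow (abs_nonneg _) ?_ hq.le
          exact_mod_cast hv i
      _ ≤ (M : ℝ) ^ (2 : ℝ) := Real.rpow_le_rpow_of_exponent_le hM1 hq2
      _ = (M : ℝ) ^ 2 := by norm_num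
  have hNM : N ≤ n * (M : ℝ) ^ 2 := by
    rw [hN']
    calc ∑ i, x i ≤ ∑ _i : Fin n, (M : ℝ) ^ 2 := Finset.sum_le_sum fun i _ => hxM i
      _ = _ := by simp
  have hN1 : 1 ≤ N := by
    obtain ⟨i, hi⟩ := Function.ne_iff.1 hv0
    rw [hN']
    have h1 : 1 ≤ x i := (hx1 i).resolve_left (by
      have : (0 : ℝ) < |(v i : ℝ)| := by
        rw [abs_pos]
        exact_mod_cast hi
      exact (Real.rpow_pos_of_pos this q).ne')
    exact h1.trans (Finset.single_le_sum (fun j _ => hx0 j) (mem_univ i))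
  have hN0 : 0 < N := by linarith
  -- `2 ^ e` is a lower bound for the threshold, known to the analysis only
  obtain ⟨e, he, he'⟩ := exists_mem_Ico_zpow (div_pos hN0 (by linarith : 0 < 4 * k))
    (by norm_num : (1 : ℝ) < 2)
  rw [le_div_iff₀ (by linarith)] at he
  rw [div_lt_iff₀ (by linarith), zpow_add_one₀ (by norm_num)] at he'
  have hE : (0 : ℝ) < 2 ^ e := by positivity
  set Λ := 1000 * (1 + Real.log D) with hΛ
  have hΛ0 : 0 < Λ := by positivity
  -- the randomness of the multipliers
  -- below `2 / (δ D)` the distribution of `unif` is not close to uniform; as the non-zero `x i` are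
  -- at least `1` and `D` is large, `x i / τ` does not get there
  have hymin : 0 < 2 / (δ * D) := by positivity
  have hA := prob_not_goodKeys (n := n) (s := s) (ρ := ρ) (δ := δ) (e := e) (x := x)
    (unif_pos hq hK0) (unif_le_one hq hK0) (fun y hy => prob_unif_le (D := D) hq hK0 hy)
    (fun y hy hy1 => le_prob_unif hq hq2 hδ0 (by linarith) hK4 hy hy1) (expect_inv_unif hq hK0)
    hδ0.le (by linarith) hρ (fun i => (hx1 i).imp_right fun h => ⟨by linarith, by
      have e14 : (2 : ℝ) ^ (e + 14) = 2 ^ e * 16384 := by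
        rw [zpow_add₀ (by norm_num)]
        norm_num
      have h1 : (2 : ℝ) ^ e * 16384 ≤ N := by nlinarith
      have h2 : 2 * (n * (M : ℝ) ^ 2) ≤ δ * D := by
        rw [div_le_iff₀ hε] at hD
        have h3 : δ * D * (16 * ρ) = ε * D := by rw [hδ]; field_simp
        have h4 : 2 * (n * (M : ℝ) ^ 2) * (16 * ρ) ≤ δ * D * (16 * ρ) := by
          rw [h3]
          linarith
        exact le_of_mul_le_mul_right h4 (by positivity)
      refine le_trans ?_ h
      rw [e14, div_mul_eq_mul_div, div_le_one (by positivity)]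
      linarith⟩) hymin
  -- the randomness of the rows, and the combination of the two
  refine le_trans (prob_mono (Q := fun ω : Seed n D B (2 * t) =>
    (fun j : Fin n → Fin D => ¬ GoodKeys ρ δ Λ e s x (fun i => x i / unif q K D (j i))) ω.1 ∨
    (fun ω : Seed n D B (2 * t) => ∃ i, η * (K * (2 ^ e) ^ (1 / q)) <
      |sketchEst ω.2 (fun r => bucketSum (scaled q K ω.1 v) (ω.2 r)) i - scaled q K ω.1 v i|) ω)
    ?_) ((prob_prod_le (b := 1 / 1000) (by norm_num) hA ?_).trans (by norm_num))
  · intro ω hbad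
    by_contra! hcon
    exact hbad (abs_output_sub_le ω (fun _ => rfl) hρ hq hε hε1 hη hη1 hηδ hδ hδ16 hk hkκ hK0 hN0
      hΛ0.le he he' (le_trans (le_of_eq (by rw [hΛ]; ring)) hL) hcon.1 hcon.2)
  · intro j hj
    rw [not_not] at hj
    refine sketchEst_accurate j v hq hq2 hK0 hη (by linarith) hE (m := 8 * k * Λ)
      (hj.sum_le.trans ?_) ?_ ht
    · have : Λ * N ≤ Λ * (2 ^ e * 2 * (4 * k)) := by gcongr
      linarith
    · refine le_trans (le_of_eq ?_) hB
      rw [hΛ]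
      ring

end Sketch

/-! ### Streaming algorithms from linear sketches -/

/-- The value modulo `P` of a linear sketch with columns `col` after the stream `σ`. -/
def linSketch {n P : ℕ} {W : Type} (col : Fin n → W → ZMod P) (σ : List (Update n)) :
    W → ZMod P :=
  (σ.map fun u => ((u.2 : ℤ) : ZMod P) • col u.1).sum

theorem exists_enumeration {n L : ℕ} (hn : 0 < n) (S : Finset (Fin n)) (h : #S ≤ L) :
    ∃ f : Fin L → Fin n, ∀ i ∈ S, ∃ j, f j = i := by
  refine ⟨fun j => if hj : (j : ℕ) < #S then S.equivFin.symm ⟨j, hj⟩ else ⟨0, hn⟩, ?_⟩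
  intro i hi
  refine ⟨⟨S.equivFin ⟨i, hi⟩, (S.equivFin ⟨i, hi⟩).2.trans_le h⟩, ?_⟩
  simp

section Construction

variable {n T P L : ℕ} {W : Type} [Fintype W] [NeZero T] [NeZero P]

open Classical in
/-- The streaming algorithm that stores the index of a seed and a linear sketch modulo `P`. The
query phase first reads the `L` coordinates `f t y` of the query and stores the bits, next to a
counter; the answer `ans t y` is a function of these bits. -/
noncomputable def sketchAlg (col : Fin T → Fin n → W → ZMod P)
    (f : Fin T → (W → ZMod P) → Fin L → Fin n)
    (ans : Fin T → (W → ZMod P) → (Fin L → Bool) → ℝ) : StreamAlg n where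
  Mem := Fin T × (W → ZMod P) × (Fin L → Bool) × Fin (L + 1)
  init := (PMF.uniformOfFintype (Fin T)).map fun t => (t, 0, fun _ => false, 0)
  update u m := PMF.pure (m.1, m.2.1 + ((u.2 : ℤ) : ZMod P) • col m.1 u.1, m.2.2)
  query m := if h : (m.2.2.2 : ℕ) < L then
      Sum.inr (f m.1 m.2.1 ⟨m.2.2.2, h⟩, fun b =>
        (m.1, m.2.1, Function.update m.2.2.1 ⟨m.2.2.2, h⟩ b, ⟨m.2.2.2 + 1, by omega⟩))
    else Sum.inl (ans m.1 m.2.1 m.2.2.1)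

variable (col : Fin T → Fin n → W → ZMod P) (f : Fin T → (W → ZMod P) → Fin L → Fin n)
  (ans : Fin T → (W → ZMod P) → (Fin L → Bool) → ℝ)

theorem card_sketchAlg :
    Fintype.card (sketchAlg col f ans).Mem = T * (P ^ Fintype.card W * (2 ^ L * (L + 1))) := by
  classical
  have h : Fintype.card (Fin T × (W → ZMod P) × (Fin L → Bool) × Fin (L + 1)) =
      T * (P ^ Fintype.card W * (2 ^ L * (L + 1))) := by
    simp [ZMod.card]
  rw [← h]
  exact Fintype.card_congr (Equiv.refl _)

/-- The memory content with seed `t` and sketch `y` before the query phase. -/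
noncomputable def unread (t : Fin T) (y : W → ZMod P) : (sketchAlg col f ans).Mem :=
  (t, y, fun _ => false, 0)

theorem final_sketchAlg (σ : List (Update n)) :
    (sketchAlg col f ans).final σ = (PMF.uniformOfFintype (Fin T)).map
      fun t => unread col f ans t (linSketch (col t) σ) := by
  have h : ∀ (σ : List (Update n)) (y : Fin T → W → ZMod P),
      σ.foldl (fun μ u => μ.bind ((sketchAlg col f ans).update u))
        ((PMF.uniformOfFintype (Fin T)).map fun t => unread col f ans t (y t)) =
      (PMF.uniformOfFintype (Fin T)).map
        fun t => unread col f ans t (y t + linSketch (col t) σ) := by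
    intro σ
    induction σ with
    | nil => intro y; simp [linSketch]
    | cons u σ ih =>
      intro y
      have hstep : ((PMF.uniformOfFintype (Fin T)).map fun t => unread col f ans t (y t)).bind
          ((sketchAlg col f ans).update u) = (PMF.uniformOfFintype (Fin T)).map
          fun t => unread col f ans t (y t + ((u.2 : ℤ) : ZMod P) • col t u.1) := by
        rw [PMF.bind_map]
        rfl
      rw [List.foldl_cons, hstep, ih fun t => y t + ((u.2 : ℤ) : ZMod P) • col t u.1]
      congr 1
      funext t
      simp only [linSketch, List.map_cons, List.sum_cons]
      rw [add_assoc]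
  have h0 := h σ (fun _ => 0)
  simp only [zero_add] at h0
  exact h0

/-- The answer function of `sketchAlg`: from a memory content that has not read all bits yet, the
remaining bits are those of the query. -/
noncomputable def sketchAnswer (m : (sketchAlg col f ans).Mem) (s : Fin n → Bool) : ℝ :=
  ans m.1 m.2.1 fun j => if j.1 < m.2.2.2.1 then m.2.2.1 j else s (f m.1 m.2.1 j)

theorem outputs_sketchAlg : (sketchAlg col f ans).Outputs (sketchAnswer col f ans) := by
  have h : ∀ (d : ℕ) (t : Fin T) (y : W → ZMod P) (bits : Fin L → Bool) (c : Fin (L + 1))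
      (s : Fin n → Bool), L - c = d → (sketchAlg col f ans).Answers s (t, y, bits, c)
        (ans t y fun j => if j.1 < c.1 then bits j else s (f t y j)) := by
    intro d
    induction d with
    | zero =>
      intro t y bits c s hd
      have hc : ¬ (c : ℕ) < L := by omega
      have hbits : (fun j : Fin L => if j.1 < c.1 then bits j else s (f t y j)) = bits := by
        funext j
        rw [if_pos (by omega)]
      rw [hbits]
      refine StreamAlg.Answers.halt ?_
      simp [sketchAlg, hc]
    | succ d ih =>
      intro t y bits c s hd
      have hc : (c : ℕ) < L := by omega
      refine StreamAlg.Answers.read (i := f t y ⟨c, hc⟩) (next := fun b =>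
        (t, y, Function.update bits ⟨c, hc⟩ b, ⟨c + 1, by omega⟩)) ?_ ?_
      · simp [sketchAlg, hc]
      · have := ih t y (Function.update bits ⟨c, hc⟩ (s (f t y ⟨c, hc⟩))) ⟨c + 1, by omega⟩ s
          (by simp only; omega)
        convert this using 2
        funext j
        by_cases hj : j = ⟨c, hc⟩
        · subst hj
          simp
        · have hj' : j.1 ≠ c.1 := fun h => hj (Fin.ext h)
          rw [Function.update_of_ne hj]
          have : j.1 < c.1 ↔ j.1 < c.1 + 1 := by omega
          simp only [this]
  rintro ⟨t, y, bits, c⟩ s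
  exact h _ t y bits c s rfl

end Construction

open Classical in
/-- A linear sketch modulo `P` with `T` equally likely seeds, and an output function that depends
on at most `L` coordinates of the query, give a streaming algorithm. -/
theorem exists_streamAlg {n T P L : ℕ} {W : Type} [Fintype W] [NeZero T] [NeZero P] (hn : 0 < n)
    (col : Fin T → Fin n → W → ZMod P) (out : Fin T → (W → ZMod P) → (Fin n → Bool) → ℝ)
    (S : Fin T → (W → ZMod P) → Finset (Fin n)) (hS : ∀ t y, #(S t y) ≤ L)
    (hout : ∀ t y s s', (∀ i ∈ S t y, s i = s' i) → out t y s = out t y s') :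
    ∃ (A : StreamAlg n) (F : A.Mem → (Fin n → Bool) → ℝ), A.Outputs F ∧
      A.space = Nat.clog 2 (T * (P ^ Fintype.card W * (2 ^ L * (L + 1)))) ∧
      ∀ (σ : List (Update n)) (s : Fin n → Bool) (good : ℝ → Prop),
        9 * T ≤ 10 * #{t | good (out t (linSketch (col t) σ) s)} →
        (9 / 10 : ENNReal) ≤ (A.final σ).toOuterMeasure {m | good (F m s)} := by
  choose f hf using fun t y => exists_enumeration hn (S t y) (hS t y)
  let ans : Fin T → (W → ZMod P) → (Fin L → Bool) → ℝ := fun t y bits =>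
    out t y fun i => decide (∃ j, f t y j = i ∧ bits j = true)
  have hans : ∀ t y s, ans t y (fun j => s (f t y j)) = out t y s := by
    intro t y s
    refine hout _ _ _ _ fun i hi => ?_
    obtain ⟨j, rfl⟩ := hf t y i hi
    by_cases h : s (f t y j) = true
    · simp only [h, decide_eq_true_eq]
      exact ⟨j, rfl, h⟩
    · rw [Bool.not_eq_true] at h
      rw [h, decide_eq_false_iff_not]
      rintro ⟨j', h1, h2⟩
      simp only [h1, h, Bool.false_eq_true] at h2
  refine ⟨sketchAlg col f ans, sketchAnswer col f ans, outputs_sketchAlg col f ans, ?_, ?_⟩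
  · rw [StreamAlg.space, card_sketchAlg]
  · intro σ s good hgood
    rw [final_sketchAlg, PMF.toOuterMeasure_map_apply, PMF.toOuterMeasure_uniformOfFintype_apply]
    have hcard : Fintype.card ((fun t => unread col f ans t (linSketch (col t) σ)) ⁻¹'
        {m | good (sketchAnswer col f ans m s)}) =
        #{t | good (out t (linSketch (col t) σ) s)} := by
      rw [← Set.toFinset_card]
      congr 1
      ext t
      simp only [Set.mem_toFinset, Set.mem_preimage, Set.mem_ofPred_eq, Finset.mem_filter,
        Finset.mem_univ, true_and]
      rw [← hans]
      exact Iff.rfl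
    rw [hcard, Fintype.card_fin, ENNReal.le_div_iff_mul_le
      (Or.inl (by exact_mod_cast NeZero.ne T)) (Or.inl (ENNReal.natCast_ne_top T)),
      ← ENNReal.mul_div_right_comm]
    refine ENNReal.div_le_of_le_mul ?_
    rw [mul_comm _ (10 : ENNReal)]
    exact_mod_cast hgood

/-! ### The streaming algorithm -/

/-- The integer vector accumulated by a stream. -/
def accInt {n : ℕ} (σ : List (Update n)) : Fin n → ℤ :=
  (σ.map fun u => Pi.single u.1 ((u.2 : ℤˣ) : ℤ)).sum

theorem accInt_cons {n : ℕ} (u : Update n) (σ : List (Update n)) :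
    accInt (u :: σ) = Pi.single u.1 ((u.2 : ℤˣ) : ℤ) + accInt σ := by
  simp [accInt]

theorem accumulated_eq {n : ℕ} (σ : List (Update n)) (i : Fin n) :
    accumulated σ i = (accInt σ i : ℝ) := by
  induction σ with
  | nil => simp [accumulated, accInt]
  | cons u σ ih =>
    rw [accInt_cons, Pi.add_apply, Int.cast_add, ← ih]
    simp only [accumulated, List.map_cons, List.sum_cons, Pi.add_apply]
    congr 1
    by_cases h : i = u.1
    · subst h
      simp
    · simp [h]

theorem sum_abs_accInt_le {n : ℕ} (σ : List (Update n)) : ∑ i, |accInt σ i| ≤ σ.length := by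
  induction σ with
  | nil => simp [accInt]
  | cons u σ ih =>
    have h1 : ∑ i, |(Pi.single u.1 ((u.2 : ℤˣ) : ℤ) : Fin n → ℤ) i| = 1 := by
      rw [Finset.sum_eq_single u.1]
      · rcases Int.units_eq_one_or u.2 with h | h <;> simp [h]
      · intro j _ hj
        simp [hj]
      · simp
    rw [accInt_cons, List.length_cons]
    generalize (Pi.single u.1 ((u.2 : ℤˣ) : ℤ) : Fin n → ℤ) = w at *
    have h2 : ∑ i, |(w + accInt σ) i| ≤ ∑ i, |w i| + ∑ i, |accInt σ i| := by
      rw [← Finset.sum_add_distrib]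
      exact Finset.sum_le_sum fun i _ => abs_add_le _ _
    push_cast
    linarith

section Alg

variable {n D B R : ℕ}

theorem sketch_add (q : ℝ) (K : ℕ) (ω : Seed n D B R) (v w : Fin n → ℤ) (r : Fin R) (b : Fin B) :
    sketch q K ω (v + w) r b = sketch q K ω v r b + sketch q K ω w r b := by
  simp only [sketch, bucketSum, scaled, Pi.add_apply, mul_add, Finset.sum_add_distrib]

theorem sketch_single (q : ℝ) (K : ℕ) (ω : Seed n D B R) (i : Fin n) (a : ℤ) (r : Fin R)
    (b : Fin B) :
    sketch q K ω (Pi.single i a) r b = a * sketch q K ω (Pi.single i 1) r b := by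
  simp only [sketch, bucketSum, scaled, Finset.mul_sum]
  refine Finset.sum_congr rfl fun j _ => ?_
  by_cases h : j = i
  · subst h
    rw [Pi.single_eq_same, Pi.single_eq_same]
    ring
  · simp [h]

theorem linSketch_eq {P : ℕ} (q : ℝ) (K : ℕ) (ω : Seed n D B R) (σ : List (Update n)) :
    linSketch (P := P) (W := Fin R × Fin B)
      (fun i w => ((sketch q K ω (Pi.single i 1) w.1 w.2 : ℤ) : ZMod P)) σ =
      fun w => ((sketch q K ω (accInt σ) w.1 w.2 : ℤ) : ZMod P) := by
  induction σ with
  | nil =>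
    funext w
    have : accInt ([] : List (Update n)) = 0 := rfl
    rw [this, sketch_zero]
    simp [linSketch]
  | cons u σ ih =>
    funext w
    have h1 : linSketch (P := P) (W := Fin R × Fin B)
        (fun i w => ((sketch q K ω (Pi.single i 1) w.1 w.2 : ℤ) : ZMod P)) (u :: σ) =
        ((u.2 : ℤ) : ZMod P) •
          (fun w : Fin R × Fin B =>
            ((sketch q K ω (Pi.single u.1 1) w.1 w.2 : ℤ) : ZMod P)) +
        linSketch (P := P) (W := Fin R × Fin B)
          (fun i w => ((sketch q K ω (Pi.single i 1) w.1 w.2 : ℤ) : ZMod P)) σ := by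
      simp [linSketch]
    rw [h1, ih, accInt_cons, sketch_add, sketch_single]
    simp

theorem abs_sketch_le {q : ℝ} {K : ℕ} (hq : 0 < q) (ω : Seed n D B R) (v : Fin n → ℤ) (r : Fin R)
    (b : Fin B) : |sketch q K ω v r b| ≤ ⌊(K : ℝ) * (D : ℝ) ^ (1 / q)⌋₊ * ∑ i, |v i| := by
  rw [sketch, bucketSum, Finset.mul_sum]
  refine (Finset.abs_sum_le_sum_abs _ _).trans (Finset.sum_le_sum fun i _ => ?_)
  rw [scaled, abs_mul, abs_mul]
  have h1 : |if (ω.2 r).1 i = b then sgn ((ω.2 r).2 i) else 0| ≤ 1 := by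
    split_ifs
    · cases (ω.2 r).2 i <;> simp [sgn]
    · simp
  have h2 : |(mult q K D (ω.1 i) : ℤ)| ≤ ⌊(K : ℝ) * (D : ℝ) ^ (1 / q)⌋₊ := by
    rw [Nat.abs_cast]
    exact_mod_cast Nat.le_floor (mult_le' hq (ω.1 i))
  calc _ ≤ 1 * (|(mult q K D (ω.1 i) : ℤ)| * |v i|) := by gcongr
    _ ≤ _ := by
      rw [one_mul]
      gcongr

/-- The accuracy guarantee of the estimator: `y` is the sum of `|v i| ^ (q ρ)` over `s` up to an
error of `ε N ^ (1 / (2 ρ)) X ^ (1 - 1 / (2 ρ))`, where `X` is that sum and `N` the sum over all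
coordinates. -/
def IsApprox (ρ q ε : ℝ) (v : Fin n → ℝ) (s : Fin n → Bool) (y : ℝ) : Prop :=
  |y - subsetSum ρ s (fun i => |v i| ^ q)| ≤
    ε * (subsetSum ρ (fun _ => true) (fun i => |v i| ^ q) ^ (1 / (2 * ρ)) *
      subsetSum ρ s (fun i => |v i| ^ q) ^ (1 - 1 / (2 * ρ)))

/-- The memory holds the index of one of `10 n (2 M + 1)` seeds, the count sketch modulo a number
larger than twice its entries, and the bits of the query at the sampled coordinates. -/
theorem exists_alg {k ρ q ε η : ℝ} {K L t M P : ℕ} [NeZero B] [NeZero D] (hn : 0 < n)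
    (hρ : 1 ≤ ρ) (hq : 0 < q) (hq2 : q ≤ 2) (hε : 0 < ε) (hε1 : ε ≤ 1) (hη : 0 < η)
    (hη1 : η ≤ 1 / 4) (hηδ : 4 * q * η ≤ ε / (16 * ρ)) (hk : 200000 ≤ k)
    (hkκ : 4096 * 20000 * 64 / ε ^ 2 * (n : ℝ) ^ (1 - 1 / ρ) ≤ k)
    (hK : 64 * ρ / ε ≤ K) (hD : 32 * ρ * n * M ^ 2 / ε ≤ D) (hM : 0 < M)
    (hB : 32 * (8000 * k * (1 + Real.log D)) / η ^ 2 ≤ B)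
    (hL : 16000 * k * (1 + Real.log D) ≤ L) (ht : 1000 * n ≤ 4 ^ t) (ht0 : 0 < t)
    (hP : P = 2 * (⌊(K : ℝ) * (D : ℝ) ^ (1 / q)⌋₊ * M) + 1) (post : ℝ → ℝ) :
    ∃ (A : StreamAlg n) (F : A.Mem → (Fin n → Bool) → ℝ), A.Outputs F ∧
      A.space = Nat.clog 2 (10 * (n * (2 * M + 1)) * (P ^ (2 * t * B) * (2 ^ L * (L + 1)))) ∧
      ∀ (σ : List (Update n)), σ.length ≤ M → ∀ (s : Fin n → Bool) (good : ℝ → Prop),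
        (∀ y, IsApprox ρ q ε (accumulated σ) s y → good (post y)) →
        (9 / 10 : ENNReal) ≤ (A.final σ).toOuterMeasure {m | good (F m s)} := by
  classical
  have hT : 0 < n * (2 * M + 1) := by positivity
  have : NeZero (10 * (n * (2 * M + 1))) := ⟨by omega⟩
  have : NeZero P := ⟨by omega⟩
  -- inputs: a vector with entries in `[-M, M]`, shifted by `M`, and a query
  let vec : (Fin n → Fin (2 * M + 1)) → Fin n → ℤ := fun a i => (a i : ℤ) - M
  have hvec : ∀ a i, |vec a i| ≤ M := by
    intro a i
    have := (a i).2
    rw [abs_le]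
    constructor <;> simp only [vec] <;> omega
  have hcard : Fintype.card ((Fin n → Fin (2 * M + 1)) × (Fin n → Bool)) <
      4 ^ (n * (2 * M + 1)) := by
    simp only [Fintype.card_prod, Fintype.card_fun, Fintype.card_fin, Fintype.card_bool]
    rw [← mul_pow, mul_comm n, pow_mul]
    refine Nat.pow_lt_pow_left ?_ hn.ne'
    have h1 : 2 * M + 1 < 2 ^ (2 * M + 1) := Nat.lt_two_pow_self
    have h2 : (4 : ℕ) ^ (2 * M + 1) = 2 ^ (2 * M + 1) * 2 ^ (2 * M + 1) := by
      rw [← mul_pow]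
      norm_num
    have h3 : 2 ≤ 2 ^ (2 * M + 1) := by
      rw [pow_succ]
      have : 1 ≤ 2 ^ (2 * M) := Nat.one_le_two_pow
      omega
    rw [h2]
    exact Nat.mul_lt_mul_of_lt_of_le h1 h3 (by omega)
  obtain ⟨ω, hω⟩ := exists_seeds (Ω := Seed n D B (2 * t))
    (fun ω (v : (Fin n → Fin (2 * M + 1)) × (Fin n → Bool)) =>
      ¬ IsApprox ρ q ε (fun i => (vec v.1 i : ℝ)) v.2
        (output k ρ q K L ω (sketch q K ω (vec v.1)) v.2))
    (fun v => prob_output hρ hq hq2 hε hε1 hη hη1 hηδ hk hkκ hK hD hM hB hL ht ht0 (vec v.1)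
      (hvec v.1) v.2) (n * (2 * M + 1)) hcard
  let dec : (Fin (2 * t) × Fin B → ZMod P) → Fin (2 * t) → Fin B → ℤ := fun y r b =>
    (y (r, b)).valMinAbs
  obtain ⟨A, F, hF, hspace, hA⟩ := exists_streamAlg (L := L) hn
    (fun j i (w : Fin (2 * t) × Fin B) =>
      ((sketch q K (ω j) (Pi.single i 1) w.1 w.2 : ℤ) : ZMod P))
    (fun j y s => post (output k ρ q K L (ω j) (dec y) s))
    (fun j y => sampled k q K L (ω j) (dec y))
    (fun j y => card_sampled_le _ _ _ _ _ _)
    (fun j y s s' h => by rw [output_congr _ _ _ _ _ _ _ h])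
  refine ⟨A, F, hF, ?_, ?_⟩
  · rw [hspace]
    simp [Fintype.card_prod]
  intro σ hσ s good hgood
  refine hA σ s good ?_
  set v := accInt σ with hv
  have hsum : ∑ i, |v i| ≤ M := (sum_abs_accInt_le σ).trans (by exact_mod_cast hσ)
  have hvM : ∀ i, |v i| ≤ M := fun i =>
    (Finset.single_le_sum (f := fun i => |v i|) (fun j _ => abs_nonneg _) (mem_univ i)).trans hsum
  have hdec : ∀ j, dec (linSketch (P := P) (W := Fin (2 * t) × Fin B)
      (fun i w => ((sketch q K (ω j) (Pi.single i 1) w.1 w.2 : ℤ) : ZMod P)) σ) =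
      sketch q K (ω j) v := by
    intro j
    rw [linSketch_eq]
    funext r b
    refine (ZMod.valMinAbs_spec _ _).2 ⟨rfl, ?_⟩
    have h1 := abs_sketch_le (K := K) hq (ω j) v r b
    have h2 : |sketch q K (ω j) v r b| ≤ (⌊(K : ℝ) * (D : ℝ) ^ (1 / q)⌋₊ : ℤ) * M :=
      h1.trans (by gcongr)
    rw [abs_le] at h2
    rw [hP]
    push_cast
    constructor <;> linarith [h2.1, h2.2]
  -- `v` is one of the inputs
  obtain ⟨a, ha⟩ : ∃ a, vec a = v := by
    refine ⟨fun i => ⟨(v i + M).toNat, ?_⟩, ?_⟩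
    · have := abs_le.1 (hvM i)
      omega
    · funext i
      have := abs_le.1 (hvM i)
      simp only [vec]
      omega
  have hbad : #{j | ¬ IsApprox ρ q ε (fun i => (vec a i : ℝ)) s
      (output k ρ q K L (ω j) (sketch q K (ω j) (vec a)) s)} < n * (2 * M + 1) := by
    convert hω (a, s)
  have hcompl := Finset.card_filter_add_card_filter_not
    (s := (univ : Finset (Fin (10 * (n * (2 * M + 1)))))) (fun j =>
      ¬ IsApprox ρ q ε (fun i => (vec a i : ℝ)) s
        (output k ρ q K L (ω j) (sketch q K (ω j) (vec a)) s))
  rw [Finset.card_univ, Fintype.card_fin] at hcompl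
  have hle : #{j | ¬ ¬ IsApprox ρ q ε (fun i => (vec a i : ℝ)) s
        (output k ρ q K L (ω j) (sketch q K (ω j) (vec a)) s)} ≤
      #{j | good (post (output k ρ q K L (ω j) (dec (linSketch (P := P) (W := Fin (2 * t) × Fin B)
      (fun i w => ((sketch q K (ω j) (Pi.single i 1) w.1 w.2 : ℤ) : ZMod P)) σ)) s))} := by
    refine Finset.card_le_card fun j hj => ?_
    simp only [Finset.mem_filter, Finset.mem_univ, true_and, not_not] at hj ⊢
    rw [hdec, ← ha]
    refine hgood _ ?_
    have hacc : accumulated σ = fun i => (vec a i : ℝ) := by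
      funext i
      rw [accumulated_eq, ha]
    rw [hacc]
    exact hj
  omega

end Alg

/-! ### The space bound -/

theorem clog_two_le {x : ℕ} (hx : 0 < x) : (Nat.clog 2 x : ℝ) ≤ 2 * Real.log x + 1 := by
  have hx1 : (1 : ℝ) ≤ x := by exact_mod_cast hx
  rcases Nat.lt_or_ge 1 x with h | h
  · have h1 := Nat.pow_pred_clog_lt_self (by norm_num : 1 < 2) h
    have hpos : 0 < Nat.clog 2 x := Nat.clog_pos (by norm_num) h
    have h2 : ((Nat.clog 2 x).pred : ℝ) * Real.log 2 ≤ Real.log x := by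
      rw [← Real.log_pow]
      refine Real.log_le_log (by positivity) ?_
      exact_mod_cast h1.le
    have h3 : ((Nat.clog 2 x).pred : ℝ) = Nat.clog 2 x - 1 := by
      rw [Nat.pred_eq_sub_one, Nat.cast_sub hpos]
      simp
    rw [h3] at h2
    have h4 := Real.log_two_gt_d9
    nlinarith
  · have : x = 1 := by omega
    subst this
    simp

theorem log_le_mul_log {x a Q : ℝ} (b : ℕ) (hx : 0 < x) (ha : 1 ≤ a) (hQ : 2 ≤ Q)
    (h : x ≤ a * Q ^ b) : Real.log x ≤ (2 * Real.log a + b) * Real.log Q := by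
  have hQlog : 1 / 2 ≤ Real.log Q := by
    have := Real.log_le_log (by norm_num) hQ
    have := Real.log_two_gt_d9
    linarith
  have hla := Real.log_nonneg ha
  calc Real.log x ≤ Real.log (a * Q ^ b) := Real.log_le_log hx h
    _ = Real.log a + b * Real.log Q := by
        rw [Real.log_mul (by positivity) (by positivity), Real.log_pow]
    _ ≤ _ := by nlinarith

theorem ceil_le_mul {x c : ℝ} (hx : 1 ≤ x) (hc : 0 ≤ c) : (⌈c * x⌉₊ : ℝ) ≤ (c + 1) * x := by
  have := Nat.ceil_lt_add_one (mul_nonneg hc (by linarith : 0 ≤ x))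
  nlinarith

/-- The logarithm of the number of memory contents of `sketchAlg`. -/
theorem log_card_le {T P m L : ℕ} (hT : 0 < T) (hP : 0 < P) :
    Real.log ((T * (P ^ m * (2 ^ L * (L + 1))) : ℕ) : ℝ) ≤
      Real.log T + m * Real.log P + 2 * L := by
  have hT' : (T : ℝ) ≠ 0 := by positivity
  push_cast
  rw [Real.log_mul hT' (by positivity), Real.log_mul (by positivity) (by positivity),
    Real.log_mul (by positivity) (by positivity), Real.log_pow, Real.log_pow]
  have h1 : Real.log ((L : ℝ) + 1) ≤ L := by
    have := Real.log_le_sub_one_of_pos (by positivity : (0 : ℝ) < (L : ℝ) + 1)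
    linarith
  have h2 : Real.log 2 ≤ 1 := by
    have := Real.log_two_lt_d9
    linarith
  nlinarith

/-- The entries of the sketch have `O(ℓ / q)` bits, where `ℓ = log (2 n / ε)`. -/
theorem log_modulus_le {K D M : ℕ} {q l cK cD cM : ℝ} (hK0 : 0 < K) (hD0 : 0 < D) (hM0 : 0 < M)
    (hq : 0 < q) (hq2 : q ≤ 2) (hl : 1 / 2 ≤ l) (hK : Real.log K ≤ cK * l)
    (hD : Real.log D ≤ cD * l) (hM : Real.log M ≤ cM * l) :
    Real.log ((2 * (⌊(K : ℝ) * (D : ℝ) ^ (1 / q)⌋₊ * M) + 1 : ℕ) : ℝ) ≤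
      (2 * (4 + cK + cM) + cD) * (l / q) := by
  have hK1 : (1 : ℝ) ≤ K := by exact_mod_cast hK0
  have hD1 : (1 : ℝ) ≤ D := by exact_mod_cast hD0
  have hM1 : (1 : ℝ) ≤ M := by exact_mod_cast hM0
  have hDq : 1 ≤ (D : ℝ) ^ (1 / q) := Real.one_le_rpow hD1 (by positivity)
  have hKD : 1 ≤ (K : ℝ) * (D : ℝ) ^ (1 / q) := one_le_mul_of_one_le_of_one_le hK1 hDq
  have hKDM : 1 ≤ (K : ℝ) * (D : ℝ) ^ (1 / q) * M := one_le_mul_of_one_le_of_one_le hKD hM1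
  have hfl : (⌊(K : ℝ) * (D : ℝ) ^ (1 / q)⌋₊ : ℝ) ≤ K * (D : ℝ) ^ (1 / q) :=
    Nat.floor_le (by positivity)
  have h1 : ((2 * (⌊(K : ℝ) * (D : ℝ) ^ (1 / q)⌋₊ * M) + 1 : ℕ) : ℝ) ≤
      3 * (K * (D : ℝ) ^ (1 / q) * M) := by
    push_cast
    have : (⌊(K : ℝ) * (D : ℝ) ^ (1 / q)⌋₊ : ℝ) * M ≤ K * (D : ℝ) ^ (1 / q) * M := by gcongr
    linarith
  have h3 : Real.log 3 ≤ 2 := by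
    have := Real.log_le_sub_one_of_pos (by norm_num : (0 : ℝ) < 3)
    linarith
  have hlK := Real.log_nonneg hK1
  have hlM := Real.log_nonneg hM1
  calc _ ≤ Real.log (3 * (K * (D : ℝ) ^ (1 / q) * M)) := by
        refine Real.log_le_log ?_ h1
        positivity
    _ = Real.log 3 + (Real.log K + 1 / q * Real.log D + Real.log M) := by
        rw [Real.log_mul (by norm_num) (by positivity),
          Real.log_mul (by positivity) (by positivity),
          Real.log_mul (by positivity) (by positivity), Real.log_rpow (by positivity)]
    _ ≤ (4 + cK + cM) * l + 1 / q * (cD * l) := by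
        have : 1 / q * Real.log D ≤ 1 / q * (cD * l) := by gcongr
        linarith
    _ ≤ (4 + cK + cM) * (2 * (l / q)) + 1 / q * (cD * l) := by
        have h4 : l ≤ 2 * (l / q) := by
          rw [← mul_div_assoc, le_div_iff₀ hq]
          nlinarith
        have h5 : 0 ≤ 4 + cK + cM := by
          have h6 : 0 ≤ cK * l := hlK.trans hK
          have h7 : 0 ≤ cM * l := hlM.trans hM
          have h8 : 0 ≤ cK := nonneg_of_mul_nonneg_left h6 (by linarith)
          have h9 : 0 ≤ cM := nonneg_of_mul_nonneg_left h7 (by linarith)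
          linarith
        gcongr
    _ = _ := by ring

set_option maxHeartbeats 1000000 in
/-- The parameters of the algorithm are chosen so that it takes `O(ε⁻⁴ n ^ (1 - 1 / ρ) ℓ⁴)` bits,
where `ℓ = log (2 n / ε)`: there are `O(ℓ)` rows of `O(k ℓ / η²)` buckets that hold `O(ℓ / q)` bits
each, `k = O(ε⁻² n ^ (1 - 1 / ρ))`, and `1 / (q η²) = O(ε⁻² ℓ)`. -/
theorem exists_alg_space_le (c : ℕ) {ρ γ C₀ : ℝ} (hρ : 1 ≤ ρ) (hγ : 0 < γ) (hγ1 : γ ≤ 1) :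
    ∃ C : ℝ, ∀ n : ℕ, 0 < n → ∀ ε : ℝ, 0 < ε → ε < 1 → ∀ q η : ℝ, 0 < q → q ≤ 2 → 0 < η →
      η ≤ 1 / 4 → 4 * q * η ≤ γ * ε / (16 * ρ) →
      1 / (q * η ^ 2) ≤ C₀ * (1 / ε) ^ 2 * Real.log (2 * n / ε) → ∀ post : ℝ → ℝ,
      ∃ (A : StreamAlg n) (F : A.Mem → (Fin n → Bool) → ℝ), A.Outputs F ∧
        (A.space : ℝ) ≤
          C * (1 / ε) ^ 4 * (n : ℝ) ^ (1 - 1 / ρ) * Real.log (2 * n / ε) ^ 4 ∧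
        ∀ (σ : List (Update n)), σ.length ≤ c * n ^ c → ∀ (s : Fin n → Bool) (good : ℝ → Prop),
          (∀ y, IsApprox ρ q (γ * ε) (accumulated σ) s y → good (post y)) →
          (9 / 10 : ENNReal) ≤ (A.final σ).toOuterMeasure {m | good (F m s)} := by
  have hρ0 : 0 < ρ := by linarith
  obtain ⟨k₁, hk₁⟩ : ∃ k₁ : ℝ, k₁ = 200000 + 4096 * 20000 * 64 / γ ^ 2 := ⟨_, rfl⟩
  have hk₁0 : 200000 ≤ k₁ := by
    have : 0 < 4096 * 20000 * 64 / γ ^ 2 := by positivity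
    linarith
  have hk₁κ : 4096 * 20000 * 64 / γ ^ 2 ≤ k₁ := by linarith
  clear hk₁
  have ha : (1 : ℝ) ≤ c + 1 := by
    have : (0 : ℝ) ≤ c := Nat.cast_nonneg c
    linarith
  have haK : 1 ≤ 64 * ρ / γ + 1 := by
    have : 0 < 64 * ρ / γ := by positivity
    linarith
  have haD : 1 ≤ 32 * ρ * (c + 1) ^ 2 / γ + 1 := by
    have : 0 < 32 * ρ * (c + 1) ^ 2 / γ := by positivity
    linarith
  -- logarithms of polynomially bounded quantities are at most these constants times `ℓ`
  obtain ⟨cK, hcK⟩ : ∃ x : ℝ, x = 2 * Real.log (64 * ρ / γ + 1) + (1 : ℕ) := ⟨_, rfl⟩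
  obtain ⟨cM, hcM⟩ : ∃ x : ℝ, x = 2 * Real.log (c + 1) + c := ⟨_, rfl⟩
  obtain ⟨cD, hcD⟩ : ∃ x : ℝ, x = 2 * Real.log (32 * ρ * (c + 1) ^ 2 / γ + 1) + (2 * c + 1 : ℕ) :=
    ⟨_, rfl⟩
  obtain ⟨cT, hcT⟩ : ∃ x : ℝ, x = 2 * Real.log (30 * (c + 1)) + (c + 1 : ℕ) := ⟨_, rfl⟩
  have hcK0 : 0 ≤ cK := by
    have := Real.log_nonneg haK
    rw [hcK]
    positivity
  have hcM0 : 0 ≤ cM := by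
    have := Real.log_nonneg ha
    rw [hcM]
    positivity
  have hcD0 : 0 ≤ cD := by
    have := Real.log_nonneg haD
    rw [hcD]
    positivity
  have hcT0 : 0 ≤ cT := by
    have := Real.log_nonneg (by linarith : (1 : ℝ) ≤ 30 * (c + 1))
    rw [hcT]
    positivity
  refine ⟨2 * (8 * cT + 48 * 256001 * (2 * (4 + cK + cM) + cD) * (2 + cD) * C₀ * k₁ +
    2 * (16001 * k₁ * (2 + cD) * 8)) + 16, ?_⟩
  intro n hn ε hε hε1 q η hq hq2 hη hη1 hηδ hqη post
  have hn1 : (1 : ℝ) ≤ n := by exact_mod_cast hn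
  obtain ⟨Q, hQ⟩ : ∃ Q : ℝ, Q = 2 * n / ε := ⟨_, rfl⟩
  have hε' : 1 ≤ 1 / ε := by rw [le_div_iff₀ hε]; linarith
  have hQn : n * (1 / ε) ≤ Q := by
    have h0 : n * (1 / ε) = n / ε := by ring
    have h1 : (0 : ℝ) < n / ε := by positivity
    have h2 : (2 : ℝ) * n / ε = n / ε + n / ε := by ring
    rw [h0, hQ, h2]
    linarith
  have hQ2 : 2 ≤ Q := by
    rw [hQ, le_div_iff₀ hε]
    nlinarith
  have hnQ : n ≤ Q := le_trans (le_mul_of_one_le_right (by linarith) hε') hQn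
  have hεQ : 1 / ε ≤ Q := le_trans (le_mul_of_one_le_left (by linarith) hn1) hQn
  rw [← hQ] at hqη ⊢
  obtain ⟨l, hl⟩ : ∃ l : ℝ, l = Real.log Q := ⟨_, rfl⟩
  have hl2 : 1 / 2 ≤ l := by
    have h1 := Real.log_le_log (by norm_num) hQ2
    have h2 := Real.log_two_gt_d9
    linarith
  rw [← hl] at hqη ⊢
  obtain ⟨E, hE⟩ : ∃ E : ℝ, E = (1 / ε) ^ 2 := ⟨_, rfl⟩
  have hE1 : 1 ≤ E := by
    rw [hE]
    exact one_le_pow₀ hε'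
  have hE4 : (1 / ε) ^ 4 = E ^ 2 := by rw [hE]; ring
  rw [← hE] at hqη
  rw [hE4]
  obtain ⟨G, hG⟩ : ∃ G : ℝ, G = (n : ℝ) ^ (1 - 1 / ρ) := ⟨_, rfl⟩
  have hG1 : 1 ≤ G := by
    rw [hG]
    refine Real.one_le_rpow hn1 ?_
    rw [sub_nonneg, div_le_one hρ0]
    exact hρ
  rw [← hG]
  -- the parameters
  obtain ⟨k, hk⟩ : ∃ k : ℝ, k = k₁ * E * G := ⟨_, rfl⟩
  obtain ⟨K, hK⟩ : ∃ K : ℕ, K = ⌈64 * ρ / γ * Q⌉₊ := ⟨_, rfl⟩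
  obtain ⟨M, hM⟩ : ∃ M : ℕ, M = c * n ^ c + 1 := ⟨_, rfl⟩
  obtain ⟨D, hD⟩ : ∃ D : ℕ, D = ⌈32 * ρ * (c + 1) ^ 2 / γ * Q ^ (2 * c + 1)⌉₊ := ⟨_, rfl⟩
  have hEG : 1 ≤ E * G := one_le_mul_of_one_le_of_one_le hE1 hG1
  have hkbig : 200000 ≤ k := by
    rw [hk, mul_assoc]
    exact hk₁0.trans (le_mul_of_one_le_right (by linarith) hEG)
  have hkκ : 4096 * 20000 * 64 / (γ * ε) ^ 2 * (n : ℝ) ^ (1 - 1 / ρ) ≤ k := by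
    have h1 : 4096 * 20000 * 64 / (γ * ε) ^ 2 = 4096 * 20000 * 64 / γ ^ 2 * E := by
      rw [hE]
      field_simp
    rw [h1, hk, ← hG]
    gcongr
  have hKpos : 0 < K := by
    rw [hK]
    exact Nat.ceil_pos.2 (by positivity)
  have hDpos : 0 < D := by
    rw [hD]
    exact Nat.ceil_pos.2 (by positivity)
  have hKge : 64 * ρ / (γ * ε) ≤ K := by
    calc 64 * ρ / (γ * ε) = 64 * ρ / γ * (1 / ε) := by field_simp
      _ ≤ 64 * ρ / γ * Q := by gcongr
      _ ≤ K := hK ▸ Nat.le_ceil _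
  have hMpos : 0 < M := by omega
  have hMQ : (M : ℝ) ≤ (c + 1) * Q ^ c := by
    rw [hM]
    push_cast
    have h1 : (n : ℝ) ^ c ≤ Q ^ c := by gcongr
    have h2 : (1 : ℝ) ≤ Q ^ c := one_le_pow₀ (by linarith)
    have h3 : (c : ℝ) * (n : ℝ) ^ c ≤ c * Q ^ c := by gcongr
    linarith
  have hDge : 32 * ρ * n * (M : ℝ) ^ 2 / (γ * ε) ≤ D := by
    calc 32 * ρ * n * (M : ℝ) ^ 2 / (γ * ε) = 32 * ρ / γ * (n * (1 / ε)) * (M : ℝ) ^ 2 := by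
          field_simp
      _ ≤ 32 * ρ / γ * Q * ((c + 1) * Q ^ c) ^ 2 := by gcongr
      _ = 32 * ρ * (c + 1) ^ 2 / γ * Q ^ (2 * c + 1) := by ring
      _ ≤ D := hD ▸ Nat.le_ceil _
  have hlogK : Real.log K ≤ cK * l := by
    rw [hcK, hl]
    refine log_le_mul_log 1 (by exact_mod_cast hKpos) haK hQ2 ?_
    rw [pow_one, hK]
    exact ceil_le_mul (by linarith) (by positivity)
  have hlogM : Real.log M ≤ cM * l := by
    rw [hcM, hl]
    exact log_le_mul_log c (by exact_mod_cast hMpos) ha hQ2 hMQ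
  have hlogD : Real.log D ≤ cD * l := by
    rw [hcD, hl]
    refine log_le_mul_log (2 * c + 1) (by exact_mod_cast hDpos) haD hQ2 ?_
    rw [hD]
    exact ceil_le_mul (one_le_pow₀ (by linarith)) (by positivity)
  have hlogD0 : 0 ≤ Real.log D := Real.log_nonneg (by exact_mod_cast hDpos)
  obtain ⟨d, hd⟩ : ∃ d : ℝ, d = 1 + Real.log D := ⟨_, rfl⟩
  have hd1 : 1 ≤ d := by linarith
  have hdl : d ≤ (2 + cD) * l := by linarith
  obtain ⟨B, hB⟩ : ∃ B : ℕ, B = ⌈256000 * (k * d / η ^ 2)⌉₊ := ⟨_, rfl⟩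
  obtain ⟨L, hL⟩ : ∃ L : ℕ, L = ⌈16000 * (k * d)⌉₊ := ⟨_, rfl⟩
  have hkd : 1 ≤ k * d := one_le_mul_of_one_le_of_one_le (by linarith) hd1
  have hη2 : η ^ 2 ≤ 1 := pow_le_one₀ hη.le (by linarith)
  have hkdη : 1 ≤ k * d / η ^ 2 := by
    rw [le_div_iff₀ (by positivity)]
    linarith
  have hBpos : 0 < B := by
    rw [hB]
    exact Nat.ceil_pos.2 (by positivity)
  have hBge : 32 * (8000 * k * (1 + Real.log D)) / η ^ 2 ≤ B := by
    rw [← hd]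
    refine le_trans (le_of_eq ?_) (hB ▸ Nat.le_ceil _)
    ring
  have hBle : (B : ℝ) ≤ 256001 * (k * d / η ^ 2) := by
    rw [hB]
    exact (ceil_le_mul hkdη (by norm_num)).trans (le_of_eq (by norm_num))
  have hLge : 16000 * k * (1 + Real.log D) ≤ L := by
    rw [← hd]
    refine le_trans (le_of_eq ?_) (hL ▸ Nat.le_ceil _)
    ring
  have hLle : (L : ℝ) ≤ 16001 * (k * d) := by
    rw [hL]
    exact (ceil_le_mul hkd (by norm_num)).trans (le_of_eq (by norm_num))
  obtain ⟨t, ht⟩ : ∃ t : ℕ, t = Nat.clog 2 n + 10 := ⟨_, rfl⟩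
  have htge : 1000 * n ≤ 4 ^ t := by
    rw [ht, pow_add, mul_comm]
    refine Nat.mul_le_mul ?_ (by norm_num)
    exact (Nat.le_pow_clog (by norm_num) n).trans (Nat.pow_le_pow_left (by norm_num) _)
  have htle : (t : ℝ) ≤ 24 * l := by
    have h1 := clog_two_le hn
    have h2 : Real.log n ≤ l := hl ▸ Real.log_le_log (by linarith) hnQ
    rw [ht]
    push_cast
    linarith
  have : NeZero B := ⟨hBpos.ne'⟩
  have : NeZero D := ⟨hDpos.ne'⟩
  obtain ⟨P, hP⟩ : ∃ P : ℕ, P = 2 * (⌊(K : ℝ) * (D : ℝ) ^ (1 / q)⌋₊ * M) + 1 := ⟨_, rfl⟩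
  have hlogP : Real.log P ≤ (2 * (4 + cK + cM) + cD) * (l / q) :=
    hP ▸ log_modulus_le hKpos hDpos hMpos hq hq2 hl2 hlogK hlogD hlogM
  obtain ⟨A, F, hF, hspace, hA⟩ := exists_alg (L := L) hn hρ hq hq2 (mul_pos hγ hε)
    (mul_le_one₀ hγ1 hε.le hε1.le) hη hη1 hηδ hkbig hkκ hKge hDge hMpos hBge hLge htge (by omega)
    hP post
  refine ⟨A, F, hF, ?_, fun σ hσ => hA σ (by omega)⟩
  -- the space bound
  have hT : 0 < 10 * (n * (2 * M + 1)) := by positivity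
  have hlogT : Real.log ((10 * (n * (2 * M + 1)) : ℕ) : ℝ) ≤ cT * l := by
    rw [hcT, hl]
    refine log_le_mul_log (c + 1) (by exact_mod_cast hT) (by linarith) hQ2 ?_
    push_cast
    have h1 : (1 : ℝ) ≤ M := by exact_mod_cast hMpos
    calc 10 * ((n : ℝ) * (2 * M + 1)) ≤ 10 * (Q * (3 * ((c + 1) * Q ^ c))) := by
          gcongr
          linarith
      _ = 30 * (c + 1) * Q ^ (c + 1) := by ring
  have hPpos : 0 < P := by omega
  have hcard := log_card_le (m := 2 * t * B) (L := L) hT hPpos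
  have hclog := clog_two_le (x := 10 * (n * (2 * M + 1)) * (P ^ (2 * t * B) * (2 ^ L * (L + 1))))
    (by positivity)
  rw [← hspace] at hclog
  -- `U` is the bound without its constant; the sketch dominates the other terms
  obtain ⟨U, hU⟩ : ∃ U : ℝ, U = E ^ 2 * G * l ^ 4 := ⟨_, rfl⟩
  have hl0 : 0 < l := by linarith
  have hl3 : 1 ≤ 8 * l ^ 3 := by
    have := pow_le_pow_left₀ (by norm_num) hl2 3
    linarith
  have hEGl : E * G * l ≤ 8 * U := by
    calc E * G * l = 1 * (E * G * l) * 1 := by ring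
      _ ≤ E * (E * G * l) * (8 * l ^ 3) := by gcongr
      _ = 8 * U := by rw [hU]; ring
  have hlU : l ≤ 8 * U := le_trans (le_mul_of_one_le_left hl0.le hEG) hEGl
  have hmain : ((2 * t * B : ℕ) : ℝ) * Real.log P ≤
      48 * 256001 * (2 * (4 + cK + cM) + cD) * (2 + cD) * C₀ * k₁ * U := by
    push_cast
    calc 2 * (t : ℝ) * B * Real.log P
        ≤ 2 * (24 * l) * (256001 * (k * ((2 + cD) * l) / η ^ 2)) *
          ((2 * (4 + cK + cM) + cD) * (l / q)) := by
          gcongr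
          refine hBle.trans ?_
          gcongr
      _ = 48 * 256001 * (2 * (4 + cK + cM) + cD) * (2 + cD) * k * l ^ 3 * (1 / (q * η ^ 2)) := by
          field_simp
          ring
      _ ≤ 48 * 256001 * (2 * (4 + cK + cM) + cD) * (2 + cD) * k * l ^ 3 * (C₀ * E * l) := by
          gcongr
      _ = _ := by rw [hU, hk]; ring
  have hLU : (L : ℝ) ≤ 16001 * k₁ * (2 + cD) * 8 * U := by
    calc (L : ℝ) ≤ 16001 * (k * ((2 + cD) * l)) := hLle.trans (by gcongr)
      _ = 16001 * k₁ * (2 + cD) * (E * G * l) := by rw [hk]; ring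
      _ ≤ 16001 * k₁ * (2 + cD) * (8 * U) := by gcongr
      _ = _ := by ring
  have hTU : cT * l ≤ cT * (8 * U) := by gcongr
  calc (A.space : ℝ) ≤ 2 * (cT * (8 * U) +
        48 * 256001 * (2 * (4 + cK + cM) + cD) * (2 + cD) * C₀ * k₁ * U +
        2 * (16001 * k₁ * (2 + cD) * 8 * U)) + 16 * U := by linarith
    _ = _ := by rw [hU]; ring

/-! ### From power sums to norms -/

theorem abs_sub_mul_rpow_le {a b p : ℝ} (ha : 0 ≤ a) (hb : 0 ≤ b) (hp : 1 ≤ p) :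
    |a - b| * b ^ (p - 1) ≤ |a ^ p - b ^ p| := by
  have h : ∀ y : ℝ, 0 ≤ y → y ^ p = y * y ^ (p - 1) := by
    intro y hy
    rw [mul_comm, ← Real.rpow_add_one' hy (by linarith), sub_add_cancel]
  rcases le_total b a with hab | hab
  · rw [abs_of_nonneg (by linarith), h a ha, h b hb]
    have h1 : b ^ (p - 1) ≤ a ^ (p - 1) := Real.rpow_le_rpow hb hab (by linarith)
    have h2 : a * b ^ (p - 1) ≤ a * a ^ (p - 1) := by gcongr
    refine le_trans ?_ (le_abs_self _)
    linarith
  · rw [abs_of_nonpos (by linarith), h a ha, h b hb]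
    have h1 : a ^ (p - 1) ≤ b ^ (p - 1) := Real.rpow_le_rpow ha hab (by linarith)
    have h2 : a * a ^ (p - 1) ≤ a * b ^ (p - 1) := by gcongr
    refine le_trans ?_ (neg_le_abs _)
    linarith

/-- The mean value inequality for `y ↦ y ^ r` on `[0, c]`. -/
theorem abs_rpow_sub_rpow_le {a b r c : ℝ} (ha : 0 ≤ a) (hb : 0 ≤ b) (hac : a ≤ c) (hbc : b ≤ c)
    (hr : 1 ≤ r) : |a ^ r - b ^ r| ≤ r * c ^ (r - 1) * |a - b| := by
  have h : ∀ x y : ℝ, 0 ≤ x → x ≤ y → y ≤ c → y ^ r - x ^ r ≤ r * c ^ (r - 1) * (y - x) := by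
    intro x y hx hxy hyc
    rcases (hx.trans hxy).eq_or_lt with hy | hy
    · have : x = 0 := le_antisymm (hy ▸ hxy) hx
      subst hy
      simp [this]
    · have h1 := one_add_mul_self_le_rpow_one_add
        (by rw [le_sub_iff_add_le]; have : 0 ≤ x / y := by positivity
            linarith : -1 ≤ x / y - 1) hr
      rw [add_sub_cancel, Real.div_rpow hx hy.le, le_div_iff₀ (by positivity)] at h1
      have h2 : y ^ r = y ^ (r - 1) * y := by
        rw [← Real.rpow_add_one hy.ne', sub_add_cancel]
      have h3 : y ^ (r - 1) ≤ c ^ (r - 1) := Real.rpow_le_rpow hy.le hyc (by linarith)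
      have h4 : (1 + r * (x / y - 1)) * y ^ r = y ^ r - r * y ^ (r - 1) * (y - x) := by
        rw [h2]
        field_simp
        ring
      rw [h4] at h1
      have h5 : r * y ^ (r - 1) * (y - x) ≤ r * c ^ (r - 1) * (y - x) := by
        have : 0 ≤ y - x := by linarith
        gcongr
      linarith
  rcases le_total a b with hab | hab
  · rw [abs_sub_comm, abs_sub_comm a b, abs_of_nonneg (sub_nonneg.2 hab), abs_of_nonneg]
    · exact h a b ha hab hbc
    · exact sub_nonneg.2 (Real.rpow_le_rpow ha hab (by linarith))
  · rw [abs_of_nonneg (sub_nonneg.2 hab), abs_of_nonneg]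
    · exact h b a hb hab hac
    · exact sub_nonneg.2 (Real.rpow_le_rpow hb hab (by linarith))

/-- For `p ≥ 1` the error bound `ε N ^ (1 / (2 ρ)) X ^ (1 - 1 / (2 ρ))` for the power sum `X` is at
most `ε N ^ (1 / p) X ^ (1 - 1 / p)`, hence gives an error `ε N ^ (1 / p)` for `X ^ (1 / p)`. -/
theorem abs_root_sub_root_le_of_one_le {y X N p ρ ε : ℝ} (hp : 1 ≤ p) (hρ : 1 ≤ ρ)
    (hpρ : p ≤ 2 * ρ) (hy : 0 ≤ y) (hX : 0 ≤ X) (hXN : X ≤ N) (hε : 0 ≤ ε)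
    (h : |y - X| ≤ ε * (N ^ (1 / (2 * ρ)) * X ^ (1 - 1 / (2 * ρ)))) :
    |y ^ (1 / p) - X ^ (1 / p)| ≤ ε * N ^ (1 / p) := by
  have hp0 : 0 < p := by linarith
  have hN : 0 ≤ N := hX.trans hXN
  have hexp : 0 < 1 - 1 / (2 * ρ) := by
    have : 1 / (2 * ρ) < 1 := by rw [div_lt_one (by linarith)]; linarith
    linarith
  rcases hX.eq_or_lt with hX0 | hX0
  · rw [← hX0, Real.zero_rpow hexp.ne', mul_zero, mul_zero, sub_zero] at h
    have hy0 : y = 0 := abs_eq_zero.1 (le_antisymm h (abs_nonneg _))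
    rw [← hX0, hy0, sub_self, abs_zero]
    positivity
  · have h1 := abs_sub_mul_rpow_le (a := y ^ (1 / p)) (b := X ^ (1 / p)) (by positivity)
      (by positivity) hp
    rw [← Real.rpow_mul hy, ← Real.rpow_mul hX, ← Real.rpow_mul hX, one_div_mul_cancel hp0.ne',
      Real.rpow_one, Real.rpow_one] at h1
    have hpos : 0 < X ^ (1 / p * (p - 1)) := by positivity
    refine le_of_mul_le_mul_right (h1.trans (h.trans ?_)) hpos
    have hle : 0 ≤ 1 / p - 1 / (2 * ρ) :=
      sub_nonneg.2 (one_div_le_one_div_of_le hp0 hpρ)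
    calc ε * (N ^ (1 / (2 * ρ)) * X ^ (1 - 1 / (2 * ρ)))
        = ε * (N ^ (1 / (2 * ρ)) * X ^ (1 / p - 1 / (2 * ρ))) * X ^ (1 / p * (p - 1)) := by
          rw [mul_assoc, mul_assoc, ← Real.rpow_add hX0]
          congr 3
          field_simp
          ring
      _ ≤ ε * (N ^ (1 / (2 * ρ)) * N ^ (1 / p - 1 / (2 * ρ))) * X ^ (1 / p * (p - 1)) := by
          gcongr
      _ = ε * N ^ (1 / p) * X ^ (1 / p * (p - 1)) := by
          rw [← Real.rpow_add (hX0.trans_le hXN), add_sub_cancel]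

/-- For `p ≤ 1` the function `y ↦ y ^ (1 / p)` has derivative at most `(2 N) ^ (1 / p - 1) / p` on
`[0, 2 N]`, which the factor `p / 2 ^ (1 / p)` in the hypothesis compensates. -/
theorem abs_root_sub_root_le_of_le_one {y X N p ε : ℝ} (hp : 0 < p) (hp1 : p ≤ 1) (hy : 0 ≤ y)
    (hX : 0 ≤ X) (hXN : X ≤ N) (hε : 0 ≤ ε) (hε1 : ε ≤ 1)
    (h : |y - X| ≤ p / 2 ^ (1 / p) * ε * N) :
    |y ^ (1 / p) - X ^ (1 / p)| ≤ ε * N ^ (1 / p) := by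
  have hN : 0 ≤ N := hX.trans hXN
  have hr : 1 ≤ 1 / p := by rwa [le_div_iff₀ hp, one_mul]
  have h2 : (1 : ℝ) ≤ 2 ^ (1 / p) := Real.one_le_rpow (by norm_num) (by positivity)
  have hγ : p / 2 ^ (1 / p) * ε ≤ 1 := by
    refine mul_le_one₀ ?_ hε hε1
    rw [div_le_one (by positivity)]
    linarith
  have hyN : y ≤ 2 * N := by
    have h3 := (abs_le.1 h).2
    nlinarith
  refine (abs_rpow_sub_rpow_le hy hX hyN (by linarith) hr).trans ?_
  calc 1 / p * (2 * N) ^ (1 / p - 1) * |y - X|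
      ≤ 1 / p * (2 * N) ^ (1 / p - 1) * (p / 2 ^ (1 / p) * ε * N) := by gcongr
    _ = (2 * N) ^ (1 / p - 1) * (N / 2 ^ (1 / p)) * ε := by field_simp
    _ = 2 ^ (1 / p - 1) / 2 ^ (1 / p) * (N ^ (1 / p - 1) * N) * ε := by
        rw [Real.mul_rpow (by norm_num) hN]
        ring
    _ = 1 / 2 * N ^ (1 / p) * ε := by
        rw [← Real.rpow_add_one' hN (by rw [sub_add_cancel]; positivity), sub_add_cancel,
          ← Real.rpow_sub (by norm_num)]
        norm_num
    _ ≤ ε * N ^ (1 / p) := by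
        have : 0 ≤ N ^ (1 / p) * ε := by positivity
        linarith

section Norm

variable {n : ℕ} {p q ρ ε : ℝ} {v : Fin n → ℝ} {s : Fin n → Bool}

theorem lpNorm_restrict (hp : p ≠ 0) (hpq : p = q * ρ) :
    lpNorm p (restrict v s) = subsetSum ρ s (fun i => |v i| ^ q) ^ (1 / p) := by
  rw [lpNorm, if_neg hp, subsetSum]
  congr 1
  refine Finset.sum_congr rfl fun i _ => ?_
  by_cases h : s i = true
  · simp only [restrict, h, if_true]
    rw [← Real.rpow_mul (abs_nonneg _), hpq]
  · simp [restrict, h, Real.zero_rpow hp]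

theorem lpNorm_eq (hp : p ≠ 0) (hpq : p = q * ρ) :
    lpNorm p v = subsetSum ρ (fun _ => true) (fun i => |v i| ^ q) ^ (1 / p) :=
  lpNorm_restrict (s := fun _ => true) hp hpq

/-- For `p > 0` the estimate of the power sum gives an estimate of the norm. -/
theorem abs_root_sub_lpNorm_le {γ y : ℝ} (hp : 0 < p) (hq2 : q ≤ 2) (hpq : p = q * ρ)
    (hρ : 1 ≤ ρ) (hε : 0 ≤ ε) (hε1 : ε ≤ 1)
    (hγ : 1 ≤ p ∧ γ = 1 ∨ p ≤ 1 ∧ ρ = 1 ∧ γ = p / 2 ^ (1 / p))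
    (h : IsApprox ρ q (γ * ε) v s y) :
    |max y 0 ^ (1 / p) - lpNorm p (restrict v s)| ≤ ε * lpNorm p v := by
  rw [lpNorm_restrict hp.ne' hpq, lpNorm_eq hp.ne' hpq]
  have hx : ∀ i, 0 ≤ |v i| ^ q := fun i => by positivity
  have hX0 : 0 ≤ subsetSum ρ s (fun i => |v i| ^ q) := subsetSum_nonneg hx
  have hXN : subsetSum ρ s (fun i => |v i| ^ q) ≤
      subsetSum ρ (fun _ => true) (fun i => |v i| ^ q) := subsetSum_le_univ hx
  unfold IsApprox at h
  generalize subsetSum ρ s (fun i => |v i| ^ q) = X at *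
  generalize subsetSum ρ (fun _ => true) (fun i => |v i| ^ q) = N at *
  have hN0 : 0 ≤ N := hX0.trans hXN
  have h' : |max y 0 - X| ≤ γ * ε * (N ^ (1 / (2 * ρ)) * X ^ (1 - 1 / (2 * ρ))) := by
    refine le_trans ?_ h
    have := abs_max_sub_max_le_abs y X 0
    rwa [max_eq_left hX0] at this
  have hpρ : p ≤ 2 * ρ := by
    rw [hpq]
    gcongr
  rcases hγ with ⟨hp1, hγ⟩ | ⟨hp1, hρ1, hγ⟩
  · rw [hγ, one_mul] at h'
    exact abs_root_sub_root_le_of_one_le hp1 hρ hpρ (le_max_right _ _) hX0 hXN hε h'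
  · refine abs_root_sub_root_le_of_le_one hp hp1 (le_max_right _ _) hX0 hXN hε hε1 (h'.trans ?_)
    rw [← hγ]
    have hγ0 : 0 ≤ γ := by rw [hγ]; positivity
    gcongr
    rw [hρ1]
    calc N ^ (1 / (2 * 1 : ℝ)) * X ^ (1 - 1 / (2 * 1 : ℝ))
        ≤ N ^ (1 / (2 * 1 : ℝ)) * N ^ (1 - 1 / (2 * 1 : ℝ)) := by
          gcongr
      _ = N := by
          rw [← Real.rpow_add' hN0 (by norm_num)]
          norm_num

theorem lpNorm_zero_restrict :
    lpNorm 0 (restrict v s) = ∑ i, if s i = true then (if v i ≠ 0 then (1 : ℝ) else 0) else 0 := by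
  rw [lpNorm, if_pos rfl, Finset.card_filter]
  push_cast
  refine Finset.sum_congr rfl fun i _ => ?_
  by_cases h : s i = true
  · simp [restrict, h]
  · simp [restrict, h]

/-- For `p = 0` and integer vectors with entries at most `M`, the power sums with an exponent `q` of
order `ε / log M` approximate the number of non-zero coordinates. -/
theorem abs_sub_lpNorm_zero_le {M y : ℝ} (hq : 0 < q) (hε : 0 < ε) (hε1 : ε ≤ 1) (hM : 1 ≤ M)
    (hqM : q * Real.log M ≤ ε / 8) (hv : ∀ i, v i = 0 ∨ 1 ≤ |v i| ∧ |v i| ≤ M)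
    (h : IsApprox 1 q (1 / 4 * ε) v s y) :
    |y - lpNorm 0 (restrict v s)| ≤ ε * lpNorm 0 v := by
  have hMq : M ^ q ≤ 1 + ε / 4 := by
    rw [Real.rpow_def_of_pos (by linarith), mul_comm]
    have h0 : 0 ≤ q * Real.log M := mul_nonneg hq.le (Real.log_nonneg hM)
    exact (exp_le_one_add_two_mul h0 (by linarith)).trans (by linarith)
  have hsum : ∀ s' : Fin n → Bool,
      lpNorm 0 (restrict v s') ≤ subsetSum 1 s' (fun i => |v i| ^ q) ∧
      subsetSum 1 s' (fun i => |v i| ^ q) ≤ (1 + ε / 4) * lpNorm 0 (restrict v s') := by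
    intro s'
    rw [lpNorm_zero_restrict, subsetSum, Finset.mul_sum]
    constructor
    · refine Finset.sum_le_sum fun i _ => ?_
      rcases hv i with h0 | ⟨h1, h2⟩
      · simp [h0, Real.zero_rpow hq.ne']
      · have h3 : v i ≠ 0 := by
          rintro h0
          rw [h0, abs_zero] at h1
          linarith
        simp only [h3, ne_eq, not_false_eq_true, if_true, Real.rpow_one]
        split_ifs
        · exact Real.one_le_rpow h1 hq.le
        · exact le_rfl
    · refine Finset.sum_le_sum fun i _ => ?_
      rcases hv i with h0 | ⟨h1, h2⟩
      · simp [h0, Real.zero_rpow hq.ne']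
      · have h3 : v i ≠ 0 := by
          rintro h0
          rw [h0, abs_zero] at h1
          linarith
        simp only [h3, ne_eq, not_false_eq_true, if_true, Real.rpow_one]
        split_ifs
        · rw [mul_one]
          exact (Real.rpow_le_rpow (abs_nonneg _) h2 hq.le).trans hMq
        · simp
  have hx : ∀ i, 0 ≤ |v i| ^ q := fun i => by positivity
  have hX0 : 0 ≤ subsetSum 1 s (fun i => |v i| ^ q) := subsetSum_nonneg hx
  have hXN : subsetSum 1 s (fun i => |v i| ^ q) ≤
      subsetSum 1 (fun _ => true) (fun i => |v i| ^ q) := subsetSum_le_univ hx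
  have hS := hsum s
  have hT : subsetSum 1 (fun _ => true) (fun i => |v i| ^ q) ≤ (1 + ε / 4) * lpNorm 0 v :=
    (hsum fun _ => true).2
  have hT' : lpNorm 0 (restrict v s) ≤ lpNorm 0 v := by
    have e : lpNorm 0 v = lpNorm 0 (restrict v fun _ => true) := rfl
    rw [e, lpNorm_zero_restrict, lpNorm_zero_restrict]
    refine Finset.sum_le_sum fun i _ => ?_
    by_cases h : s i = true
    · simp [h]
    · simp only [h]
      split_ifs <;> norm_num
  have hX0' : 0 ≤ lpNorm 0 (restrict v s) := by
    rw [lpNorm, if_pos rfl]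
    positivity
  unfold IsApprox at h
  generalize subsetSum 1 s (fun i => |v i| ^ q) = X at *
  generalize subsetSum 1 (fun _ => true) (fun i => |v i| ^ q) = N at *
  generalize lpNorm 0 (restrict v s) = X' at *
  generalize lpNorm 0 v = N' at *
  have hN0 : 0 ≤ N := hX0.trans hXN
  have hG : N ^ (1 / (2 * 1 : ℝ)) * X ^ (1 - 1 / (2 * 1 : ℝ)) ≤ N := by
    calc N ^ (1 / (2 * 1 : ℝ)) * X ^ (1 - 1 / (2 * 1 : ℝ))
        ≤ N ^ (1 / (2 * 1 : ℝ)) * N ^ (1 - 1 / (2 * 1 : ℝ)) := by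
          gcongr
      _ = N := by
          rw [← Real.rpow_add' hN0 (by norm_num)]
          norm_num
  have h1 : |y - X| ≤ 1 / 4 * ε * N := h.trans (by gcongr)
  have h2 : 1 / 4 * ε * N ≤ 1 / 4 * ε * ((1 + ε / 4) * N') := by gcongr
  have hεN : 0 ≤ ε * N' := mul_nonneg hε.le (hX0'.trans hT')
  have h3 : ε * (ε * N') ≤ 1 * (ε * N') := by gcongr
  have h4 : ε * X' ≤ ε * N' := by gcongr
  rw [abs_le] at h1 ⊢
  constructor
  · linarith [h1.1, hS.1]
  · linarith [h1.2, hS.2]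

end Norm

end SubsetNorm

open SubsetNorm in
theorem mainTheorem7 (p : ℝ) (hp : 0 ≤ p) (c : ℕ) :
    ∃ (C : ℝ) (d : ℕ), ∀ (n : ℕ), 0 < n → ∀ ε : ℝ, 0 < ε → ε < 1 →
      ∃ (A : StreamAlg n) (F : A.Mem → (Fin n → Bool) → ℝ),
        A.Outputs F ∧
        (∀ σ : List (Update n), σ.length ≤ c * n ^ c → ∀ s : Fin n → Bool,
          (9 / 10 : ENNReal) ≤ (A.final σ).toOuterMeasure
            {m | |F m s - lpNorm p (restrict (accumulated σ) s)|
              ≤ ε * lpNorm p (accumulated σ)}) ∧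
        (p ≤ 2 → (A.space : ℝ) ≤ C * (1 / ε) ^ 4 * Real.log (2 * n / ε) ^ d) ∧
        (2 < p → (A.space : ℝ) ≤
          C * (1 / ε) ^ 4 * (n : ℝ) ^ (1 - 2 / p) * Real.log (2 * n / ε) ^ d) := by
  have hlog : ∀ (n : ℕ) (ε : ℝ), 0 < n → 0 < ε → ε < 1 → 1 / 2 ≤ Real.log (2 * n / ε) := by
    intro n ε hn hε hε1
    have hn1 : (1 : ℝ) ≤ n := by exact_mod_cast hn
    have h1 := Real.log_le_log (by norm_num : (0 : ℝ) < 2)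
      (show (2 : ℝ) ≤ 2 * n / ε by rw [le_div_iff₀ hε]; nlinarith)
    have h2 := Real.log_two_gt_d9
    linarith
  rcases hp.eq_or_lt with rfl | hp0
  · -- `p = 0`: the exponent `q` tends to zero with `ε`, and `η` is constant
    obtain ⟨cM, hcM⟩ : ∃ x : ℝ, x = 2 * Real.log (c + 1) + c := ⟨_, rfl⟩
    have ha : (1 : ℝ) ≤ c + 1 := by
      have : (0 : ℝ) ≤ c := Nat.cast_nonneg c
      linarith
    have hcM0 : 0 ≤ cM := by
      have := Real.log_nonneg ha
      rw [hcM]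
      positivity
    obtain ⟨C, hC⟩ := exists_alg_space_le c (ρ := 1) (γ := 1 / 4) (C₀ := 1024 * (cM + 2)) le_rfl
      (by norm_num) (by norm_num)
    refine ⟨C, 4, fun n hn ε hε hε1 => ?_⟩
    have hn1 : (1 : ℝ) ≤ n := by exact_mod_cast hn
    have hl := hlog n ε hn hε hε1
    have hQ2 : (2 : ℝ) ≤ 2 * n / ε := by
      rw [le_div_iff₀ hε]
      nlinarith
    obtain ⟨M, hM⟩ : ∃ M : ℕ, M = c * n ^ c + 1 := ⟨_, rfl⟩
    have hM1 : (1 : ℝ) ≤ M := by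
      rw [hM]
      push_cast
      have : (0 : ℝ) ≤ c * (n : ℝ) ^ c := by positivity
      linarith
    have hMlog : Real.log M ≤ cM * Real.log (2 * n / ε) := by
      rw [hcM]
      refine log_le_mul_log c (by linarith) ha hQ2 ?_
      rw [hM]
      push_cast
      have h0 : (n : ℝ) ≤ 2 * n / ε := by
        rw [le_div_iff₀ hε]
        nlinarith
      have h1 : (n : ℝ) ^ c ≤ (2 * n / ε) ^ c := by gcongr
      have h2 : (1 : ℝ) ≤ (2 * n / ε) ^ c := one_le_pow₀ (by linarith)
      have h3 : (c : ℝ) * (n : ℝ) ^ c ≤ c * (2 * n / ε) ^ c := by gcongr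
      linarith
    have hlM := Real.log_nonneg hM1
    obtain ⟨q, hq⟩ : ∃ q : ℝ, q = ε / (64 * (Real.log M + 1)) := ⟨_, rfl⟩
    have hq0 : 0 < q := by rw [hq]; positivity
    have hqlog : q * (Real.log M + 1) = ε / 64 := by rw [hq]; field_simp
    have hq64 : q ≤ ε / 64 := by nlinarith
    obtain ⟨A, F, hF, hspace, hA⟩ := hC n hn ε hε hε1 q (1 / 4) hq0 (by linarith) (by norm_num)
      le_rfl (by linarith) (by
        have e : 1 / (q * (1 / 4) ^ 2) = 1024 * (Real.log M + 1) * (1 / ε) := by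
          rw [hq]
          field_simp
          norm_num
        rw [e]
        have hε2 : 1 ≤ 1 / ε := by rw [le_div_iff₀ hε]; linarith
        calc 1024 * (Real.log M + 1) * (1 / ε)
            ≤ 1024 * ((cM + 2) * Real.log (2 * n / ε)) * (1 / ε) ^ 2 := by
              gcongr
              · linarith
              · exact le_self_pow₀ hε2 (by norm_num)
          _ = _ := by ring) id
    refine ⟨A, F, hF, fun σ hσ s => hA σ hσ s
      (fun x => |x - lpNorm 0 (restrict (accumulated σ) s)| ≤ ε * lpNorm 0 (accumulated σ))
      fun y hy => ?_, fun _ => ?_, fun h => ?_⟩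
    · refine abs_sub_lpNorm_zero_le hq0 hε hε1.le hM1 (by nlinarith) (fun i => ?_) hy
      rw [accumulated_eq]
      by_cases h0 : accInt σ i = 0
      · left
        exact_mod_cast h0
      · right
        constructor
        · exact_mod_cast Int.one_le_abs h0
        · have h1 := (Finset.single_le_sum (f := fun i => |accInt σ i|)
            (fun j _ => abs_nonneg _) (Finset.mem_univ i)).trans (sum_abs_accInt_le σ)
          have h2 : |accInt σ i| ≤ (M : ℤ) := h1.trans (by exact_mod_cast (by omega))
          exact_mod_cast h2
    · simpa using hspace
    · linarith
  · -- `p > 0`: sample with probabilities proportional to `|v i| ^ min p 2`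
    obtain ⟨q, hq⟩ : ∃ q : ℝ, q = min p 2 := ⟨_, rfl⟩
    have hq0 : 0 < q := hq ▸ lt_min hp0 two_pos
    have hq2 : q ≤ 2 := hq ▸ min_le_right _ _
    have hqp : q ≤ p := hq ▸ min_le_left _ _
    obtain ⟨ρ, hρ⟩ : ∃ ρ : ℝ, ρ = p / q := ⟨_, rfl⟩
    have hpq : p = q * ρ := by rw [hρ]; field_simp
    have hρ1 : 1 ≤ ρ := by rwa [hρ, le_div_iff₀ hq0, one_mul]
    obtain ⟨γ, hγ, hγ0, hγ1, hγp⟩ : ∃ γ : ℝ,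
        (1 ≤ p ∧ γ = 1 ∨ p ≤ 1 ∧ ρ = 1 ∧ γ = p / 2 ^ (1 / p)) ∧ 0 < γ ∧ γ ≤ 1 ∧ γ ≤ p := by
      rcases le_total 1 p with h | h
      · exact ⟨1, Or.inl ⟨h, rfl⟩, one_pos, le_rfl, h⟩
      · have h2 : (1 : ℝ) ≤ 2 ^ (1 / p) := Real.one_le_rpow (by norm_num) (by positivity)
        have h3 : p / 2 ^ (1 / p) ≤ p := div_le_self hp0.le h2
        refine ⟨p / 2 ^ (1 / p), Or.inr ⟨h, ?_, rfl⟩, by positivity, h3.trans h, h3⟩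
        rw [hρ, hq, min_eq_left (by linarith), div_self hp0.ne']
    obtain ⟨C, hC⟩ := exists_alg_space_le c (ρ := ρ) (γ := γ) (C₀ := 2 * (64 * p) ^ 2 / (q * γ ^ 2))
      hρ1 hγ0 hγ1
    refine ⟨C, 4, fun n hn ε hε hε1 => ?_⟩
    have hl := hlog n ε hn hε hε1
    obtain ⟨A, F, hF, hspace, hA⟩ := hC n hn ε hε hε1 q (γ * ε / (64 * p)) hq0 hq2 (by positivity)
      (by
        rw [div_le_iff₀ (by positivity)]
        nlinarith)
      (by
        rw [hρ]
        apply le_of_eq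
        field_simp
        norm_num)
      (by
        have e : 1 / (q * (γ * ε / (64 * p)) ^ 2) =
            (64 * p) ^ 2 / (q * γ ^ 2) * (1 / ε) ^ 2 := by
          field_simp
        rw [e]
        have h1 : 0 < (64 * p) ^ 2 / (q * γ ^ 2) * (1 / ε) ^ 2 := by positivity
        have h2 : 2 * (64 * p) ^ 2 / (q * γ ^ 2) * (1 / ε) ^ 2 * Real.log (2 * n / ε) =
            (64 * p) ^ 2 / (q * γ ^ 2) * (1 / ε) ^ 2 * (2 * Real.log (2 * n / ε)) := by ring
        rw [h2]
        nlinarith)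
      (fun y => max y 0 ^ (1 / p))
    refine ⟨A, F, hF, fun σ hσ s => hA σ hσ s
      (fun x => |x - lpNorm p (restrict (accumulated σ) s)| ≤ ε * lpNorm p (accumulated σ))
      fun y hy =>
      abs_root_sub_lpNorm_le hp0 hq2 hpq hρ1 hε.le hε1.le hγ hy, fun h => ?_, fun h => ?_⟩
    · have : ρ = 1 := by rw [hρ, hq, min_eq_left h, div_self hp0.ne']
      rw [this] at hspace
      simpa using hspace
    · have : 1 / ρ = 2 / p := by rw [hρ, hq, min_eq_right h.le, one_div_div]
      rw [this] at hspace
      exact hspace
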